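/- Let $0<\underline m<\bar m$, $0<\underline f<\bar f$, $\eta\ge 1$, let $\Theta=[\underline m,\bar m]\times[\underline f,\bar f]$ be the type space, and $\mathcal C=\mathbb R_+\times[0,1]$ the set of contracts $(p,q)$ (price, quality). If a seller of type $\theta=(m,f)$ supplies $(p,q)$, his profit is $p-mq^\eta-f$. Let $\Phi:\mathcal C\to\mathbb R$ be a scoring rule, i.e. a smooth function, strictly increasing in $q$ and strictly decreasing in $p$. *Regularity.* For $s\in\operatorname{Im}\Phi$ let $u(s,\theta)$ be the largest profit of type $\theta$ from a contract of score $s$, let $u_1=\partial u/\partial s$, let $Q(s)$ be the set of qualities $q\in[0,1]$ for which some price $p\ge 0$ satisfies $\Phi(p,q)=s$, and for $q\in Q(s)$ let $P(s,q)$ be this price. Assume that for all $s\in\operatorname{Im}\Phi$: (a) at all $\theta\in\Theta$ with $u(s,\theta)\ge 0$, the derivatives $u_1(s,\theta)$ and $\frac{\partial}{\partial m}\left(\frac{u(s,\theta)}{|u_1(s,\theta)|}\right)$ exist, and the latter is continuous in $\theta$ and strictly negative; (b) for every $q\in[0,1]$ there is a $p\ge 0$ with $\Phi(p,q)\le s$;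 the function $P(s,\cdot)$ is smooth and strictly concave on $Q(s)$ with strictly decreasing derivative; $P_q(s,0)>\bar m$ if $0\in Q(s)$, and $P_q(s,1)<\underline m$ (if $Q(s)$ is more than the point $1$). *Auction.* Let $\mathcal G$ be the set of Lebesgue densities $g$ on $\Theta$ that are strictly positive almost everywhere. In the first-score auction two sellers, with types drawn independently from $g$, bid contracts; the contract of higher score wins (ties are broken by a fair coin) and the winner supplies his bid. A symmetric Bayes–Nash equilibrium at $g$ is a measurable map $\Theta\to\mathcal C$ that prescribes to every type $\theta\in\Theta$ a contract maximizing the probability of winning times the profit, given that the opponent bids according to the same map. *Moments.* A moment is a map $M(g)=\int_\Theta\zeta(\tau)g(\tau)\,d\tau$ on $\mathcal G$ with $\zeta:\Theta\to\mathbb R$ bounded and measurable. The auction can be implemented in $n$-moment strategies if there are symmetric equilibria $(p^*,q^*)(\cdot,g)$, one for each $g\in\mathcal G$, such that for every $\theta\in\Theta$ there are moments $M^1_\theta,\dots,M^n_\theta$ and a function $\varphi_\theta:\mathbb R^n\to\mathcal C$, differentiable at every point $(M^1_\theta(g),\dots,M^n_\theta(g))$ with $g\in\mathcal G$, such that $$(p^*,q^*)(\theta,g)=\varphi_\theta(M^1_\theta(g),\dots,M^n_\theta(g))\quad\text{for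 all } g\in\mathcal G.$$ **Theorem.** Under these assumptions, exactly one of the following holds: the first-score auction with scoring rule $\Phi$ can be implemented in $2$-moment strategies, or it cannot be implemented in $n$-moment strategies for any finite $n$. -/

import Mathlib

open MeasureTheory Set
open scoped ContDiff

namespace ScoreAuction

noncomputable section

/-- The cost environment of the two sellers: types `(m, f)` range over the nondegenerate rectangle
`[mLo, mHi] × [fLo, fHi]` in the open positive quadrant, and producing quality `q` costs type
`(m, f)` the amount `m * q ^ η + f`. -/
structure CostModel where
  mLo : ℝ
  mHi : ℝ
  fLo : ℝ
  fHi : ℝ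
  η : ℝ
  mLo_pos : 0 < mLo
  fLo_pos : 0 < fLo
  mLo_lt_mHi : mLo < mHi
  fLo_lt_fHi : fLo < fHi
  one_le_η : 1 ≤ η

/-- The type space. A type is a pair `(m, f)`. -/
def CostModel.types (M : CostModel) : Set (ℝ × ℝ) :=
  Icc M.mLo M.mHi ×ˢ Icc M.fLo M.fHi

/-- The cost `m * q ^ η + f` of type `θ = (m, f)` for quality `q`. -/
def CostModel.cost (M : CostModel) (θ : ℝ × ℝ) (q : ℝ) : ℝ :=
  θ.1 * q ^ M.η + θ.2

/-- The profit of type `θ` if he wins and has to supply the contract `c = (p, q)`. -/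
def CostModel.profit (M : CostModel) (θ c : ℝ × ℝ) : ℝ :=
  c.1 - M.cost θ c.2

/-- The contracts `(p, q)`: a price `p ≥ 0` and a quality `q ∈ [0, 1]`. -/
def contracts : Set (ℝ × ℝ) := Ici 0 ×ˢ Icc 0 1

/-- Scoring rules: smooth on the contract space, strictly increasing in quality and strictly
decreasing in price. Values outside the contract space play no role. -/
structure IsScoringRule (Φ : ℝ × ℝ → ℝ) : Prop where
  smooth : ContDiffOn ℝ ∞ Φ contracts
  increasing_quality : ∀ p ∈ Ici (0 : ℝ), StrictMonoOn (fun q => Φ (p, q)) (Icc 0 1)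
  decreasing_price : ∀ q ∈ Icc (0 : ℝ) 1, StrictAntiOn (fun p => Φ (p, q)) (Ici 0)

/-- The indirect utility `u(s, θ)`: the best profit, conditional on winning, that type `θ` can get
from a contract of score `s`. -/
def indirectUtility (M : CostModel) (Φ : ℝ × ℝ → ℝ) (s : ℝ) (θ : ℝ × ℝ) : ℝ :=
  sSup (M.profit θ '' {c | c ∈ contracts ∧ Φ c = s})

/-- The derivative `u₁(s, θ)` of the indirect utility in the score. -/
def indirectUtilityDeriv (M : CostModel) (Φ : ℝ × ℝ → ℝ) (s : ℝ) (θ : ℝ × ℝ) : ℝ :=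
  deriv (fun t => indirectUtility M Φ t θ) s

/-- The ratio `u(s, θ) / |u₁(s, θ)|`. -/
def utilityRatio (M : CostModel) (Φ : ℝ × ℝ → ℝ) (s : ℝ) (θ : ℝ × ℝ) : ℝ :=
  indirectUtility M Φ s θ / |indirectUtilityDeriv M Φ s θ|

/-- The derivative of `u(s, (m, f)) / |u₁(s, (m, f))|` in `m` (one-sided at the two ends of the
range of marginal costs). -/
def utilityRatioDeriv (M : CostModel) (Φ : ℝ × ℝ → ℝ) (s : ℝ) (θ : ℝ × ℝ) : ℝ :=
  derivWithin (fun m => utilityRatio M Φ s (m, θ.2)) (Icc M.mLo M.mHi) θ.1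

/-- The qualities at which some nonnegative price yields the score `s`. -/
def feasibleQualities (Φ : ℝ × ℝ → ℝ) (s : ℝ) : Set ℝ :=
  {q | q ∈ Icc (0 : ℝ) 1 ∧ ∃ p, 0 ≤ p ∧ Φ (p, q) = s}

/-- The price `P(s, q)` that yields the score `s` at quality `q`: for a scoring rule and a feasible
quality, the set below has exactly one element. -/
def requiredPrice (Φ : ℝ × ℝ → ℝ) (s q : ℝ) : ℝ :=
  sSup {p | 0 ≤ p ∧ Φ (p, q) = s}

/-- The derivative `P_q(s, q)` of the required price in quality (one-sided at the ends of the
interval of feasible qualities). -/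
def requiredPriceDeriv (Φ : ℝ × ℝ → ℝ) (s q : ℝ) : ℝ :=
  derivWithin (requiredPrice Φ s) (feasibleQualities Φ s) q

/-- Regularity of a scoring rule. Single crossing is imposed at the scores that give the type a
nonnegative profit. -/
structure IsRegular (M : CostModel) (Φ : ℝ × ℝ → ℝ) : Prop where
  utility_differentiable : ∀ s ∈ Φ '' contracts, ∀ θ ∈ M.types,
    0 ≤ indirectUtility M Φ s θ → DifferentiableAt ℝ (fun t => indirectUtility M Φ t θ) s
  ratio_differentiable : ∀ s ∈ Φ '' contracts, ∀ θ ∈ M.types,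
    0 ≤ indirectUtility M Φ s θ →
      DifferentiableWithinAt ℝ (fun m => utilityRatio M Φ s (m, θ.2)) (Icc M.mLo M.mHi) θ.1
  ratio_deriv_continuous : ∀ s ∈ Φ '' contracts,
    ContinuousOn (utilityRatioDeriv M Φ s) {θ | θ ∈ M.types ∧ 0 ≤ indirectUtility M Φ s θ}
  ratio_deriv_neg : ∀ s ∈ Φ '' contracts, ∀ θ ∈ M.types,
    0 ≤ indirectUtility M Φ s θ → utilityRatioDeriv M Φ s θ < 0
  price_finite : ∀ s ∈ Φ '' contracts, ∀ q ∈ Icc (0 : ℝ) 1, ∃ p, 0 ≤ p ∧ Φ (p, q) ≤ s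
  price_smooth : ∀ s ∈ Φ '' contracts,
    ContDiffOn ℝ ∞ (requiredPrice Φ s) (feasibleQualities Φ s)
  price_concave : ∀ s ∈ Φ '' contracts,
    StrictConcaveOn ℝ (feasibleQualities Φ s) (requiredPrice Φ s)
  price_deriv_decreasing : ∀ s ∈ Φ '' contracts,
    StrictAntiOn (requiredPriceDeriv Φ s) (feasibleQualities Φ s)
  price_deriv_zero : ∀ s ∈ Φ '' contracts, 0 ∈ feasibleQualities Φ s →
    M.mHi < requiredPriceDeriv Φ s 0
  price_deriv_one : ∀ s ∈ Φ '' contracts, requiredPriceDeriv Φ s 1 < M.mLo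

/-- The space of type distributions: strictly positive Lebesgue densities on the type space. -/
def densities (M : CostModel) : Set (ℝ × ℝ → ℝ) :=
  {g | IntegrableOn g M.types ∧ (∀ᵐ τ ∂(volume.restrict M.types), 0 < g τ) ∧
    ∫ τ in M.types, g τ = 1}

/-- The moment `E[ζ(τ)]` for `τ` drawn from the density `g`. -/
def moment (M : CostModel) (ζ g : ℝ × ℝ → ℝ) : ℝ :=
  ∫ τ in M.types, ζ τ * g τ

open Classical in
/-- The probability of winning with a bid of score `s` against an opponent whose type has density
`g` and who bids according to `σ`; a tie is broken by a fair coin. -/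
def winProb (M : CostModel) (Φ : ℝ × ℝ → ℝ) (g : ℝ × ℝ → ℝ) (σ : ℝ × ℝ → ℝ × ℝ) (s : ℝ) : ℝ :=
  ∫ τ in M.types, (if Φ (σ τ) < s then 1 else if Φ (σ τ) = s then 1 / 2 else 0) * g τ

/-- `σ` is a symmetric Bayes-Nash equilibrium of the first-score auction with scoring rule `Φ` when
the density `g` is common knowledge: every type's contract is a best response. -/
structure IsEquilibrium (M : CostModel) (Φ : ℝ × ℝ → ℝ) (g : ℝ × ℝ → ℝ)
    (σ : ℝ × ℝ → ℝ × ℝ) : Prop where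
  measurable : Measurable (M.types.domRestrict σ)
  mem_contracts : ∀ θ ∈ M.types, σ θ ∈ contracts
  best_response : ∀ θ ∈ M.types, ∀ c ∈ contracts,
    winProb M Φ g σ (Φ c) * M.profit θ c ≤ winProb M Φ g σ (Φ (σ θ)) * M.profit θ (σ θ)

/-- `σ`, which gives the bid `σ θ g` of type `θ` at the density `g`, is an `n`-moment strategy: the
bid of `θ` is a function `φ` of `n` moments, `φ` being differentiable at every vector of moment
values that arises. The kernels of the moments and `φ` may depend on `θ` but not on `g`. -/
def IsMomentStrategy (M : CostModel) (n : ℕ) (σ : ℝ × ℝ → (ℝ × ℝ → ℝ) → ℝ × ℝ) : Prop :=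
  ∀ θ ∈ M.types, ∃ (ζ : Fin n → ℝ × ℝ → ℝ) (φ : (Fin n → ℝ) → ℝ × ℝ),
    (∀ i, Measurable (ζ i) ∧ ∃ B : ℝ, ∀ τ, |ζ i τ| ≤ B) ∧
    (∀ x, φ x ∈ contracts) ∧
    ∀ g ∈ densities M,
      DifferentiableAt ℝ φ (fun i => moment M (ζ i) g) ∧
      σ θ g = φ (fun i => moment M (ζ i) g)

/-- The first-score auction with scoring rule `Φ` can be implemented in `n`-moment strategies. -/
def Implementable (M : CostModel) (Φ : ℝ × ℝ → ℝ) (n : ℕ) : Prop :=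
  ∃ σ : ℝ × ℝ → (ℝ × ℝ → ℝ) → ℝ × ℝ,
    (∀ g ∈ densities M, IsEquilibrium M Φ g (fun θ => σ θ g)) ∧ IsMomentStrategy M n σ

end

end ScoreAuction

/-!
Only one implication has content: if the auction can be implemented in `n`-moment strategies for
some `n`, then it can be implemented in `2`-moment strategies. The proof passes through a property
of the scoring rule alone, separability of the payoffs (`IsSeparable`): above the score `s₀` at
which the least efficient type breaks even, the drop `u(s₀, (m, f)) - u(s, (m, f))` of the indirect
utility is a function of `m` times a function of `s`.

*Finitely many moments force separability* (`isSeparable_of_implementable`). Consider a chain of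
types, each better in both costs than the one before, and densities concentrated on small squares
at these types. As the squares shrink, every equilibrium converges on the chain to the solution of
a finite recursion in the masses of the squares: each type is indifferent between the score that
beats exactly the worse types and the score that also beats its own square (`IsBidLadder`,
`tendsto_score_ladder`). This uses that equilibrium scores have no atoms and are monotone in the
product order, which follows from single crossing. If the chain has more than `n + 1` types,
linear algebra gives a shift of the masses that changes none of the `n` moments on which the bid of
the best type depends, so this bid does not move (`exists_invariant_direction`). Tracing the
recursion down from the best type to the last type whose bid does move shows that the quantity
`u(x, τ) - u(x, τ') * u₁(x, τ) / u₁(x, τ')` takes the same value at any two feasible bids `x`, for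
some two consecutive types `τ, τ'` of the chain (`crossEffect_eq`). If the ratio
`u₁(y, (m, f)) / u₁(x, (m, f))`, which does not depend on `f`, varied with `m` for some scores
`x < y`, the intermediate value theorem would yield arbitrarily long chains on which this fails for
every consecutive pair. So the ratio is constant in `m` (`marginal_ratio_eq`), and integrating in
the score gives separability.

*Separability suffices for two moments* (`IsSeparable.implementable`). Under separability the profit
of a type from the optimal contract of score `s` is a positive multiple of `k - B(s)`, with a
one-dimensional pseudotype `k` and an increasing function `B` of the score. The auction is then
strategically a first-price auction with values `k`, in which bidding the expectation of the
opponent's pseudotype conditional on its being smaller is an equilibrium. This conditional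
expectation is the ratio of the moments with kernels `k · 1{k < k(θ)}` and `1{k < k(θ)}`. By the
envelope theorem the optimal quality, raised to the power `η`, is affine in `B(s)`, so the bid
contract is an explicit function of this ratio; it is differentiable because optimal qualities are
positive.
-/

namespace ScoreAuction

open Filter Topology

/-! ### Indirect utility and single crossing -/

section

variable {M : CostModel} {Φ : ℝ × ℝ → ℝ}

/-- The scores that some contract attains. -/
def scores (Φ : ℝ × ℝ → ℝ) : Set ℝ := Φ '' contracts

lemma IsScoringRule.continuousOn (hΦ : IsScoringRule Φ) : ContinuousOn Φ contracts :=
  hΦ.smooth.continuousOn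

lemma isClosed_contracts : IsClosed contracts := isClosed_Ici.prod isClosed_Icc

lemma convex_contracts : Convex ℝ contracts := (convex_Ici 0).prod (convex_Icc 0 1)

lemma CostModel.η_pos (M : CostModel) : 0 < M.η := lt_of_lt_of_le one_pos M.one_le_η

lemma ordConnected_scores (hΦ : IsScoringRule Φ) : (scores Φ).OrdConnected :=
  (convex_contracts.isPreconnected.image _ hΦ.continuousOn).ordConnected

lemma price_strictAnti (hΦ : IsScoringRule Φ) {p p' q : ℝ} (hp : 0 ≤ p) (hq : q ∈ Icc (0 : ℝ) 1)
    (h : p < p') : Φ (p', q) < Φ (p, q) :=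
  hΦ.decreasing_price q hq hp (hp.trans h.le : (0 : ℝ) ≤ p') h

/-- A contract can be made worse to any attainable lower score by raising its price alone. -/
lemma exists_price (hΦ : IsScoringRule Φ) (hreg : IsRegular M Φ) {p q s : ℝ}
    (hc : (p, q) ∈ contracts) (hs : s ∈ scores Φ) (hle : s ≤ Φ (p, q)) :
    ∃ p', p ≤ p' ∧ Φ (p', q) = s := by
  obtain ⟨p0, h0, hp0⟩ := hreg.price_finite s hs q hc.2
  have hpp : p ≤ p0 ∨ s = Φ (p, q) := by
    by_contra! h
    exact absurd (price_strictAnti hΦ h0 hc.2 h.1) (by have := lt_of_le_of_ne hle h.2; linarith)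
  rcases hpp with hpp | h
  · have hcont : ContinuousOn (fun x => Φ (x, q)) (Icc p p0) :=
      hΦ.continuousOn.comp (by fun_prop) fun x hx => ⟨le_trans hc.1 hx.1, hc.2⟩
    obtain ⟨x, hx, hxs⟩ := intermediate_value_Icc' hpp hcont ⟨hp0, hle⟩
    exact ⟨x, hx.1, hxs⟩
  · exact ⟨p, le_rfl, h.symm⟩

lemma isCompact_isoscore (hΦ : IsScoringRule Φ) (hreg : IsRegular M Φ) {s : ℝ}
    (hs : s ∈ scores Φ) : IsCompact {c | c ∈ contracts ∧ Φ c = s} := by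
  obtain ⟨p1, h1, hp1⟩ := hreg.price_finite s hs 1 (by simp)
  have hclosed : IsClosed {c | c ∈ contracts ∧ Φ c = s} :=
    hΦ.continuousOn.preimage_isClosed_of_isClosed isClosed_contracts isClosed_singleton
  have hbox : IsCompact (Icc 0 p1 ×ˢ Icc (0 : ℝ) 1) := isCompact_Icc.prod isCompact_Icc
  refine hbox.of_isClosed_subset hclosed ?_
  rintro ⟨p, q⟩ ⟨hc, hcs⟩
  refine ⟨⟨hc.1, ?_⟩, hc.2⟩
  by_contra! h
  have h2 : Φ (p, q) ≤ Φ (p, 1) :=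
    (hΦ.increasing_quality p hc.1).monotoneOn hc.2 (by simp) hc.2.2
  have h3 := price_strictAnti hΦ h1 (by simp : (1 : ℝ) ∈ Icc (0 : ℝ) 1) h
  linarith [hcs]

lemma continuous_profit (θ : ℝ × ℝ) : Continuous (M.profit θ) := by
  have h := M.η_pos
  unfold CostModel.profit CostModel.cost
  exact continuous_fst.sub ((continuous_const.mul
    ((Real.continuous_rpow_const h.le).comp continuous_snd)).add continuous_const)

/-- The best profit at an attainable score is attained. -/
lemma exists_optimal (hΦ : IsScoringRule Φ) (hreg : IsRegular M Φ) {s : ℝ}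
    (hs : s ∈ scores Φ) (θ : ℝ × ℝ) :
    ∃ c ∈ contracts, Φ c = s ∧ M.profit θ c = indirectUtility M Φ s θ ∧
      ∀ c' ∈ contracts, Φ c' = s → M.profit θ c' ≤ M.profit θ c := by
  have hne : {c | c ∈ contracts ∧ Φ c = s}.Nonempty := by
    obtain ⟨c, hc, h⟩ := hs
    exact ⟨c, hc, h⟩
  obtain ⟨c, hc, hmax⟩ := (isCompact_isoscore hΦ hreg hs).exists_isMaxOn hne
    (continuous_profit (M := M) θ).continuousOn
  have hg : IsGreatest (M.profit θ '' {c | c ∈ contracts ∧ Φ c = s}) (M.profit θ c) := by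
    refine ⟨⟨c, hc, rfl⟩, ?_⟩
    rintro _ ⟨c', hc', rfl⟩
    exact hmax hc'
  exact ⟨c, hc.1, hc.2, hg.csSup_eq.symm, fun c' h1 h2 => hmax ⟨h1, h2⟩⟩

lemma profit_le_indirectUtility (hΦ : IsScoringRule Φ) (hreg : IsRegular M Φ) {c : ℝ × ℝ}
    (hc : c ∈ contracts) (θ : ℝ × ℝ) : M.profit θ c ≤ indirectUtility M Φ (Φ c) θ := by
  obtain ⟨c', -, -, h, h'⟩ := exists_optimal hΦ hreg ⟨c, hc, rfl⟩ θ
  rw [← h]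
  exact h' c hc rfl

lemma rpow_quality_mem (M : CostModel) {q : ℝ} (hq : q ∈ Icc (0 : ℝ) 1) :
    q ^ M.η ∈ Icc (0 : ℝ) 1 :=
  ⟨Real.rpow_nonneg hq.1 _, Real.rpow_le_one hq.1 hq.2 M.η_pos.le⟩

lemma indirectUtility_sub (hΦ : IsScoringRule Φ) (hreg : IsRegular M Φ) {s : ℝ}
    (hs : s ∈ scores Φ) (m f : ℝ) :
    indirectUtility M Φ s (m, f) = indirectUtility M Φ s (m, 0) - f := by
  obtain ⟨c, hc, hcs, h, h'⟩ := exists_optimal hΦ hreg hs (m, f)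
  obtain ⟨d, hd, hds, k, k'⟩ := exists_optimal hΦ hreg hs (m, 0)
  have h1 := h' d hd hds
  have h2 := k' c hc hcs
  rw [← h, ← k]
  simp only [CostModel.profit, CostModel.cost] at *
  linarith

/-- Lowering both cost parameters raises the indirect utility by at least the fall in the fixed
cost. -/
lemma indirectUtility_anti (hΦ : IsScoringRule Φ) (hreg : IsRegular M Φ) {s : ℝ}
    (hs : s ∈ scores Φ) {m m' : ℝ} (f f' : ℝ) (hm : m' ≤ m) :
    indirectUtility M Φ s (m, f) + (f - f') ≤ indirectUtility M Φ s (m', f') := by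
  obtain ⟨c, hc, hcs, h, h'⟩ := exists_optimal hΦ hreg hs (m, f)
  have h1 := profit_le_indirectUtility hΦ hreg hc (m', f')
  rw [← h]
  rw [hcs] at h1
  have h3 := mul_le_mul_of_nonneg_right hm (rpow_quality_mem M hc.2).1
  simp only [CostModel.profit, CostModel.cost] at *
  linarith

lemma indirectUtility_le (hΦ : IsScoringRule Φ) (hreg : IsRegular M Φ) {s : ℝ}
    (hs : s ∈ scores Φ) {m m' : ℝ} (f f' : ℝ) (hm : m' ≤ m) :
    indirectUtility M Φ s (m', f') ≤ indirectUtility M Φ s (m, f) + (f - f') + (m - m') := by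
  obtain ⟨c, hc, hcs, h, h'⟩ := exists_optimal hΦ hreg hs (m', f')
  have h1 := profit_le_indirectUtility hΦ hreg hc (m, f)
  rw [← h]
  rw [hcs] at h1
  have h3 := mul_le_mul_of_nonneg_left (rpow_quality_mem M hc.2).2 (sub_nonneg.2 hm)
  simp only [CostModel.profit, CostModel.cost] at *
  linarith

lemma continuous_indirectUtility (hΦ : IsScoringRule Φ) (hreg : IsRegular M Φ) {s : ℝ}
    (hs : s ∈ scores Φ) : Continuous (indirectUtility M Φ s) := by
  have h1 : Continuous fun m => indirectUtility M Φ s (m, 0) := by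
    refine LipschitzWith.continuous (K := 1) (LipschitzWith.of_dist_le_mul fun m m' => ?_)
    rw [Real.dist_eq, Real.dist_eq, NNReal.coe_one, one_mul]
    rcases le_total m m' with h | h
    · have h1 := indirectUtility_anti hΦ hreg hs 0 0 h
      have h2 := indirectUtility_le hΦ hreg hs 0 0 h
      rw [abs_of_nonneg (by linarith), abs_of_nonpos (by linarith)]
      linarith
    · have h1 := indirectUtility_anti hΦ hreg hs 0 0 h
      have h2 := indirectUtility_le hΦ hreg hs 0 0 h
      rw [abs_of_nonpos (by linarith), abs_of_nonneg (by linarith)]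
      linarith
  have h2 : indirectUtility M Φ s = fun θ => indirectUtility M Φ s (θ.1, 0) - θ.2 := by
    funext θ
    exact indirectUtility_sub hΦ hreg hs θ.1 θ.2
  rw [h2]
  exact (h1.comp continuous_fst).sub continuous_snd

lemma indirectUtility_strictAnti (hΦ : IsScoringRule Φ) (hreg : IsRegular M Φ) (θ : ℝ × ℝ) :
    StrictAntiOn (fun s => indirectUtility M Φ s θ) (scores Φ) := by
  intro s hs t ht hst
  obtain ⟨⟨p, q⟩, hc, hct, h, -⟩ := exists_optimal hΦ hreg ht θ
  obtain ⟨p', hp', hps⟩ := exists_price hΦ hreg hc hs (by rw [hct]; exact hst.le)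
  have hc' : (p', q) ∈ contracts := ⟨hc.1.trans hp', hc.2⟩
  have h1 := profit_le_indirectUtility hΦ hreg hc' θ
  rw [hps] at h1
  have hne : p ≠ p' := by
    rintro rfl
    rw [hct] at hps
    exact hst.ne' hps
  have := lt_of_le_of_ne hp' hne
  simp only at *
  rw [← h]
  simp only [CostModel.profit] at *
  linarith

lemma cost_pos {θ : ℝ × ℝ} (hθ : θ ∈ M.types) {q : ℝ} (hq : q ∈ Icc (0 : ℝ) 1) :
    0 < M.cost θ q := by
  have h1 := M.mLo_pos.trans_le hθ.1.1
  have h2 := M.fLo_pos.trans_le hθ.2.1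
  have h3 := (rpow_quality_mem M hq).1
  unfold CostModel.cost
  positivity

lemma scores_mem_nhds (hΦ : IsScoringRule Φ) (hreg : IsRegular M Φ) {s : ℝ} {θ : ℝ × ℝ}
    (hθ : θ ∈ M.types) (hs : s ∈ scores Φ) (hu : 0 ≤ indirectUtility M Φ s θ) :
    scores Φ ∈ 𝓝 s := by
  obtain ⟨⟨p, q⟩, hc, hcs, h, -⟩ := exists_optimal hΦ hreg hs θ
  have hcost := cost_pos hθ hc.2
  have hp : 0 < p := by
    rw [← h] at hu
    simp only [CostModel.profit] at hu
    linarith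
  have h1 : Φ (p + 1, q) < s := hcs ▸ price_strictAnti hΦ hc.1 hc.2 (by linarith)
  have h2 : s < Φ (0, q) := hcs ▸ price_strictAnti hΦ le_rfl hc.2 hp
  refine mem_of_superset (Icc_mem_nhds h1 h2) ((ordConnected_scores hΦ).out ?_ ?_)
  · exact ⟨(p + 1, q), ⟨by simp only [mem_Ici]; linarith, hc.2⟩, rfl⟩
  · exact ⟨(0, q), ⟨by simp, hc.2⟩, rfl⟩

/-- Every type has a score at which its best profit vanishes: the best score among the contracts
that cover its cost. -/
lemma exists_zeroScore (hΦ : IsScoringRule Φ) (hreg : IsRegular M Φ) {θ : ℝ × ℝ}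
    (hθ : θ ∈ M.types) : ∃ s ∈ scores Φ, indirectUtility M Φ s θ = 0 := by
  have hη := M.η_pos
  have hcost : Continuous (M.cost θ) := by
    unfold CostModel.cost
    exact (continuous_const.mul (Real.continuous_rpow_const hη.le)).add continuous_const
  have hcont : ContinuousOn (fun q => Φ (M.cost θ q, q)) (Icc 0 1) :=
    hΦ.continuousOn.comp (by fun_prop) fun q hq => ⟨(cost_pos hθ hq).le, hq⟩
  obtain ⟨q, hq, hmax⟩ := isCompact_Icc.exists_isMaxOn ⟨0, by simp⟩ hcont
  have hc : (M.cost θ q, q) ∈ contracts := ⟨(cost_pos hθ hq).le, hq⟩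
  have hs : Φ (M.cost θ q, q) ∈ scores Φ := ⟨_, hc, rfl⟩
  refine ⟨_, hs, le_antisymm ?_ ?_⟩
  · by_contra! hpos
    obtain ⟨⟨p, q'⟩, hc', hcs, h, -⟩ := exists_optimal hΦ hreg hs θ
    rw [← h] at hpos
    have h1 : Φ (p, q') < Φ (M.cost θ q', q') :=
      price_strictAnti hΦ (cost_pos hθ hc'.2).le hc'.2 (by simpa [CostModel.profit] using hpos)
    have h2 := hmax hc'.2
    simp only [mem_ofPred_eq] at h2
    linarith [hcs]
  · have := profit_le_indirectUtility hΦ hreg hc θ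
    simpa [CostModel.profit] using this

lemma exists_pos_profit (M : CostModel) (θ : ℝ × ℝ) (hθ : θ ∈ M.types) :
    ∃ c ∈ contracts, 0 < M.profit θ c := by
  have := M.fLo_pos.trans_le hθ.2.1
  refine ⟨(θ.2 + 1, 0), ⟨by simp only [mem_Ici]; linarith, by simp⟩, ?_⟩
  simp [CostModel.profit, CostModel.cost, Real.zero_rpow M.η_pos.ne']

lemma hasDerivAt_indirectUtility (hreg : IsRegular M Φ) {s : ℝ} {θ : ℝ × ℝ}
    (hθ : θ ∈ M.types) (hs : s ∈ scores Φ) (hu : 0 ≤ indirectUtility M Φ s θ) :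
    HasDerivAt (fun t => indirectUtility M Φ t θ) (indirectUtilityDeriv M Φ s θ) s :=
  (hreg.utility_differentiable s hs θ hθ hu).hasDerivAt

/-- The marginal loss from raising the score is nonzero, because the score is differentiable, hence
locally Lipschitz, in the price. -/
lemma indirectUtilityDeriv_neg (hΦ : IsScoringRule Φ) (hreg : IsRegular M Φ) {s : ℝ} {θ : ℝ × ℝ}
    (hθ : θ ∈ M.types) (hs : s ∈ scores Φ) (hu : 0 ≤ indirectUtility M Φ s θ) :
    indirectUtilityDeriv M Φ s θ < 0 := by
  have hd := hasDerivAt_indirectUtility hreg hθ hs hu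
  obtain ⟨⟨p, q⟩, hc, hcs, h, -⟩ := exists_optimal hΦ hreg hs θ
  have hdiff : DifferentiableWithinAt ℝ (fun x => Φ (x, q)) (Ici 0) p := by
    have h1 : DifferentiableWithinAt ℝ Φ contracts (p, q) :=
      hΦ.smooth.differentiableOn (by simp) _ hc
    exact h1.comp p (f := fun x : ℝ => (x, q)) (by fun_prop) fun x hx => ⟨hx, hc.2⟩
  obtain ⟨C, hC0, hC⟩ := hdiff.isBigO_sub.exists_pos
  rw [Asymptotics.isBigOWith_iff] at hC
  have hIoi : 𝓝[>] p ≤ 𝓝[Ici 0] p := nhdsWithin_mono _ fun x (hx : p < x) => le_trans hc.1 hx.le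
  have hC' := hC.filter_mono hIoi
  have htend : Tendsto (fun x => Φ (x, q)) (𝓝[>] p) (𝓝[≠] s) := by
    refine tendsto_nhdsWithin_iff.2 ⟨?_, ?_⟩
    · rw [← hcs]
      exact hdiff.continuousWithinAt.tendsto.mono_left hIoi
    · filter_upwards [self_mem_nhdsWithin] with x hx
      exact (hcs ▸ price_strictAnti hΦ hc.1 hc.2 hx).ne
  have hslope := (hasDerivAt_iff_tendsto_slope.1 hd).comp htend
  have hle : indirectUtilityDeriv M Φ s θ ≤ -(1 / C) := by
    refine le_of_tendsto hslope ?_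
    filter_upwards [hC', self_mem_nhdsWithin] with x hx hpx
    have hpx' : p < x := hpx
    have hlt : Φ (x, q) < s := hcs ▸ price_strictAnti hΦ hc.1 hc.2 hpx
    rw [hcs, Real.norm_eq_abs, Real.norm_eq_abs, abs_of_neg (by linarith),
      abs_of_pos (by linarith)] at hx
    have h1 := profit_le_indirectUtility hΦ hreg
      (show (x, q) ∈ contracts from ⟨le_trans hc.1 hpx'.le, hc.2⟩) θ
    have h2 : indirectUtility M Φ s θ + (x - p) ≤ indirectUtility M Φ (Φ (x, q)) θ := by
      rw [← h]
      simp only [CostModel.profit] at *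
      linarith
    simp only [Function.comp, slope_def_field]
    rw [div_le_iff_of_neg (by linarith)]
    have h3 : -(1 / C) * (Φ (x, q) - s) = (s - Φ (x, q)) / C := by ring
    rw [h3]
    have h4 : (s - Φ (x, q)) / C ≤ x - p := by
      rw [div_le_iff₀ hC0]; linarith
    linarith
  have : 0 < 1 / C := by positivity
  linarith

lemma eventually_utility_pos (hΦ : IsScoringRule Φ) (hreg : IsRegular M Φ) {s : ℝ} {θ : ℝ × ℝ}
    (hθ : θ ∈ M.types) (hs : s ∈ scores Φ) (hu : 0 < indirectUtility M Φ s θ) :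
    ∀ᶠ t in 𝓝 s, t ∈ scores Φ ∧ 0 < indirectUtility M Φ t θ :=
  Filter.Eventually.and (scores_mem_nhds hΦ hreg hθ hs hu.le)
    ((hasDerivAt_indirectUtility hreg hθ hs hu.le).continuousAt.tendsto.eventually_const_lt hu)

lemma indirectUtilityDeriv_fst (hΦ : IsScoringRule Φ) (hreg : IsRegular M Φ) {s : ℝ}
    (hs : scores Φ ∈ 𝓝 s) (m f f' : ℝ) :
    indirectUtilityDeriv M Φ s (m, f) = indirectUtilityDeriv M Φ s (m, f') := by
  unfold indirectUtilityDeriv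
  have h1 : (fun t => indirectUtility M Φ t (m, f)) =ᶠ[𝓝 s]
      fun t => indirectUtility M Φ t (m, f') + (f' - f) := by
    filter_upwards [hs] with t ht
    rw [indirectUtility_sub hΦ hreg ht m f, indirectUtility_sub hΦ hreg ht m f']
    ring
  rw [h1.deriv_eq, deriv_add_const]

lemma mem_types_of_le {m m' f f' : ℝ} (h : (m, f) ∈ M.types) (hm : M.mLo ≤ m') (hm' : m' ≤ m)
    (hf : M.fLo ≤ f') (hf' : f' ≤ f) : (m', f') ∈ M.types :=
  ⟨⟨hm, hm'.trans h.1.2⟩, hf, hf'.trans h.2.2⟩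

/-- The ratio `u / |u₁|` is strictly decreasing in the marginal cost. -/
lemma utilityRatio_lt_of_fst_lt (hΦ : IsScoringRule Φ) (hreg : IsRegular M Φ) {s : ℝ}
    {m m' f : ℝ} (hθ : (m, f) ∈ M.types) (hs : s ∈ scores Φ)
    (hu : 0 ≤ indirectUtility M Φ s (m, f)) (hm : M.mLo ≤ m') (hmm : m' < m) :
    utilityRatio M Φ s (m, f) < utilityRatio M Φ s (m', f) := by
  have hmem : ∀ x ∈ Icc m' m, (x, f) ∈ M.types := fun x hx =>
    mem_types_of_le hθ (hm.trans hx.1) hx.2 hθ.2.1 le_rfl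
  have hux : ∀ x ∈ Icc m' m, 0 ≤ indirectUtility M Φ s (x, f) := fun x hx =>
    hu.trans (by simpa using indirectUtility_anti hΦ hreg hs f f hx.2)
  have hsub : Icc m' m ⊆ Icc M.mLo M.mHi := Icc_subset_Icc hm hθ.1.2
  have hanti : StrictAntiOn (fun x => utilityRatio M Φ s (x, f)) (Icc m' m) := by
    refine strictAntiOn_of_deriv_neg (convex_Icc _ _) ?_ ?_
    · intro x hx
      exact (hreg.ratio_differentiable s hs (x, f) (hmem x hx) (hux x hx)).continuousWithinAt.mono
        hsub
    · intro x hx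
      rw [interior_Icc] at hx
      have hx' := Ioo_subset_Icc_self hx
      have h1 := hreg.ratio_deriv_neg s hs (x, f) (hmem x hx') (hux x hx')
      rw [utilityRatioDeriv, derivWithin_of_mem_nhds] at h1
      · exact h1
      · exact Icc_mem_nhds (hm.trans_lt hx.1) (hx.2.trans_le hθ.1.2)
  exact hanti ⟨le_rfl, hmm.le⟩ ⟨hmm.le, le_rfl⟩ hmm

/-- Better types, in the product order, have a larger ratio `u / |u₁|` at every score that gives
the worse type a nonnegative profit. -/
lemma utilityRatio_lt (hΦ : IsScoringRule Φ) (hreg : IsRegular M Φ) {s : ℝ}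
    {m m' f f' : ℝ} (hθ : (m, f) ∈ M.types) (hθ' : (m', f') ∈ M.types) (hs : s ∈ scores Φ)
    (hu : 0 ≤ indirectUtility M Φ s (m, f)) (hm : m' ≤ m) (hf : f' ≤ f)
    (hne : (m', f') ≠ (m, f)) :
    utilityRatio M Φ s (m, f) < utilityRatio M Φ s (m', f') := by
  have hmem : (m', f) ∈ M.types := mem_types_of_le hθ hθ'.1.1 hm hθ.2.1 le_rfl
  have hu' : 0 ≤ indirectUtility M Φ s (m', f) :=
    hu.trans (by simpa using indirectUtility_anti hΦ hreg hs f f hm)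
  have hn := scores_mem_nhds hΦ hreg hθ hs hu
  have hneg := indirectUtilityDeriv_neg hΦ hreg hmem hs hu'
  have h2 : utilityRatio M Φ s (m', f') =
      utilityRatio M Φ s (m', f) + (f - f') / |indirectUtilityDeriv M Φ s (m', f)| := by
    unfold utilityRatio
    rw [indirectUtilityDeriv_fst hΦ hreg hn m' f' f, indirectUtility_sub hΦ hreg hs m' f',
      indirectUtility_sub hΦ hreg hs m' f]
    ring
  have hpos : 0 < |indirectUtilityDeriv M Φ s (m', f)| := abs_pos.2 hneg.ne
  rcases hm.lt_or_eq with hlt | rfl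
  · have := utilityRatio_lt_of_fst_lt hΦ hreg hθ hs hu hθ'.1.1 hlt
    have h3 : 0 ≤ (f - f') / |indirectUtilityDeriv M Φ s (m', f)| :=
      div_nonneg (by linarith) hpos.le
    linarith
  · have hlt : f' < f := lt_of_le_of_ne hf fun h => hne (by rw [h])
    have h3 : 0 < (f - f') / |indirectUtilityDeriv M Φ s (m', f)| :=
      div_pos (by linarith) hpos
    linarith

/-- Single crossing: among two bids, a better type has a stronger relative preference for the
higher score. -/
lemma single_crossing (hΦ : IsScoringRule Φ) (hreg : IsRegular M Φ) {s t : ℝ}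
    {m m' f f' : ℝ} (hθ : (m, f) ∈ M.types) (hθ' : (m', f') ∈ M.types) (hs : s ∈ scores Φ)
    (ht : t ∈ scores Φ) (hts : t < s)
    (hu : 0 < indirectUtility M Φ s (m, f)) (hm : m' ≤ m) (hf : f' ≤ f)
    (hne : (m', f') ≠ (m, f)) :
    indirectUtility M Φ t (m', f') * indirectUtility M Φ s (m, f) <
      indirectUtility M Φ s (m', f') * indirectUtility M Φ t (m, f) := by
  have hsc : Icc t s ⊆ scores Φ := (ordConnected_scores hΦ).out ht hs
  have hu1 : ∀ x ∈ Icc t s, 0 < indirectUtility M Φ x (m, f) := fun x hx =>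
    hu.trans_le ((indirectUtility_strictAnti hΦ hreg (m, f)).antitoneOn (hsc hx) hs hx.2)
  have hu2 : ∀ x ∈ Icc t s, 0 < indirectUtility M Φ x (m', f') := fun x hx =>
    (hu1 x hx).trans_le (by
      have := indirectUtility_anti hΦ hreg (hsc hx) f f' hm
      linarith)
  have hd : ∀ x ∈ Icc t s, HasDerivAt
      (fun x => indirectUtility M Φ x (m', f') / indirectUtility M Φ x (m, f))
      ((indirectUtilityDeriv M Φ x (m', f') * indirectUtility M Φ x (m, f) -
        indirectUtility M Φ x (m', f') * indirectUtilityDeriv M Φ x (m, f)) /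
        indirectUtility M Φ x (m, f) ^ 2) x := fun x hx =>
    (hasDerivAt_indirectUtility hreg hθ' (hsc hx) (hu2 x hx).le).div
      (hasDerivAt_indirectUtility hreg hθ (hsc hx) (hu1 x hx).le) (hu1 x hx).ne'
  have hmono : StrictMonoOn
      (fun x => indirectUtility M Φ x (m', f') / indirectUtility M Φ x (m, f)) (Icc t s) := by
    refine strictMonoOn_of_deriv_pos (convex_Icc _ _)
      (fun x hx => (hd x hx).continuousAt.continuousWithinAt) fun x hx => ?_
    rw [interior_Icc] at hx
    have hx := Ioo_subset_Icc_self hx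
    rw [(hd x hx).deriv]
    have h1 := utilityRatio_lt hΦ hreg hθ hθ' (hsc hx) (hu1 x hx).le hm hf hne
    have n1 := indirectUtilityDeriv_neg hΦ hreg hθ (hsc hx) (hu1 x hx).le
    have n2 := indirectUtilityDeriv_neg hΦ hreg hθ' (hsc hx) (hu2 x hx).le
    unfold utilityRatio at h1
    rw [abs_of_neg n1, abs_of_neg n2, div_lt_div_iff₀ (by linarith) (by linarith)] at h1
    refine div_pos ?_ (pow_pos (hu1 x hx) 2)
    linarith
  have h := hmono (left_mem_Icc.2 hts.le) (right_mem_Icc.2 hts.le) hts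
  simp only at h
  rw [div_lt_div_iff₀ (hu1 t (left_mem_Icc.2 hts.le)) hu] at h
  exact h

/-- The marginal loss from raising the score is continuous in the marginal cost. -/
lemma continuousOn_indirectUtilityDeriv (hΦ : IsScoringRule Φ) (hreg : IsRegular M Φ) {s a b : ℝ}
    (hs : s ∈ scores Φ) (ha : M.mLo ≤ a) (hb : b ≤ M.mHi)
    (hu : M.fLo < indirectUtility M Φ s (b, 0)) :
    ContinuousOn (fun m => indirectUtilityDeriv M Φ s (m, M.fLo)) (Icc a b) := by
  have hmem : ∀ x ∈ Icc a b, (x, M.fLo) ∈ M.types := fun x hx =>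
    ⟨⟨ha.trans hx.1, hx.2.trans hb⟩, le_rfl, M.fLo_lt_fHi.le⟩
  have hux : ∀ x ∈ Icc a b, 0 < indirectUtility M Φ s (x, M.fLo) := fun x hx => by
    have := indirectUtility_anti hΦ hreg hs 0 M.fLo hx.2
    linarith
  have heq : ∀ x ∈ Icc a b, indirectUtilityDeriv M Φ s (x, M.fLo) =
      - (indirectUtility M Φ s (x, M.fLo) / utilityRatio M Φ s (x, M.fLo)) := fun x hx => by
    have n1 := indirectUtilityDeriv_neg hΦ hreg (hmem x hx) hs (hux x hx).le
    have n2 := (hux x hx).ne'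
    have n3 := n1.ne
    rw [utilityRatio, abs_of_neg n1]
    field_simp
  refine ContinuousOn.congr ?_ heq
  refine (ContinuousOn.div ?_ ?_ ?_).neg
  · exact ((continuous_indirectUtility hΦ hreg hs).comp (by fun_prop)).continuousOn
  · intro x hx
    exact (hreg.ratio_differentiable s hs (x, M.fLo) (hmem x hx) (hux x hx).le
      ).continuousWithinAt.mono (Icc_subset_Icc ha hb)
  · intro x hx
    have n1 := indirectUtilityDeriv_neg hΦ hreg (hmem x hx) hs (hux x hx).le
    exact (div_pos (hux x hx) (abs_pos.2 n1.ne)).ne'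

end

/-! ### Equilibrium without atoms -/

section

variable {M : CostModel} {Φ : ℝ × ℝ → ℝ} {g : ℝ × ℝ → ℝ} {σ : ℝ × ℝ → ℝ × ℝ}

/-- The law of a type drawn from the density `g`. -/
noncomputable def typeLaw (M : CostModel) (g : ℝ × ℝ → ℝ) : Measure (ℝ × ℝ) :=
  (volume.restrict M.types).withDensity fun τ => ENNReal.ofReal (g τ)

/-- The least efficient type. -/
def CostModel.worst (M : CostModel) : ℝ × ℝ := (M.mHi, M.fHi)

lemma CostModel.worst_mem (M : CostModel) : M.worst ∈ M.types :=
  ⟨⟨M.mLo_lt_mHi.le, le_rfl⟩, M.fLo_lt_fHi.le, le_rfl⟩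

lemma measurableSet_types : MeasurableSet M.types := measurableSet_Icc.prod measurableSet_Icc

lemma isCompact_types : IsCompact M.types := isCompact_Icc.prod isCompact_Icc

lemma ae_eq_ofReal (hg : g ∈ densities M) :
    (fun τ => (ENNReal.ofReal (g τ)).toReal) =ᵐ[volume.restrict M.types] g := by
  filter_upwards [hg.2.1] with τ hτ
  exact ENNReal.toReal_ofReal hτ.le

lemma integral_typeLaw (hg : g ∈ densities M) (w : ℝ × ℝ → ℝ) :
    ∫ τ, w τ ∂(typeLaw M g) = ∫ τ in M.types, w τ * g τ := by
  rw [typeLaw, integral_withDensity_eq_integral_toReal_smul₀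
    hg.1.aestronglyMeasurable.aemeasurable.ennreal_ofReal (by simp)]
  refine integral_congr_ae ?_
  filter_upwards [ae_eq_ofReal hg] with τ hτ
  rw [hτ, smul_eq_mul, mul_comm]

lemma isProbabilityMeasure_typeLaw (hg : g ∈ densities M) :
    IsProbabilityMeasure (typeLaw M g) := by
  constructor
  rw [typeLaw, withDensity_apply _ MeasurableSet.univ, Measure.restrict_univ,
    ← ofReal_integral_eq_lintegral_ofReal hg.1 (hg.2.1.mono fun _ h => h.le), hg.2.2,
    ENNReal.ofReal_one]

lemma typeLaw_absolutelyContinuous : typeLaw M g ≪ volume.restrict M.types :=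
  withDensity_absolutelyContinuous _ _

lemma absolutelyContinuous_typeLaw (hg : g ∈ densities M) :
    volume.restrict M.types ≪ typeLaw M g := by
  refine withDensity_absolutelyContinuous'
    hg.1.aestronglyMeasurable.aemeasurable.ennreal_ofReal ?_
  filter_upwards [hg.2.1] with τ hτ
  simpa using hτ

lemma ae_typeLaw_mem : ∀ᵐ τ ∂(typeLaw M g), τ ∈ M.types :=
  typeLaw_absolutelyContinuous.ae_le (ae_restrict_mem measurableSet_types)

/-- A relatively open nonempty set of types has positive probability. -/
lemma typeLaw_pos (hg : g ∈ densities M) {V : Set (ℝ × ℝ)} (hV : IsOpen V)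
    (hne : (V ∩ M.types).Nonempty) : 0 < typeLaw M g (V ∩ M.types) := by
  have hcl : closure (Ioo M.mLo M.mHi ×ˢ Ioo M.fLo M.fHi) = M.types := by
    rw [closure_prod_eq, closure_Ioo M.mLo_lt_mHi.ne, closure_Ioo M.fLo_lt_fHi.ne]
    rfl
  obtain ⟨τ, hτV, hτ⟩ := hne
  rw [← hcl] at hτ
  have h1 : (V ∩ Ioo M.mLo M.mHi ×ˢ Ioo M.fLo M.fHi).Nonempty :=
    mem_closure_iff.1 hτ V hV hτV
  have h2 : 0 < volume (V ∩ Ioo M.mLo M.mHi ×ˢ Ioo M.fLo M.fHi) :=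
    (hV.inter (isOpen_Ioo.prod isOpen_Ioo)).measure_pos _ h1
  have hsub : V ∩ Ioo M.mLo M.mHi ×ˢ Ioo M.fLo M.fHi ⊆ V ∩ M.types :=
    inter_subset_inter_right _ (prod_mono Ioo_subset_Icc_self Ioo_subset_Icc_self)
  refine pos_iff_ne_zero.2 fun h0 => ?_
  have h3 := absolutelyContinuous_typeLaw hg h0
  rw [Measure.restrict_apply (hV.measurableSet.inter measurableSet_types), inter_assoc,
    inter_self] at h3
  exact (h2.trans_le (measure_mono hsub)).ne' h3

/-- A measurable set of types that meets every line of constant marginal cost at most once is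
null. -/
lemma typeLaw_eq_zero_of_sections {S : Set (ℝ × ℝ)} (hS : MeasurableSet S)
    (h : ∀ m f f', (m, f) ∈ S → (m, f') ∈ S → f = f') : typeLaw M g S = 0 := by
  refine typeLaw_absolutelyContinuous (Measure.absolutelyContinuous_of_le
    Measure.restrict_le_self ?_)
  rw [Measure.volume_eq_prod, Measure.measure_prod_null hS]
  refine Eventually.of_forall fun m => ?_
  exact Set.Subsingleton.measure_zero (fun f hf f' hf' => h m f f' hf hf') _

lemma typeLaw_zeroCurve (hΦ : IsScoringRule Φ) (hreg : IsRegular M Φ) {s : ℝ}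
    (hs : s ∈ scores Φ) : typeLaw M g {τ | indirectUtility M Φ s τ = 0} = 0 := by
  refine typeLaw_eq_zero_of_sections
    ((continuous_indirectUtility hΦ hreg hs).measurable (measurableSet_singleton 0)) ?_
  intro m f f' h h'
  have h1 : indirectUtility M Φ s (m, f) = 0 := h
  have h2 : indirectUtility M Φ s (m, f') = 0 := h'
  rw [indirectUtility_sub hΦ hreg hs] at h1 h2
  linarith

lemma aemeasurable_score (hΦ : IsScoringRule Φ)
    (hm : Measurable (M.types.domRestrict σ)) (hc : ∀ θ ∈ M.types, σ θ ∈ contracts) :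
    AEMeasurable (fun τ => Φ (σ τ)) (typeLaw M g) := by
  refine AEMeasurable.mono_ac (aemeasurable_restrict_of_measurable_subtype measurableSet_types ?_)
    typeLaw_absolutelyContinuous
  have h1 : Measurable fun τ : M.types => (⟨σ τ, hc τ τ.2⟩ : contracts) := hm.subtype_mk
  have h2 : Measurable (contracts.domRestrict Φ) :=
    (continuousOn_iff_continuous_domRestrict.1 hΦ.continuousOn).measurable
  exact h2.comp h1

lemma winProb_eq (hg : g ∈ densities M)
    (hX : AEMeasurable (fun τ => Φ (σ τ)) (typeLaw M g)) (s : ℝ) :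
    winProb M Φ g σ s = (typeLaw M g).real {τ | Φ (σ τ) < s} +
      1 / 2 * (typeLaw M g).real {τ | Φ (σ τ) = s} := by
  classical
  have := isProbabilityMeasure_typeLaw hg
  have h1 : NullMeasurableSet {τ | Φ (σ τ) < s} (typeLaw M g) :=
    nullMeasurableSet_lt hX aemeasurable_const
  have h2 : NullMeasurableSet {τ | Φ (σ τ) = s} (typeLaw M g) :=
    nullMeasurableSet_eq_fun hX aemeasurable_const
  have hw : ∀ τ, (if Φ (σ τ) < s then (1 : ℝ) else if Φ (σ τ) = s then 1 / 2 else 0) =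
      {τ | Φ (σ τ) < s}.indicator (fun _ => (1 : ℝ)) τ +
        {τ | Φ (σ τ) = s}.indicator (fun _ => (1 / 2 : ℝ)) τ := by
    intro τ
    simp only [indicator_apply, mem_ofPred_eq]
    by_cases h : Φ (σ τ) < s
    · simp [h, h.ne]
    · simp [h]
  rw [winProb, ← integral_typeLaw hg]
  simp_rw [hw]
  rw [integral_add ((integrable_const _).indicator₀ h1) ((integrable_const _).indicator₀ h2),
    integral_indicator₀ h1, integral_indicator₀ h2]
  simp [mul_comm]

/-- An equilibrium of a first-score auction with a regular scoring rule. -/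
structure RegularEquilibrium (M : CostModel) (Φ : ℝ × ℝ → ℝ) (g : ℝ × ℝ → ℝ)
    (σ : ℝ × ℝ → ℝ × ℝ) : Prop where
  rule : IsScoringRule Φ
  regular : IsRegular M Φ
  density : g ∈ densities M
  equilibrium : IsEquilibrium M Φ g σ

namespace RegularEquilibrium

lemma score_mem (E : RegularEquilibrium M Φ g σ) {θ : ℝ × ℝ} (hθ : θ ∈ M.types) :
    Φ (σ θ) ∈ scores Φ := ⟨_, E.equilibrium.mem_contracts θ hθ, rfl⟩

lemma aemeasurable (E : RegularEquilibrium M Φ g σ) :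
    AEMeasurable (fun τ => Φ (σ τ)) (typeLaw M g) :=
  aemeasurable_score E.rule E.equilibrium.measurable E.equilibrium.mem_contracts

lemma isProbabilityMeasure (E : RegularEquilibrium M Φ g σ) :
    IsProbabilityMeasure (typeLaw M g) := isProbabilityMeasure_typeLaw E.density

lemma winProb_nonneg (E : RegularEquilibrium M Φ g σ) (s : ℝ) : 0 ≤ winProb M Φ g σ s := by
  rw [winProb_eq E.density E.aemeasurable]
  positivity

lemma measure_lt_le_winProb (E : RegularEquilibrium M Φ g σ) (s : ℝ) :
    (typeLaw M g).real {τ | Φ (σ τ) < s} ≤ winProb M Φ g σ s := by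
  rw [winProb_eq E.density E.aemeasurable]
  have : 0 ≤ (typeLaw M g).real {τ | Φ (σ τ) = s} := measureReal_nonneg
  linarith

/-- In equilibrium every type bids a score that maximizes the probability of winning times the
indirect utility. -/
lemma best_score (E : RegularEquilibrium M Φ g σ) {θ : ℝ × ℝ} (hθ : θ ∈ M.types) {t : ℝ}
    (ht : t ∈ scores Φ) :
    winProb M Φ g σ t * indirectUtility M Φ t θ ≤
      winProb M Φ g σ (Φ (σ θ)) * indirectUtility M Φ (Φ (σ θ)) θ := by
  obtain ⟨c, hc, hct, h, -⟩ := exists_optimal E.rule E.regular ht θ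
  have h1 := E.equilibrium.best_response θ hθ c hc
  rw [hct, h] at h1
  exact h1.trans (mul_le_mul_of_nonneg_left (profit_le_indirectUtility E.rule E.regular
    (E.equilibrium.mem_contracts θ hθ) θ) (E.winProb_nonneg _))

lemma payoff_nonneg (E : RegularEquilibrium M Φ g σ) {θ : ℝ × ℝ} (hθ : θ ∈ M.types) :
    0 ≤ winProb M Φ g σ (Φ (σ θ)) * indirectUtility M Φ (Φ (σ θ)) θ := by
  obtain ⟨c, hc, hpos⟩ := exists_pos_profit M θ hθ
  have h1 := E.best_score hθ ⟨c, hc, rfl⟩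
  have h2 := profit_le_indirectUtility E.rule E.regular hc θ
  exact (mul_nonneg (E.winProb_nonneg _) (hpos.le.trans h2)).trans h1

lemma utility_nonneg (E : RegularEquilibrium M Φ g σ) {θ : ℝ × ℝ} (hθ : θ ∈ M.types)
    (hw : 0 < winProb M Φ g σ (Φ (σ θ))) : 0 ≤ indirectUtility M Φ (Φ (σ θ)) θ :=
  nonneg_of_mul_nonneg_right (E.payoff_nonneg hθ) hw

lemma measure_le_eq (E : RegularEquilibrium M Φ g σ) (s : ℝ) :
    (typeLaw M g).real {τ | Φ (σ τ) ≤ s} =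
      (typeLaw M g).real {τ | Φ (σ τ) < s} + (typeLaw M g).real {τ | Φ (σ τ) = s} := by
  have := E.isProbabilityMeasure
  have h1 : {τ | Φ (σ τ) ≤ s} = {τ | Φ (σ τ) < s} ∪ {τ | Φ (σ τ) = s} := by
    ext τ
    exact le_iff_lt_or_eq (a := Φ (σ τ)) (b := s)
  rw [h1, measureReal_union₀ (nullMeasurableSet_eq_fun E.aemeasurable aemeasurable_const)]
  exact (Set.disjoint_left.2 fun τ (h : Φ (σ τ) < s) (h' : Φ (σ τ) = s) => h.ne h').aedisjoint

/-- Equilibrium score distributions have no atoms: a positive mass of types bidding the same score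
would include a type with a positive profit, who would gain by raising the score slightly. -/
lemma no_atom (E : RegularEquilibrium M Φ g σ) (s : ℝ) :
    (typeLaw M g).real {τ | Φ (σ τ) = s} = 0 := by
  have := E.isProbabilityMeasure
  by_contra hne
  have hpos : 0 < (typeLaw M g).real {τ | Φ (σ τ) = s} :=
    lt_of_le_of_ne measureReal_nonneg (Ne.symm hne)
  have hnull : typeLaw M g {τ | Φ (σ τ) = s} ≠ 0 := fun h => hne (by simp [Measure.real, h])
  obtain ⟨τ, hτ, hs, hu⟩ : ∃ τ ∈ M.types, Φ (σ τ) = s ∧ indirectUtility M Φ s τ ≠ 0 := by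
    by_contra! hcon
    refine hnull ?_
    by_cases hs : s ∈ scores Φ
    · refine measure_mono_null_ae ?_ (typeLaw_zeroCurve (M := M) (g := g) E.rule E.regular hs)
      filter_upwards [ae_typeLaw_mem (M := M) (g := g)] with τ hτ h
      exact hcon τ hτ h
    · refine measure_mono_null_ae ?_ measure_empty
      filter_upwards [ae_typeLaw_mem (M := M) (g := g)] with τ hτ h
      exact hs (h ▸ E.score_mem hτ)
  have hmem : s ∈ scores Φ := hs ▸ E.score_mem hτ
  have hw : 0 < winProb M Φ g σ s := by
    rw [winProb_eq E.density E.aemeasurable]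
    positivity
  have hu0 : 0 < indirectUtility M Φ s τ :=
    lt_of_le_of_ne (by simpa [hs] using E.utility_nonneg hτ (by rwa [hs])) (Ne.symm hu)
  have hjump : ∀ t, s < t → winProb M Φ g σ s + 1 / 2 * (typeLaw M g).real {τ | Φ (σ τ) = s} ≤
      winProb M Φ g σ t := by
    intro t hst
    refine le_trans ?_ (E.measure_lt_le_winProb t)
    have h1 : (typeLaw M g).real {τ | Φ (σ τ) ≤ s} ≤ (typeLaw M g).real {τ | Φ (σ τ) < t} :=
      measureReal_mono fun x (hx : Φ (σ x) ≤ s) => hx.trans_lt hst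
    rw [E.measure_le_eq] at h1
    rw [winProb_eq E.density E.aemeasurable]
    linarith
  have hd := hasDerivAt_indirectUtility E.regular hτ hmem hu0.le
  have htend : Tendsto (fun t => (winProb M Φ g σ s +
      1 / 2 * (typeLaw M g).real {τ | Φ (σ τ) = s}) * indirectUtility M Φ t τ) (𝓝[>] s)
      (𝓝 ((winProb M Φ g σ s + 1 / 2 * (typeLaw M g).real {τ | Φ (σ τ) = s}) *
        indirectUtility M Φ s τ)) :=
    (hd.continuousAt.tendsto.mono_left nhdsWithin_le_nhds).const_mul _
  have hle : (winProb M Φ g σ s + 1 / 2 * (typeLaw M g).real {τ | Φ (σ τ) = s}) *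
      indirectUtility M Φ s τ ≤ winProb M Φ g σ s * indirectUtility M Φ s τ := by
    refine le_of_tendsto htend ?_
    filter_upwards [self_mem_nhdsWithin, nhdsWithin_le_nhds
      (eventually_utility_pos E.rule E.regular hτ hmem hu0)] with t ht ⟨hts, hut⟩
    have h1 := E.best_score hτ hts
    rw [hs] at h1
    exact (mul_le_mul_of_nonneg_right (hjump t ht) hut.le).trans h1
  have := mul_pos hpos hu0
  linarith

lemma winProb_eq_lt (E : RegularEquilibrium M Φ g σ) (s : ℝ) :
    winProb M Φ g σ s = (typeLaw M g).real {τ | Φ (σ τ) < s} := by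
  rw [winProb_eq E.density E.aemeasurable, E.no_atom]
  simp

lemma winProb_eq_le (E : RegularEquilibrium M Φ g σ) (s : ℝ) :
    winProb M Φ g σ s = (typeLaw M g).real {τ | Φ (σ τ) ≤ s} := by
  rw [E.winProb_eq_lt, E.measure_le_eq, E.no_atom, add_zero]

/-- Almost every type wins with positive probability. -/
lemma ae_winProb_pos (E : RegularEquilibrium M Φ g σ) :
    ∀ᵐ τ ∂(typeLaw M g), 0 < winProb M Φ g σ (Φ (σ τ)) := by
  have := E.isProbabilityMeasure
  have hsub : {τ | ¬ 0 < winProb M Φ g σ (Φ (σ τ))} ⊆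
      {τ | winProb M Φ g σ (Φ (σ τ)) = 0} := fun τ hτ =>
    le_antisymm (not_lt.1 hτ) (E.winProb_nonneg _)
  refine measure_mono_null hsub ?_
  have hzero : ∀ s, winProb M Φ g σ s = 0 → typeLaw M g {τ | Φ (σ τ) ≤ s} = 0 := by
    intro s h
    rw [E.winProb_eq_le] at h
    exact (measureReal_eq_zero_iff).1 h
  -- Either the scores that never win have a largest element, or rational numbers separate them.
  by_cases hmax : ∃ τ, winProb M Φ g σ (Φ (σ τ)) = 0 ∧
      ∀ τ', winProb M Φ g σ (Φ (σ τ')) = 0 → Φ (σ τ') ≤ Φ (σ τ)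
  · obtain ⟨τ, h0, hτ⟩ := hmax
    exact measure_mono_null (fun τ' h => hτ τ' h) (hzero _ h0)
  · push Not at hmax
    have hcov : {τ | winProb M Φ g σ (Φ (σ τ)) = 0} ⊆
        ⋃ r ∈ {r : ℚ | typeLaw M g {τ | Φ (σ τ) ≤ r} = 0}, {τ | Φ (σ τ) ≤ r} := by
      intro τ hτ
      obtain ⟨τ', h', hlt⟩ := hmax τ hτ
      obtain ⟨r, h1, h2⟩ := exists_rat_btwn hlt
      refine mem_biUnion (x := r) ?_ h1.le
      exact measure_mono_null (fun x (hx : Φ (σ x) ≤ r) => hx.trans h2.le) (hzero _ h')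
    exact measure_mono_null hcov ((measure_biUnion_null_iff (to_countable _)).2 fun r hr => hr)

/-- A score wins with positive probability as soon as the least efficient types cannot afford it. -/
lemma winProb_pos (E : RegularEquilibrium M Φ g σ) {s : ℝ} (hs : s ∈ scores Φ)
    (hu : indirectUtility M Φ s M.worst < 0) : 0 < winProb M Φ g σ s := by
  have := E.isProbabilityMeasure
  have hV : IsOpen {τ | indirectUtility M Φ s τ < 0} :=
    isOpen_lt (continuous_indirectUtility E.rule E.regular hs) continuous_const
  have hpos := typeLaw_pos E.density hV ⟨M.worst, hu, M.worst_mem⟩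
  rw [E.winProb_eq_lt, measureReal_def, ENNReal.toReal_pos_iff]
  refine ⟨hpos.trans_le (measure_mono_ae ?_), measure_lt_top _ _⟩
  filter_upwards [E.ae_winProb_pos] with τ hτ hmem
  have h1 := E.utility_nonneg hmem.2 hτ
  by_contra hcon
  have h2 := (indirectUtility_strictAnti E.rule E.regular τ).antitoneOn hs (E.score_mem hmem.2)
    (not_lt.1 hcon)
  exact absurd hmem.1 (not_lt.2 (h1.trans h2))

/-- A type that has a positive profit at the zero-profit score of the least efficient type wins
with positive probability and a positive profit. -/
lemma pos_of_utility_pos (E : RegularEquilibrium M Φ g σ) {s₀ : ℝ} (hs₀ : s₀ ∈ scores Φ)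
    (hu₀ : indirectUtility M Φ s₀ M.worst = 0) {θ : ℝ × ℝ} (hθ : θ ∈ M.types)
    (hu : 0 < indirectUtility M Φ s₀ θ) :
    0 < winProb M Φ g σ (Φ (σ θ)) ∧ 0 < indirectUtility M Φ (Φ (σ θ)) θ := by
  obtain ⟨t, hst, hts, hut⟩ : ∃ t, s₀ < t ∧ t ∈ scores Φ ∧ 0 < indirectUtility M Φ t θ :=
    ((eventually_mem_nhdsWithin (a := s₀) (s := Ioi s₀)).and (nhdsWithin_le_nhds
      (eventually_utility_pos E.rule E.regular hθ hs₀ hu))).exists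
  have hneg : indirectUtility M Φ t M.worst < 0 :=
    hu₀ ▸ indirectUtility_strictAnti E.rule E.regular M.worst hs₀ hts hst
  have h1 := (mul_pos (E.winProb_pos hts hneg) hut).trans_le (E.best_score hθ hts)
  have hw : 0 < winProb M Φ g σ (Φ (σ θ)) := by
    refine lt_of_le_of_ne (E.winProb_nonneg _) fun h => ?_
    rw [← h, zero_mul] at h1
    exact h1.false
  exact ⟨hw, pos_of_mul_pos_right h1 hw.le⟩

/-- Equilibrium scores are monotone in the product order of types. -/
lemma score_le (E : RegularEquilibrium M Φ g σ) {m m' f f' : ℝ} (hθ : (m, f) ∈ M.types)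
    (hθ' : (m', f') ∈ M.types) (hm : m' ≤ m) (hf : f' ≤ f)
    (hw : 0 < winProb M Φ g σ (Φ (σ (m, f))))
    (hu : 0 < indirectUtility M Φ (Φ (σ (m, f))) (m, f)) :
    Φ (σ (m, f)) ≤ Φ (σ (m', f')) := by
  by_contra! hlt
  have hne : (m', f') ≠ (m, f) := fun h => by rw [h] at hlt; exact hlt.false
  have hs := E.score_mem hθ
  have ht := E.score_mem hθ'
  have hut : 0 < indirectUtility M Φ (Φ (σ (m', f'))) (m, f) :=
    hu.trans (indirectUtility_strictAnti E.rule E.regular (m, f) ht hs hlt)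
  have hut' : 0 < indirectUtility M Φ (Φ (σ (m', f'))) (m', f') :=
    hut.trans_le (by
      have := indirectUtility_anti E.rule E.regular ht f f' hm
      linarith)
  have h1 := E.best_score hθ ht
  have h2 := E.best_score hθ' hs
  have h3 := single_crossing E.rule E.regular hθ hθ' hs ht hlt hu hm hf hne
  have h4 := mul_le_mul_of_nonneg_right h2 hut.le
  have h5 := mul_le_mul_of_nonneg_right h1 hut'.le
  have h6 := mul_lt_mul_of_pos_left h3 hw
  nlinarith

/-- Scores below the zero-profit score of the least efficient type never win. -/
lemma winProb_eq_zero (E : RegularEquilibrium M Φ g σ) {t : ℝ} (ht : t ∈ scores Φ)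
    (hu : 0 < indirectUtility M Φ t M.worst) : winProb M Φ g σ t = 0 := by
  have := E.isProbabilityMeasure
  by_contra hne
  have hw := lt_of_le_of_ne (E.winProb_nonneg t) (Ne.symm hne)
  have h1 := (mul_pos hw hu).trans_le (E.best_score M.worst_mem ht)
  have hw' : 0 < winProb M Φ g σ (Φ (σ M.worst)) := by
    refine lt_of_le_of_ne (E.winProb_nonneg _) fun h => ?_
    rw [← h, zero_mul] at h1
    exact h1.false
  have hu' := pos_of_mul_pos_right h1 hw'.le
  have h2 : typeLaw M g {τ | Φ (σ τ) < Φ (σ M.worst)} = 0 := by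
    refine measure_mono_null_ae ?_ measure_empty
    filter_upwards [ae_typeLaw_mem (M := M) (g := g)] with τ hτ h
    exact absurd h (not_lt.2 (E.score_le M.worst_mem hτ hτ.1.2 hτ.2.2 hw' hu'))
  rw [E.winProb_eq_lt, measureReal_def, h2] at hw'
  exact hw'.false

end RegularEquilibrium

end

/-! ### Type distributions with prescribed masses -/

section

variable {M : CostModel} {Φ : ℝ × ℝ → ℝ}

lemma indirectUtility_le_of_worse (hΦ : IsScoringRule Φ) (hreg : IsRegular M Φ) {s : ℝ}
    (hs : s ∈ scores Φ) {θ θ' : ℝ × ℝ} (hm : θ'.1 ≤ θ.1) (hf : θ'.2 ≤ θ.2) :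
    indirectUtility M Φ s θ ≤ indirectUtility M Φ s θ' := by
  have := indirectUtility_anti hΦ hreg hs θ.2 θ'.2 hm
  simp only [Prod.mk.eta] at this
  linarith

/-- The indirect utility takes every value between zero and its value at a given score. -/
lemma exists_score_of_utility (hΦ : IsScoringRule Φ) (hreg : IsRegular M Φ) {θ : ℝ × ℝ}
    (hθ : θ ∈ M.types) {s v : ℝ} (hs : s ∈ scores Φ) (hv : 0 ≤ v)
    (hvs : v ≤ indirectUtility M Φ s θ) :
    ∃ z ∈ scores Φ, s ≤ z ∧ indirectUtility M Φ z θ = v := by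
  obtain ⟨r, hr, hr0⟩ := exists_zeroScore hΦ hreg hθ
  have hanti := indirectUtility_strictAnti hΦ hreg θ
  have hsr : s ≤ r := by
    by_contra! h
    have := hanti hr hs h
    simp only [hr0] at this
    linarith
  have hsub : Icc s r ⊆ scores Φ := (ordConnected_scores hΦ).out hs hr
  have hcont : ContinuousOn (fun t => indirectUtility M Φ t θ) (Icc s r) := fun t ht =>
    (hasDerivAt_indirectUtility hreg hθ (hsub ht)
      (hr0 ▸ hanti.antitoneOn (hsub ht) hr ht.2)).continuousAt.continuousWithinAt
  obtain ⟨z, hz, hzv⟩ := intermediate_value_Icc' hsr hcont ⟨hr0.trans_le hv, hvs⟩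
  exact ⟨z, hsub hz, hz.1, hzv⟩

lemma tendsto_score_of_utility (hΦ : IsScoringRule Φ) (hreg : IsRegular M Φ) {θ : ℝ × ℝ}
    (hθ : θ ∈ M.types) {s : ℝ} (hs : s ∈ scores Φ) (hu : 0 ≤ indirectUtility M Φ s θ)
    {ι : Type*} {l : Filter ι} {x : ι → ℝ} (hx : ∀ k, x k ∈ scores Φ)
    (h : Tendsto (fun k => indirectUtility M Φ (x k) θ) l (𝓝 (indirectUtility M Φ s θ))) :
    Tendsto x l (𝓝 s) := by
  have hn := scores_mem_nhds hΦ hreg hθ hs hu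
  have hanti := indirectUtility_strictAnti hΦ hreg θ
  refine tendsto_order.2 ⟨fun a ha => ?_, fun a ha => ?_⟩
  · obtain ⟨b, ⟨hab, hbs⟩, hb⟩ : ((Ioo a s) ∩ scores Φ).Nonempty :=
      (Filter.Eventually.and (Ioo_mem_nhdsLT ha) (nhdsWithin_le_nhds hn) :
        ∀ᶠ b in 𝓝[<] s, b ∈ Ioo a s ∧ b ∈ scores Φ).exists
    filter_upwards [h.eventually_lt_const (hanti hb hs hbs)] with k hk
    exact hab.trans (by
      by_contra! hcon
      exact absurd hk (not_lt.2 (hanti.antitoneOn (hx k) hb hcon)))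
  · obtain ⟨b, ⟨hbs, hab⟩, hb⟩ : ((Ioo s a) ∩ scores Φ).Nonempty :=
      (Filter.Eventually.and (Ioo_mem_nhdsGT ha) (nhdsWithin_le_nhds hn) :
        ∀ᶠ b in 𝓝[>] s, b ∈ Ioo s a ∧ b ∈ scores Φ).exists
    filter_upwards [h.eventually_const_lt (hanti hs hb hbs)] with k hk
    exact lt_trans (by
      by_contra! hcon
      exact absurd hk (not_lt.2 (hanti.antitoneOn hb (hx k) hcon))) hab

/-- The square of side `δ` with least efficient corner `θ`. -/
def box (θ : ℝ × ℝ) (δ : ℝ) : Set (ℝ × ℝ) := Icc (θ.1 - δ) θ.1 ×ˢ Icc (θ.2 - δ) θ.2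

/-- The uniform density on the square `box θ δ`. -/
noncomputable def boxDensity (θ : ℝ × ℝ) (δ : ℝ) : ℝ × ℝ → ℝ :=
  (box θ δ).indicator fun _ => 1 / δ ^ 2

/-- The area of the type space. -/
def CostModel.area (M : CostModel) : ℝ := (M.mHi - M.mLo) * (M.fHi - M.fLo)

/-- A density that gives most of its mass to small squares at the types `θ 0, …, θ (J - 1)`, in the
proportions `w`, and spreads the mass `δ` uniformly. -/
noncomputable def mixture (M : CostModel) (θ : ℕ → ℝ × ℝ) (J : ℕ) (w : ℕ → ℝ) (δ : ℝ)
    (τ : ℝ × ℝ) : ℝ :=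
  (1 - δ) * ∑ i ∈ Finset.range J, w i * boxDensity (θ i) δ τ + δ * (1 / M.area)

/-- A sequence of types that improve strictly in both costs and stay inside the type space. -/
structure IsChain (M : CostModel) (θ : ℕ → ℝ × ℝ) : Prop where
  fst_lt : ∀ i, (θ (i + 1)).1 < (θ i).1
  snd_lt : ∀ i, (θ (i + 1)).2 < (θ i).2
  lt_fst : ∀ i, M.mLo < (θ i).1
  lt_snd : ∀ i, M.fLo < (θ i).2
  fst_le : ∀ i, (θ i).1 ≤ M.mHi
  snd_lt_fHi : ∀ i, (θ i).2 < M.fHi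

/-- The squares of side `δ` at the first types of the chain lie in the type space and are ordered
like the types. -/
structure IsSmall (M : CostModel) (θ : ℕ → ℝ × ℝ) (J : ℕ) (δ : ℝ) : Prop where
  pos : 0 < δ
  lt_one : δ < 1
  le_fst : ∀ i ≤ J, M.mLo ≤ (θ i).1 - δ
  le_snd : ∀ i ≤ J, M.fLo ≤ (θ i).2 - δ
  fst_le : ∀ i ≤ J, (θ (i + 1)).1 ≤ (θ i).1 - δ
  snd_le : ∀ i ≤ J, (θ (i + 1)).2 ≤ (θ i).2 - δ

lemma IsChain.eventually_isSmall {θ : ℕ → ℝ × ℝ} (hθ : IsChain M θ) (J : ℕ) :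
    ∀ᶠ δ in 𝓝[>] (0 : ℝ), IsSmall M θ J δ := by
  have key : ∀ a : ℝ, 0 < a → ∀ᶠ δ in 𝓝[>] (0 : ℝ), δ < a := fun a ha =>
    nhdsWithin_le_nhds (Iio_mem_nhds ha)
  have h : ∀ᶠ δ in 𝓝[>] (0 : ℝ), ∀ i ∈ Finset.range (J + 1),
      (δ < (θ i).1 - M.mLo ∧ δ < (θ i).2 - M.fLo) ∧
      (δ < (θ i).1 - (θ (i + 1)).1 ∧ δ < (θ i).2 - (θ (i + 1)).2) := by
    rw [Filter.eventually_all_finset]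
    intro i _
    exact ((key _ (sub_pos.2 (hθ.lt_fst i))).and (key _ (sub_pos.2 (hθ.lt_snd i)))).and
      ((key _ (sub_pos.2 (hθ.fst_lt i))).and (key _ (sub_pos.2 (hθ.snd_lt i))))
  filter_upwards [self_mem_nhdsWithin, key 1 one_pos, h] with δ h0 h1 h
  have h' : ∀ i ≤ J, _ := fun i hi => h i (Finset.mem_range.2 (by omega))
  exact ⟨h0, h1, fun i hi => by linarith [(h' i hi).1.1], fun i hi => by linarith [(h' i hi).1.2],
    fun i hi => by linarith [(h' i hi).2.1], fun i hi => by linarith [(h' i hi).2.2]⟩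

lemma CostModel.area_pos (M : CostModel) : 0 < M.area :=
  mul_pos (sub_pos.2 M.mLo_lt_mHi) (sub_pos.2 M.fLo_lt_fHi)

lemma volume_types : volume.real M.types = M.area := by
  rw [CostModel.types, Measure.volume_eq_prod, measureReal_prod_prod, Real.volume_real_Icc_of_le
    M.mLo_lt_mHi.le, Real.volume_real_Icc_of_le M.fLo_lt_fHi.le, CostModel.area]

lemma measurableSet_box (θ : ℝ × ℝ) (δ : ℝ) : MeasurableSet (box θ δ) :=
  measurableSet_Icc.prod measurableSet_Icc

lemma measurable_boxDensity (θ : ℝ × ℝ) (δ : ℝ) : Measurable (boxDensity θ δ) :=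
  measurable_const.indicator (measurableSet_box θ δ)

instance : IsFiniteMeasure (volume.restrict M.types) :=
  ⟨by rw [Measure.restrict_apply_univ]; exact isCompact_types.measure_lt_top⟩

lemma integrable_mul_boxDensity {ζ : ℝ × ℝ → ℝ} (hζ : Measurable ζ) {B : ℝ}
    (hB : ∀ τ, |ζ τ| ≤ B) (θ : ℝ × ℝ) (δ : ℝ) :
    Integrable (fun τ => ζ τ * boxDensity θ δ τ) (volume.restrict M.types) := by
  refine Integrable.of_bound (hζ.mul (measurable_boxDensity θ δ)).aestronglyMeasurable
    (B * |1 / δ ^ 2|) (Eventually.of_forall fun τ => ?_)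
  rw [Real.norm_eq_abs, abs_mul]
  refine mul_le_mul (hB τ) ?_ (abs_nonneg _) ((abs_nonneg _).trans (hB τ))
  unfold boxDensity
  by_cases h : τ ∈ box θ δ
  · rw [indicator_of_mem h]
  · rw [indicator_of_notMem h, abs_zero]
    exact abs_nonneg _

lemma integrable_boxDensity (θ : ℝ × ℝ) (δ : ℝ) :
    Integrable (boxDensity θ δ) (volume.restrict M.types) := by
  simpa using integrable_mul_boxDensity (M := M) (ζ := fun _ => 1) measurable_const (B := 1)
    (by simp) θ δ

lemma box_subset_types {θ : ℝ × ℝ} (hθ : θ ∈ M.types) {δ : ℝ} (h1 : M.mLo ≤ θ.1 - δ)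
    (h2 : M.fLo ≤ θ.2 - δ) : box θ δ ⊆ M.types := fun _ hτ =>
  ⟨⟨h1.trans hτ.1.1, hτ.1.2.trans hθ.1.2⟩, h2.trans hτ.2.1, hτ.2.2.trans hθ.2.2⟩

lemma integral_boxDensity {θ : ℝ × ℝ} {δ : ℝ} (hδ : 0 < δ) (h : box θ δ ⊆ M.types) :
    ∫ τ in M.types, boxDensity θ δ τ = 1 := by
  unfold boxDensity
  rw [setIntegral_indicator (measurableSet_box θ δ), inter_eq_self_of_subset_right h,
    setIntegral_const, box, Measure.volume_eq_prod, measureReal_prod_prod,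
    Real.volume_real_Icc_of_le (by linarith), Real.volume_real_Icc_of_le (by linarith), smul_eq_mul]
  field_simp
  ring

lemma boxDensity_nonneg (θ : ℝ × ℝ) (δ : ℝ) (τ : ℝ × ℝ) : 0 ≤ boxDensity θ δ τ :=
  indicator_nonneg (fun _ _ => by positivity) _

variable {θ : ℕ → ℝ × ℝ} {J : ℕ} {w : ℕ → ℝ} {δ : ℝ}

lemma IsChain.mem_types (hθ : IsChain M θ) (i : ℕ) : θ i ∈ M.types :=
  ⟨⟨(hθ.lt_fst i).le, hθ.fst_le i⟩, (hθ.lt_snd i).le, (hθ.snd_lt_fHi i).le⟩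

lemma IsChain.box_subset (hθ : IsChain M θ) (hδ : IsSmall M θ J δ) {i : ℕ} (hi : i ≤ J) :
    box (θ i) δ ⊆ M.types :=
  box_subset_types (hθ.mem_types i) (hδ.le_fst i hi) (hδ.le_snd i hi)

lemma integrable_mixture : Integrable (mixture M θ J w δ) (volume.restrict M.types) := by
  unfold mixture
  refine Integrable.add ((integrable_finsetSum _ fun i _ => ?_).const_mul _) (integrable_const _)
  exact (integrable_boxDensity _ _).const_mul _

lemma mixture_mem_densities (hθ : IsChain M θ) (hδ : IsSmall M θ J δ) (hw : ∀ i < J, 0 ≤ w i)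
    (hsum : ∑ i ∈ Finset.range J, w i = 1) : mixture M θ J w δ ∈ densities M := by
  have harea := M.area_pos
  have h0 := hδ.pos
  have h1 := hδ.lt_one
  refine ⟨integrable_mixture, Eventually.of_forall fun τ => ?_, ?_⟩
  · unfold mixture
    refine add_pos_of_nonneg_of_pos (mul_nonneg (by linarith) (Finset.sum_nonneg fun i hi => ?_))
      (by positivity)
    exact mul_nonneg (hw i (Finset.mem_range.1 hi)) (boxDensity_nonneg _ _ _)
  · unfold mixture
    rw [integral_add ((integrable_finsetSum _ fun i _ =>
      (integrable_boxDensity _ _).const_mul _).const_mul _) (integrable_const _),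
      integral_const_mul, integral_finsetSum _ fun i _ => (integrable_boxDensity _ _).const_mul _,
      setIntegral_const, volume_types]
    have : ∀ i ∈ Finset.range J, ∫ τ in M.types, w i * boxDensity (θ i) δ τ = w i := by
      intro i hi
      rw [integral_const_mul, integral_boxDensity h0
        (hθ.box_subset hδ (Finset.mem_range.1 hi).le), mul_one]
    rw [Finset.sum_congr rfl this, hsum, smul_eq_mul]
    field_simp
    ring

/-- Moments are affine in the weights of a mixture. -/
lemma moment_mixture {ζ : ℝ × ℝ → ℝ} (hζ : Measurable ζ) {B : ℝ} (hB : ∀ τ, |ζ τ| ≤ B) :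
    moment M ζ (mixture M θ J w δ) =
      (1 - δ) * ∑ i ∈ Finset.range J, w i * moment M ζ (boxDensity (θ i) δ) +
        ∫ τ in M.types, ζ τ * (δ * (1 / M.area)) := by
  have hζi : Integrable ζ (volume.restrict M.types) :=
    Integrable.of_bound hζ.aestronglyMeasurable B (Eventually.of_forall hB)
  have hi : ∀ i, Integrable (fun τ => w i * (ζ τ * boxDensity (θ i) δ τ))
      (volume.restrict M.types) := fun i => (integrable_mul_boxDensity hζ hB _ _).const_mul _
  have heq : ∀ τ, ζ τ * mixture M θ J w δ τ =
      (1 - δ) * ∑ i ∈ Finset.range J, w i * (ζ τ * boxDensity (θ i) δ τ) +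
        ζ τ * (δ * (1 / M.area)) := by
    intro τ
    unfold mixture
    rw [mul_add, mul_left_comm, Finset.mul_sum]
    congr 2
    exact Finset.sum_congr rfl fun i _ => by ring
  unfold moment
  simp_rw [heq]
  rw [integral_add ((integrable_finsetSum _ fun i _ => hi i).const_mul _) (hζi.mul_const _),
    integral_const_mul, integral_finsetSum _ fun i _ => hi i]
  simp_rw [integral_const_mul]

/-- A set of types that contains some of the squares has at least their mass. -/
lemma le_typeLaw_mixture (hθ : IsChain M θ) (hδ : IsSmall M θ J δ) (hw : ∀ i < J, 0 ≤ w i)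
    (hsum : ∑ i ∈ Finset.range J, w i = 1) {S : Set (ℝ × ℝ)}
    (hS : NullMeasurableSet S (typeLaw M (mixture M θ J w δ))) {T : Finset ℕ}
    (hT : T ⊆ Finset.range J) (hsub : ∀ i ∈ T, box (θ i) δ ⊆ S) :
    (1 - δ) * ∑ i ∈ T, w i ≤ (typeLaw M (mixture M θ J w δ)).real S := by
  have hg := mixture_mem_densities hθ hδ hw hsum
  have := isProbabilityMeasure_typeLaw hg
  have harea := M.area_pos
  have h0 := hδ.pos
  have h1 := hδ.lt_one
  have hS' : NullMeasurableSet S (volume.restrict M.types) :=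
    hS.mono_ac (absolutelyContinuous_typeLaw hg)
  have hreal : (typeLaw M (mixture M θ J w δ)).real S =
      ∫ τ in M.types, S.indicator (fun _ => (1 : ℝ)) τ * mixture M θ J w δ τ := by
    rw [← integral_typeLaw hg, integral_indicator₀ hS]
    simp
  have hleft : (1 - δ) * ∑ i ∈ T, w i =
      ∫ τ in M.types, (1 - δ) * ∑ i ∈ T, w i * boxDensity (θ i) δ τ := by
    rw [integral_const_mul, integral_finsetSum _ fun i _ => (integrable_boxDensity _ _).const_mul _]
    congr 1
    refine Finset.sum_congr rfl fun i hi => ?_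
    rw [integral_const_mul, integral_boxDensity h0
      (hθ.box_subset hδ (Finset.mem_range.1 (hT hi)).le), mul_one]
  rw [hreal, hleft]
  refine integral_mono ((integrable_finsetSum _ fun i _ =>
    (integrable_boxDensity _ _).const_mul _).const_mul _) ?_ fun τ => ?_
  · have : (fun τ => S.indicator (fun _ => (1 : ℝ)) τ * mixture M θ J w δ τ) =
        S.indicator (mixture M θ J w δ) := by
      funext τ
      by_cases h : τ ∈ S <;> simp [h]
    rw [this]
    exact integrable_mixture.indicator₀ hS'
  · have hnn : ∀ i ∈ Finset.range J, 0 ≤ w i * boxDensity (θ i) δ τ := fun i hi =>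
      mul_nonneg (hw i (Finset.mem_range.1 hi)) (boxDensity_nonneg _ _ _)
    by_cases h : τ ∈ S
    · simp only [indicator_of_mem h, one_mul, mixture]
      have h2 := mul_le_mul_of_nonneg_left
        (Finset.sum_le_sum_of_subset_of_nonneg hT fun i hi _ => hnn i hi)
        (sub_nonneg.2 h1.le)
      have h3 : 0 ≤ δ * (1 / M.area) := by positivity
      linarith
    · simp only [indicator_of_notMem h, zero_mul]
      refine le_of_eq ?_
      rw [Finset.sum_eq_zero, mul_zero]
      intro i hi
      rw [boxDensity, indicator_of_notMem fun hb => h (hsub i hi hb), mul_zero]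

end

/-! ### Equilibrium scores on a chain of types -/

section

variable {M : CostModel} {Φ : ℝ × ℝ → ℝ} {θ : ℕ → ℝ × ℝ} {J : ℕ}

/-- The total weight of the first `i` types. -/
def cumul (p : ℕ → ℝ) (i : ℕ) : ℝ := ∑ l ∈ Finset.range i, p l

lemma cumul_succ (p : ℕ → ℝ) (i : ℕ) : cumul p (i + 1) = cumul p i + p i :=
  Finset.sum_range_succ _ _

lemma cumul_zero (p : ℕ → ℝ) : cumul p 0 = 0 := Finset.sum_range_zero _

lemma cumul_pos {p : ℕ → ℝ} (hp : ∀ i, 0 < p i) (i : ℕ) : 0 < cumul p (i + 1) :=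
  Finset.sum_pos (fun i _ => hp i) ⟨0, by simp⟩

lemma cumul_nonneg {p : ℕ → ℝ} (hp : ∀ i, 0 < p i) (i : ℕ) : 0 ≤ cumul p i :=
  Finset.sum_nonneg fun i _ => (hp i).le

lemma IsChain.antitone_fst (hθ : IsChain M θ) : Antitone fun i => (θ i).1 :=
  antitone_nat_of_succ_le fun i => (hθ.fst_lt i).le

lemma IsChain.antitone_snd (hθ : IsChain M θ) : Antitone fun i => (θ i).2 :=
  antitone_nat_of_succ_le fun i => (hθ.snd_lt i).le

/-- The scores that separate the bids of successive types of a chain when there are only these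
types, with masses proportional to `p`: type `θ i` bids between `s i` and `s (i + 1)` and is
indifferent between winning against all worse types at `s i` and winning also against its own type
at `s (i + 1)`. The value `s 0` plays no role. -/
structure IsBidLadder (M : CostModel) (Φ : ℝ × ℝ → ℝ) (θ : ℕ → ℝ × ℝ) (p s : ℕ → ℝ) : Prop where
  mem : ∀ i, s (i + 1) ∈ scores Φ
  indifferent : ∀ i, cumul p (i + 1) * indirectUtility M Φ (s (i + 1)) (θ i) =
    cumul p i * indirectUtility M Φ (s i) (θ i)

section Ladder

variable {p s : ℕ → ℝ}

lemma IsChain.utility_lt_succ (hθ : IsChain M θ) (hΦ : IsScoringRule Φ) (hreg : IsRegular M Φ)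
    {t : ℝ} (ht : t ∈ scores Φ) (i : ℕ) :
    indirectUtility M Φ t (θ i) < indirectUtility M Φ t (θ (i + 1)) := by
  have := indirectUtility_anti hΦ hreg ht (θ i).2 (θ (i + 1)).2 (hθ.fst_lt i).le
  simp only [Prod.mk.eta] at this
  linarith [hθ.snd_lt i]

lemma IsBidLadder.utility_nonneg (hs : IsBidLadder M Φ θ p s) (hθ : IsChain M θ)
    (hΦ : IsScoringRule Φ) (hreg : IsRegular M Φ) (hp : ∀ i, 0 < p i) (i : ℕ) :
    0 ≤ indirectUtility M Φ (s (i + 1)) (θ i) := by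
  induction i with
  | zero =>
    have h := hs.indifferent 0
    rw [cumul_zero, zero_mul] at h
    exact (mul_eq_zero.1 h).resolve_left (cumul_pos hp 0).ne' |>.ge
  | succ i ih =>
    have h := hs.indifferent (i + 1)
    have h1 := ih.trans (hθ.utility_lt_succ hΦ hreg (hs.mem i) i).le
    refine nonneg_of_mul_nonneg_right ?_ (cumul_pos hp (i + 1))
    rw [h]
    exact mul_nonneg (cumul_nonneg hp _) h1

lemma IsBidLadder.utility_pos (hs : IsBidLadder M Φ θ p s) (hθ : IsChain M θ)
    (hΦ : IsScoringRule Φ) (hreg : IsRegular M Φ) (hp : ∀ i, 0 < p i) (i : ℕ) :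
    0 < indirectUtility M Φ (s (i + 1)) (θ (i + 1)) :=
  (hs.utility_nonneg hθ hΦ hreg hp i).trans_lt (hθ.utility_lt_succ hΦ hreg (hs.mem i) i)

lemma exists_isBidLadder (hθ : IsChain M θ) (hΦ : IsScoringRule Φ) (hreg : IsRegular M Φ)
    (hp : ∀ i, 0 < p i) : ∃ s, IsBidLadder M Φ θ p s := by
  obtain ⟨s0, hs0, hu0⟩ := exists_zeroScore hΦ hreg (hθ.mem_types 0)
  have step : ∀ i (t : ℝ), t ∈ scores Φ ∧ 0 ≤ indirectUtility M Φ t (θ i) →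
      ∃ z, (z ∈ scores Φ ∧ 0 ≤ indirectUtility M Φ z (θ (i + 1))) ∧
        cumul p (i + 1) * indirectUtility M Φ z (θ i) =
          cumul p i * indirectUtility M Φ t (θ i) := by
    intro i t ⟨ht, hut⟩
    have hP := cumul_pos hp i
    have hle : cumul p i ≤ cumul p (i + 1) := by rw [cumul_succ]; linarith [hp i]
    obtain ⟨z, hz, -, hzu⟩ := exists_score_of_utility hΦ hreg (hθ.mem_types i) ht
      (v := cumul p i / cumul p (i + 1) * indirectUtility M Φ t (θ i))
      (mul_nonneg (div_nonneg (cumul_nonneg hp i) hP.le) hut)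
      (mul_le_of_le_one_left hut ((div_le_one hP).2 hle))
    refine ⟨z, ⟨hz, ?_⟩, ?_⟩
    · refine le_trans ?_ (hθ.utility_lt_succ hΦ hreg hz i).le
      rw [hzu]
      exact mul_nonneg (div_nonneg (cumul_nonneg hp i) hP.le) hut
    · rw [hzu]
      field_simp
  choose! F hF1 hF2 using step
  let s : ℕ → ℝ := fun i => Nat.rec s0 (fun i t => F i t) i
  have hsucc : ∀ i, s (i + 1) = F i (s i) := fun i => rfl
  have hs : ∀ i, s i ∈ scores Φ ∧ 0 ≤ indirectUtility M Φ (s i) (θ i) := by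
    intro i
    induction i with
    | zero => exact ⟨hs0, hu0.ge⟩
    | succ i ih => rw [hsucc]; exact hF1 i _ ih
  exact ⟨s, fun i => (hs (i + 1)).1, fun i => by rw [hsucc]; exact hF2 i _ (hs i)⟩

lemma IsBidLadder.congr {p' s' : ℕ → ℝ} (hs : IsBidLadder M Φ θ p s)
    (hs' : IsBidLadder M Φ θ p' s') (hΦ : IsScoringRule Φ) (hreg : IsRegular M Φ)
    (hp : ∀ i, 0 < p i) {j : ℕ} (h : ∀ i < j, p i = p' i) : ∀ i < j, s (i + 1) = s' (i + 1) := by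
  have hcum : ∀ i ≤ j, cumul p i = cumul p' i := fun i hi =>
    Finset.sum_congr rfl fun l hl => h l ((Finset.mem_range.1 hl).trans_le hi)
  intro i
  induction i with
  | zero =>
    intro hi
    have h1 := hs.indifferent 0
    have h2 := hs'.indifferent 0
    rw [← hcum 1 hi, ← hcum 0 (by omega), cumul_zero, zero_mul] at h2
    rw [cumul_zero, zero_mul, ← h2] at h1
    exact (indirectUtility_strictAnti hΦ hreg (θ 0)).injOn (hs.mem 0) (hs'.mem 0)
      (mul_left_cancel₀ (cumul_pos hp 0).ne' h1)
  | succ i ih =>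
    intro hi
    have h1 := hs.indifferent (i + 1)
    have h2 := hs'.indifferent (i + 1)
    rw [← hcum (i + 1 + 1) (by omega), ← hcum (i + 1) (by omega), ← ih (by omega)] at h2
    rw [← h2] at h1
    exact (indirectUtility_strictAnti hΦ hreg _).injOn (hs.mem _) (hs'.mem _)
      (mul_left_cancel₀ (cumul_pos hp _).ne' h1)

/-- Rescaling all masses does not change the separating scores. -/
lemma IsBidLadder.smul (hs : IsBidLadder M Φ θ p s) (c : ℝ) :
    IsBidLadder M Φ θ (fun i => c * p i) s := by
  have : ∀ i, cumul (fun i => c * p i) i = c * cumul p i := fun i => by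
    simp [cumul, Finset.mul_sum]
  exact ⟨hs.mem, fun i => by rw [this, this, mul_assoc, hs.indifferent, mul_assoc]⟩

end Ladder

section Limit

variable {w : ℕ → ℝ} {δ : ℝ} {σ : ℝ × ℝ → ℝ × ℝ}

lemma RegularEquilibrium.pos_of_snd_lt {g : ℝ × ℝ → ℝ} (E : RegularEquilibrium M Φ g σ)
    {τ : ℝ × ℝ} (hτ : τ ∈ M.types) (h : τ.2 < M.fHi) :
    0 < winProb M Φ g σ (Φ (σ τ)) ∧ 0 < indirectUtility M Φ (Φ (σ τ)) τ := by
  obtain ⟨s0, hs0, hu0⟩ := exists_zeroScore E.rule E.regular M.worst_mem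
  refine E.pos_of_utility_pos hs0 hu0 hτ ?_
  have := indirectUtility_anti E.rule E.regular hs0 M.fHi τ.2 hτ.1.2
  rw [show (M.mHi, M.fHi) = M.worst from rfl, hu0] at this
  simp only [Prod.mk.eta] at this
  linarith

/-- The winning probability of a type that lies between the squares `i - 1` and `i`. -/
lemma winProb_between (hθ : IsChain M θ) (hδ : IsSmall M θ J δ) (hw : ∀ i < J, 0 ≤ w i)
    (hsum : cumul w J = 1) (E : RegularEquilibrium M Φ (mixture M θ J w δ) σ) {i : ℕ} (hi : i ≤ J)
    {τ : ℝ × ℝ} (hτ : τ ∈ M.types) (hτf : τ.2 < M.fHi)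
    (hworse : ∀ l < i, ∀ x ∈ box (θ l) δ, τ.1 ≤ x.1 ∧ τ.2 ≤ x.2)
    (hbetter : ∀ l < J, i ≤ l → ∀ x ∈ box (θ l) δ, x.1 ≤ τ.1 ∧ x.2 ≤ τ.2) :
    (1 - δ) * cumul w i ≤ winProb M Φ (mixture M θ J w δ) σ (Φ (σ τ)) ∧
      winProb M Φ (mixture M θ J w δ) σ (Φ (σ τ)) ≤ (1 - δ) * cumul w i + δ := by
  have := E.isProbabilityMeasure
  constructor
  · rw [E.winProb_eq_le]
    refine le_typeLaw_mixture hθ hδ hw hsum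
      (nullMeasurableSet_le E.aemeasurable aemeasurable_const)
      (Finset.range_subset_range.2 hi) fun l hl x hx => ?_
    have hl := Finset.mem_range.1 hl
    have hx' := hθ.box_subset hδ (hl.le.trans hi) hx
    have hxf : x.2 < M.fHi := hx.2.2.trans_lt (hθ.snd_lt_fHi l)
    have hp := E.pos_of_snd_lt hx' hxf
    exact E.score_le hx' hτ (hworse l hl x hx).1 (hworse l hl x hx).2 hp.1 hp.2
  · rw [E.winProb_eq_lt]
    have hnull : NullMeasurableSet {x | Φ (σ x) < Φ (σ τ)} (typeLaw M (mixture M θ J w δ)) :=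
      nullMeasurableSet_lt E.aemeasurable aemeasurable_const
    have h1 := le_typeLaw_mixture hθ hδ hw hsum hnull.compl
      (T := Finset.range J \ Finset.range i) Finset.sdiff_subset fun l hl x hx => ?_
    · rw [probReal_compl_eq_one_sub₀ hnull] at h1
      have h2 : ∑ l ∈ Finset.range J \ Finset.range i, w l = 1 - cumul w i := by
        rw [← hsum, cumul, cumul, ← Finset.sum_sdiff (Finset.range_subset_range.2 hi)]
        ring
      rw [h2] at h1
      linarith
    · rw [Finset.mem_sdiff, Finset.mem_range, Finset.mem_range, not_lt] at hl
      have hx' := hθ.box_subset hδ hl.1.le hx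
      have hp := E.pos_of_snd_lt hτ hτf
      exact not_lt.2 (E.score_le hτ hx' (hbetter l hl.1 hl.2 x hx).1 (hbetter l hl.1 hl.2 x hx).2
        hp.1 hp.2)

lemma box_le {l : ℕ} {x : ℝ × ℝ} (hx : x ∈ box (θ l) δ) : x.1 ≤ (θ l).1 ∧ x.2 ≤ (θ l).2 :=
  ⟨hx.1.2, hx.2.2⟩

lemma le_box (hθ : IsChain M θ) (hδ : IsSmall M θ J δ) {l i : ℕ} (hl : l < i) (hi : i ≤ J)
    {x : ℝ × ℝ} (hx : x ∈ box (θ l) δ) : (θ i).1 ≤ x.1 ∧ (θ i).2 ≤ x.2 := by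
  have h1 := hδ.fst_le l (by omega)
  have h2 := hδ.snd_le l (by omega)
  have h3 := hθ.antitone_fst (show l + 1 ≤ i by omega)
  have h4 := hθ.antitone_snd (show l + 1 ≤ i by omega)
  simp only at h3 h4
  exact ⟨by linarith [hx.1.1], by linarith [hx.2.1]⟩

lemma winProb_worst_corner (hθ : IsChain M θ) (hδ : IsSmall M θ J δ) (hw : ∀ i < J, 0 ≤ w i)
    (hsum : cumul w J = 1) (E : RegularEquilibrium M Φ (mixture M θ J w δ) σ) {i : ℕ}
    (hi : i ≤ J) :
    (1 - δ) * cumul w i ≤ winProb M Φ (mixture M θ J w δ) σ (Φ (σ (θ i))) ∧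
      winProb M Φ (mixture M θ J w δ) σ (Φ (σ (θ i))) ≤ (1 - δ) * cumul w i + δ := by
  refine winProb_between hθ hδ hw hsum E hi (hθ.mem_types i) (hθ.snd_lt_fHi i)
    (fun l hl x hx => le_box hθ hδ hl hi hx) fun l hl hil x hx => ?_
  exact ⟨(box_le hx).1.trans (hθ.antitone_fst hil), (box_le hx).2.trans (hθ.antitone_snd hil)⟩

/-- The most efficient type in the square of side `δ` at `θ`. -/
def bestCorner (θ : ℝ × ℝ) (δ : ℝ) : ℝ × ℝ := (θ.1 - δ, θ.2 - δ)

lemma bestCorner_mem (hθ : IsChain M θ) (hδ : IsSmall M θ J δ) {i : ℕ} (hi : i ≤ J) :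
    bestCorner (θ i) δ ∈ M.types := by
  have := hδ.pos
  exact hθ.box_subset hδ hi ⟨⟨le_rfl, by simp only [bestCorner]; linarith⟩, le_rfl,
    by simp only [bestCorner]; linarith⟩

lemma winProb_bestCorner (hθ : IsChain M θ) (hδ : IsSmall M θ J δ) (hw : ∀ i < J, 0 ≤ w i)
    (hsum : cumul w J = 1) (E : RegularEquilibrium M Φ (mixture M θ J w δ) σ) {i : ℕ}
    (hi : i < J) :
    (1 - δ) * cumul w (i + 1) ≤ winProb M Φ (mixture M θ J w δ) σ (Φ (σ (bestCorner (θ i) δ))) ∧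
      winProb M Φ (mixture M θ J w δ) σ (Φ (σ (bestCorner (θ i) δ))) ≤
        (1 - δ) * cumul w (i + 1) + δ := by
  have hpos := hδ.pos
  refine winProb_between hθ hδ hw hsum E hi (bestCorner_mem hθ hδ hi.le)
    (lt_of_le_of_lt (by simp only [bestCorner]; linarith) (hθ.snd_lt_fHi i))
    (fun l hl x hx => ?_) fun l hl hil x hx => ?_
  · rcases Nat.lt_succ_iff_lt_or_eq.1 hl with h | rfl
    · have := le_box hθ hδ h hi.le hx
      exact ⟨by simp only [bestCorner]; linarith, by simp only [bestCorner]; linarith⟩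
    · exact ⟨hx.1.1, hx.2.1⟩
  · have h1 := hθ.antitone_fst hil
    have h2 := hθ.antitone_snd hil
    have h3 := hδ.fst_le i hi.le
    have h4 := hδ.snd_le i hi.le
    simp only at h1 h2
    simp only [bestCorner]
    exact ⟨by linarith [(box_le hx).1], by linarith [(box_le hx).2]⟩

lemma RegularEquilibrium.winProb_le_one {g : ℝ × ℝ → ℝ} (E : RegularEquilibrium M Φ g σ) (s : ℝ) :
    winProb M Φ g σ s ≤ 1 := by
  have := E.isProbabilityMeasure
  rw [E.winProb_eq_lt]
  exact measureReal_le_one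

/-- The worst type of a small square loses little by bidding like the best type of the square. -/
lemma payoff_bestCorner (hθ : IsChain M θ) (hδ : IsSmall M θ J δ)
    {g : ℝ × ℝ → ℝ} (E : RegularEquilibrium M Φ g σ) {i : ℕ} (hi : i ≤ J) :
    winProb M Φ g σ (Φ (σ (θ i))) * indirectUtility M Φ (Φ (σ (θ i))) (θ i) - 2 * δ ≤
      winProb M Φ g σ (Φ (σ (bestCorner (θ i) δ))) *
        indirectUtility M Φ (Φ (σ (bestCorner (θ i) δ))) (θ i) := by
  have hpos := hδ.pos
  have hmem := bestCorner_mem hθ hδ hi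
  have hs := E.score_mem (hθ.mem_types i)
  have hb := E.score_mem hmem
  set b := Φ (σ (bestCorner (θ i) δ))
  set a := Φ (σ (θ i))
  have h1 : winProb M Φ g σ a * indirectUtility M Φ a (θ i) ≤
      winProb M Φ g σ a * indirectUtility M Φ a (bestCorner (θ i) δ) :=
    mul_le_mul_of_nonneg_left (indirectUtility_le_of_worse E.rule E.regular hs
      (by simp only [bestCorner]; linarith) (by simp only [bestCorner]; linarith))
      (E.winProb_nonneg _)
  have h2 := E.best_score hmem hs
  have h3 : indirectUtility M Φ b (bestCorner (θ i) δ) ≤ indirectUtility M Φ b (θ i) + 2 * δ := by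
    have := indirectUtility_le E.rule E.regular hb (m := (θ i).1) (m' := (θ i).1 - δ) (θ i).2
      ((θ i).2 - δ) (by linarith)
    simp only [Prod.mk.eta] at this
    simp only [bestCorner]
    linarith
  have h4 := mul_le_mul_of_nonneg_left h3 (E.winProb_nonneg b)
  have h5 := mul_le_mul_of_nonneg_right (E.winProb_le_one b) hpos.le
  linarith

/-- As the squares shrink and the uniform background vanishes, the equilibrium scores of the types
of the chain converge to the ladder of separating scores. -/
theorem tendsto_score_ladder (hΦ : IsScoringRule Φ) (hreg : IsRegular M Φ) (hθ : IsChain M θ)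
    {w : ℕ → ℕ → ℝ} {p s : ℕ → ℝ} {δ : ℕ → ℝ} {σ : ℕ → ℝ × ℝ → ℝ × ℝ}
    (hδ : ∀ k, IsSmall M θ J (δ k)) (hδ0 : Tendsto δ atTop (𝓝 0))
    (hw : ∀ k, ∀ i < J, 0 ≤ w k i) (hsum : ∀ k, cumul (w k) J = 1)
    (hwp : ∀ i < J, Tendsto (fun k => w k i) atTop (𝓝 (p i))) (hp : ∀ i, 0 < p i)
    (hs : IsBidLadder M Φ θ p s)
    (hσ : ∀ k, IsEquilibrium M Φ (mixture M θ J (w k) (δ k)) (σ k)) {i : ℕ} (hi : i < J) :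
    Tendsto (fun k => Φ (σ k (θ (i + 1)))) atTop (𝓝 (s (i + 1))) := by
  have E : ∀ k, RegularEquilibrium M Φ (mixture M θ J (w k) (δ k)) (σ k) := fun k =>
    ⟨hΦ, hreg, mixture_mem_densities hθ (hδ k) (hw k) (hsum k), hσ k⟩
  let W : ℕ → ℝ → ℝ := fun k => winProb M Φ (mixture M θ J (w k) (δ k)) (σ k)
  let a : ℕ → ℕ → ℝ := fun i k => Φ (σ k (θ i))
  let b : ℕ → ℕ → ℝ := fun i k => Φ (σ k (bestCorner (θ i) (δ k)))
  have hcum : ∀ i ≤ J, Tendsto (fun k => (1 - δ k) * cumul (w k) i) atTop (𝓝 (cumul p i)) := by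
    intro i hi
    have h1 : Tendsto (fun k => cumul (w k) i) atTop (𝓝 (cumul p i)) :=
      tendsto_finsetSum _ fun l hl => hwp l ((Finset.mem_range.1 hl).trans_le hi)
    simpa using ((tendsto_const_nhds (x := (1 : ℝ))).sub hδ0).mul h1
  have hcum' : ∀ i ≤ J, Tendsto (fun k => (1 - δ k) * cumul (w k) i + δ k) atTop
      (𝓝 (cumul p i)) := by
    intro i hi
    simpa using (hcum i hi).add hδ0
  have hWa : ∀ i ≤ J, Tendsto (fun k => W k (a i k)) atTop (𝓝 (cumul p i)) := fun i hi =>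
    tendsto_of_tendsto_of_tendsto_of_le_of_le (hcum i hi) (hcum' i hi)
      (fun k => (winProb_worst_corner hθ (hδ k) (hw k) (hsum k) (E k) hi).1)
      fun k => (winProb_worst_corner hθ (hδ k) (hw k) (hsum k) (E k) hi).2
  have hWb : ∀ i < J, Tendsto (fun k => W k (b i k)) atTop (𝓝 (cumul p (i + 1))) := fun i hi =>
    tendsto_of_tendsto_of_tendsto_of_le_of_le (hcum (i + 1) hi) (hcum' (i + 1) hi)
      (fun k => (winProb_bestCorner hθ (hδ k) (hw k) (hsum k) (E k) hi).1)
      fun k => (winProb_bestCorner hθ (hδ k) (hw k) (hsum k) (E k) hi).2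
  have hcont : ∀ {t : ℝ} {τ : ℝ × ℝ}, τ ∈ M.types → t ∈ scores Φ → 0 ≤ indirectUtility M Φ t τ →
      ContinuousAt (fun t => indirectUtility M Φ t τ) t := fun hτ ht hu =>
    (hasDerivAt_indirectUtility hreg hτ ht hu).continuousAt
  -- The payoff of `θ i` determines the limit score of the next type.
  have step : ∀ i < J, Tendsto (fun k => W k (a i k) * indirectUtility M Φ (a i k) (θ i)) atTop
      (𝓝 (cumul p i * indirectUtility M Φ (s i) (θ i))) →
      Tendsto (a (i + 1)) atTop (𝓝 (s (i + 1))) := by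
    intro i hi hpay
    have hP := cumul_pos hp i
    have hmem := hs.mem i
    have hb : ∀ k, b i k ∈ scores Φ := fun k => (E k).score_mem (bestCorner_mem hθ (hδ k) hi.le)
    have ha : ∀ k, a (i + 1) k ∈ scores Φ := fun k => (E k).score_mem (hθ.mem_types _)
    have h1 : Tendsto (fun k => W k (b i k) * indirectUtility M Φ (b i k) (θ i)) atTop
        (𝓝 (cumul p i * indirectUtility M Φ (s i) (θ i))) := by
      refine tendsto_of_tendsto_of_tendsto_of_le_of_le (g := fun k =>
        W k (a i k) * indirectUtility M Φ (a i k) (θ i) - 2 * δ k) ?_ hpay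
        (fun k => payoff_bestCorner hθ (hδ k) (E k) hi.le)
        fun k => (E k).best_score (hθ.mem_types i) (hb k)
      simpa using hpay.sub (hδ0.const_mul 2)
    have h2 : Tendsto (fun k => indirectUtility M Φ (b i k) (θ i)) atTop
        (𝓝 (indirectUtility M Φ (s (i + 1)) (θ i))) := by
      have h3 := h1.div (hWb i hi) hP.ne'
      rw [← hs.indifferent i, mul_div_cancel_left₀ _ hP.ne'] at h3
      refine h3.congr' ?_
      filter_upwards [(hWb i hi).eventually_const_lt hP] with k hk
      simp only [Pi.div_apply]
      rw [mul_div_cancel_left₀ _ hk.ne']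
    have hbs : Tendsto (b i) atTop (𝓝 (s (i + 1))) :=
      tendsto_score_of_utility hΦ hreg (hθ.mem_types i) hmem
        (hs.utility_nonneg hθ hΦ hreg hp i) hb h2
    have hupos := hs.utility_pos hθ hΦ hreg hp i
    have h4 : Tendsto (fun k => indirectUtility M Φ (b i k) (θ (i + 1))) atTop
        (𝓝 (indirectUtility M Φ (s (i + 1)) (θ (i + 1)))) :=
      (hcont (hθ.mem_types _) hmem hupos.le).tendsto.comp hbs
    have h5 : Tendsto (fun k => W k (b i k) * indirectUtility M Φ (b i k) (θ (i + 1)) /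
        W k (a (i + 1) k)) atTop (𝓝 (indirectUtility M Φ (s (i + 1)) (θ (i + 1)))) := by
      have := ((hWb i hi).mul h4).div (hWa (i + 1) hi) hP.ne'
      rwa [mul_div_cancel_left₀ _ hP.ne'] at this
    refine tendsto_score_of_utility hΦ hreg (hθ.mem_types _) hmem hupos.le ha ?_
    refine tendsto_of_tendsto_of_tendsto_of_le_of_le' h5 h4 ?_ (Eventually.of_forall fun k => ?_)
    · filter_upwards [(hWa (i + 1) hi).eventually_const_lt hP] with k hk
      rw [div_le_iff₀ hk, mul_comm _ (W k _)]
      exact (E k).best_score (hθ.mem_types _) (hb k)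
    · have hbm := bestCorner_mem hθ (hδ k) hi.le
      have hpos := (hδ k).pos
      have hle : b i k ≤ a (i + 1) k := by
        have hp := (E k).pos_of_snd_lt hbm
          (lt_of_le_of_lt (by simp only [bestCorner]; linarith) (hθ.snd_lt_fHi i))
        exact (E k).score_le hbm (hθ.mem_types (i + 1)) ((hδ k).fst_le i hi.le)
          ((hδ k).snd_le i hi.le) hp.1 hp.2
      exact (indirectUtility_strictAnti hΦ hreg _).antitoneOn (hb k) (ha k) hle
  have hpay : ∀ i < J, Tendsto (fun k => W k (a i k) * indirectUtility M Φ (a i k) (θ i)) atTop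
      (𝓝 (cumul p i * indirectUtility M Φ (s i) (θ i))) := by
    intro i
    induction i with
    | zero =>
      intro hi
      rw [cumul_zero, zero_mul]
      obtain ⟨s0, hs0, hu0⟩ := exists_zeroScore hΦ hreg M.worst_mem
      have hW0 := (hWa 0 hi.le).mul_const (indirectUtility M Φ s0 (θ 0))
      rw [cumul_zero, zero_mul] at hW0
      refine tendsto_of_tendsto_of_tendsto_of_le_of_le tendsto_const_nhds hW0
        (fun k => (E k).payoff_nonneg (hθ.mem_types 0)) fun k => ?_
      have hp := (E k).pos_of_snd_lt (hθ.mem_types 0) (hθ.snd_lt_fHi 0)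
      have hak := (E k).score_mem (hθ.mem_types 0)
      refine mul_le_mul_of_nonneg_left ?_ hp.1.le
      refine (indirectUtility_strictAnti hΦ hreg _).antitoneOn hs0 hak ?_
      by_contra! hlt
      have h0 := (E k).winProb_eq_zero hak
        (hu0 ▸ indirectUtility_strictAnti hΦ hreg _ hak hs0 hlt)
      exact hp.1.ne' h0
    | succ i ih =>
      intro hi
      have h1 := step i (by omega) (ih (by omega))
      refine (hWa (i + 1) hi.le).mul ?_
      exact (hcont (hθ.mem_types _) (hs.mem i)
        (hs.utility_pos hθ hΦ hreg hp i).le).tendsto.comp h1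
  exact step i hi (hpay i hi)

end Limit

end

/-! ### Distributions with equal moments -/

section

variable {M : CostModel} {Φ : ℝ × ℝ → ℝ} {θ : ℕ → ℝ × ℝ} {J n : ℕ}

/-- Any `J > n + 1` shrinking squares admit, in the limit, a direction of mass shifts that changes
neither the total mass nor any of the `n` moments on which the bid of the type `θ J` depends. The
top score of the ladder is therefore constant along this direction. -/
theorem exists_invariant_direction (hΦ : IsScoringRule Φ) (hreg : IsRegular M Φ)
    (hθ : IsChain M θ) (hJ : n + 1 < J) {σ : ℝ × ℝ → (ℝ × ℝ → ℝ) → ℝ × ℝ}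
    (heq : ∀ g ∈ densities M, IsEquilibrium M Φ g (fun τ => σ τ g))
    (hmom : IsMomentStrategy M n σ) :
    ∃ α : ℕ → ℝ, (∃ i < J, α i ≠ 0) ∧ (∀ i, J ≤ i → α i = 0) ∧ cumul α J = 0 ∧
      ∀ (p s s' : ℕ → ℝ) (t : ℝ), (∀ i, 0 < p i) → (∀ i, 0 < p i + t * α i) →
        IsBidLadder M Φ θ p s → IsBidLadder M Φ θ (fun i => p i + t * α i) s' → s J = s' J := by
  obtain ⟨ζ, φ, hζ, -, hφ⟩ := hmom (θ J) (hθ.mem_types J)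
  obtain ⟨ε, hε, hsmall⟩ := mem_nhdsGT_iff_exists_Ioo_subset.1 (hθ.eventually_isSmall J)
  have hε' : (0 : ℝ) < ε := hε
  let δ : ℕ → ℝ := fun k => ε / (k + 2)
  have hδ : ∀ k, IsSmall M θ J (δ k) := fun k => by
    refine hsmall ⟨by positivity, div_lt_self hε' ?_⟩
    have : (0 : ℝ) ≤ k := k.cast_nonneg
    linarith
  have hδ0 : Tendsto δ atTop (𝓝 0) :=
    tendsto_const_nhds.div_atTop (tendsto_natCast_atTop_atTop.atTop_add tendsto_const_nhds)
  -- For each side length, a unit vector in the kernel of the moments.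
  have hker : ∀ k, ∃ x : Fin J → ℝ, ‖x‖ = 1 ∧ ∑ i, x i = 0 ∧
      ∀ l, ∑ i : Fin J, x i * moment M (ζ l) (boxDensity (θ i) (δ k)) = 0 := by
    intro k
    let L : (Fin J → ℝ) →ₗ[ℝ] (Fin n → ℝ) × ℝ :=
      { toFun := fun x => (fun l => ∑ i : Fin J, x i * moment M (ζ l) (boxDensity (θ i) (δ k)),
          ∑ i, x i)
        map_add' := fun x y => by
          ext
          · simp [add_mul, Finset.sum_add_distrib]
          · simp [Finset.sum_add_distrib]
        map_smul' := fun c x => by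
          ext
          · simp [Finset.mul_sum, mul_assoc]
          · simp [Finset.mul_sum] }
    have hne : LinearMap.ker L ≠ ⊥ := LinearMap.ker_ne_bot_of_finrank_lt (by simpa using hJ)
    obtain ⟨x, hx, hx0⟩ := Submodule.exists_mem_ne_zero_of_ne_bot hne
    have hnorm : ‖x‖ ≠ 0 := norm_ne_zero_iff.2 hx0
    have hy : L (‖x‖⁻¹ • x) = 0 := by rw [map_smul, LinearMap.mem_ker.1 hx, smul_zero]
    refine ⟨‖x‖⁻¹ • x, ?_, congrArg Prod.snd hy, fun l => congrFun (congrArg Prod.fst hy) l⟩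
    rw [norm_smul, norm_inv, norm_norm, inv_mul_cancel₀ hnorm]
  choose β hβ1 hβs hβm using hker
  obtain ⟨a, ha, ψ, hψ, hlim⟩ := (isCompact_sphere (0 : Fin J → ℝ) 1).tendsto_subseq
    (x := β) fun k => by simp [hβ1 k]
  let ext : (Fin J → ℝ) → ℕ → ℝ := fun x i => if h : i < J then x ⟨i, h⟩ else 0
  have hext : ∀ (x : Fin J → ℝ) (i : Fin J), ext x i = x i := fun x i => by simp [ext]
  have hlim' : ∀ i, Tendsto (fun k => ext (β (ψ k)) i) atTop (𝓝 (ext a i)) := by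
    intro i
    by_cases h : i < J
    · simpa only [ext, h, dif_pos, Function.comp_apply] using (tendsto_pi_nhds.1 hlim) ⟨i, h⟩
    · simp only [ext, h, dif_neg, not_false_eq_true]
      exact tendsto_const_nhds
  have hcumβ : ∀ k, cumul (ext (β k)) J = 0 := fun k => by
    rw [cumul, Finset.sum_range]
    simpa only [hext] using hβs k
  have hcum : cumul (ext a) J = 0 := by
    refine tendsto_nhds_unique
      (tendsto_finsetSum (Finset.range J) fun i _ => hlim' i) ?_
    refine tendsto_const_nhds.congr fun k => ?_
    exact (hcumβ (ψ k)).symm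
  refine ⟨ext a, ?_, fun i hi => by simp [ext, not_lt.2 hi], hcum, ?_⟩
  · by_contra! h
    have : a = 0 := by
      funext i
      rw [← hext a i]
      exact h i i.2
    rw [this] at ha
    simp at ha
  · intro p s s' t hp hp' hs hs'
    obtain ⟨J', rfl⟩ : ∃ J', J = J' + 1 := ⟨J - 1, by omega⟩
    have hP := cumul_pos hp J'
    set P := cumul p (J' + 1) with hPdef
    -- Eventually the shifted weights along the kernel vectors are positive.
    have hev : ∀ᶠ k in atTop, ∀ i ∈ Finset.range (J' + 1), 0 < p i + t * ext (β (ψ k)) i := by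
      rw [Filter.eventually_all_finset]
      intro i _
      exact (tendsto_const_nhds.add ((hlim' i).const_mul t)).eventually_const_lt (hp' i)
    obtain ⟨K, hK⟩ := eventually_atTop.1 hev
    let κ : ℕ → ℕ := fun k => ψ (k + K)
    have hκ : Tendsto κ atTop atTop := hψ.tendsto_atTop.comp (tendsto_add_atTop_nat K)
    have hlimκ : ∀ i, Tendsto (fun k => ext (β (κ k)) i) atTop (𝓝 (ext a i)) := fun i =>
      (hlim' i).comp (tendsto_add_atTop_nat K)
    let w : ℕ → ℝ := fun i => P⁻¹ * p i
    let w' : ℕ → ℕ → ℝ := fun k i => P⁻¹ * (p i + t * ext (β (κ k)) i)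
    have hw : ∀ i < J' + 1, 0 ≤ w i := fun i _ =>
      mul_nonneg (inv_nonneg.2 hP.le) (hp i).le
    have hw' : ∀ k, ∀ i < J' + 1, 0 ≤ w' k i := fun k i hi =>
      mul_nonneg (inv_nonneg.2 hP.le) (hK (k + K) (by omega) i (Finset.mem_range.2 hi)).le
    have hsum : cumul w (J' + 1) = 1 := by
      rw [cumul, ← Finset.mul_sum]
      exact inv_mul_cancel₀ hP.ne'
    have hsum' : ∀ k, cumul (w' k) (J' + 1) = 1 := fun k => by
      have h1 := hcumβ (κ k)
      rw [cumul] at h1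
      rw [cumul, ← Finset.mul_sum, Finset.sum_add_distrib, ← Finset.mul_sum, h1, mul_zero,
        add_zero]
      exact inv_mul_cancel₀ hP.ne'
    have hg : ∀ k, mixture M θ (J' + 1) w (δ (κ k)) ∈ densities M := fun k =>
      mixture_mem_densities hθ (hδ _) hw hsum
    have hg' : ∀ k, mixture M θ (J' + 1) (w' k) (δ (κ k)) ∈ densities M := fun k =>
      mixture_mem_densities hθ (hδ _) (hw' k) (hsum' k)
    have hsame : ∀ k, σ (θ (J' + 1)) (mixture M θ (J' + 1) w (δ (κ k))) =
        σ (θ (J' + 1)) (mixture M θ (J' + 1) (w' k) (δ (κ k))) := by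
      intro k
      rw [(hφ _ (hg k)).2, (hφ _ (hg' k)).2]
      congr 1
      funext l
      obtain ⟨hζm, B, hB⟩ := hζ l
      rw [moment_mixture hζm hB, moment_mixture hζm hB]
      have h1 : ∑ i ∈ Finset.range (J' + 1),
          ext (β (κ k)) i * moment M (ζ l) (boxDensity (θ i) (δ (κ k))) = 0 := by
        rw [Finset.sum_range]
        simpa only [hext] using hβm (κ k) l
      have h2 : ∑ i ∈ Finset.range (J' + 1),
          w' k i * moment M (ζ l) (boxDensity (θ i) (δ (κ k))) =
          ∑ i ∈ Finset.range (J' + 1), w i * moment M (ζ l) (boxDensity (θ i) (δ (κ k))) +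
          P⁻¹ * t * ∑ i ∈ Finset.range (J' + 1),
            ext (β (κ k)) i * moment M (ζ l) (boxDensity (θ i) (δ (κ k))) := by
        rw [Finset.mul_sum, ← Finset.sum_add_distrib]
        exact Finset.sum_congr rfl fun i _ => by simp only [w', w]; ring
      rw [h2, h1, mul_zero, add_zero]
    have hinv : ∀ i, 0 < P⁻¹ * p i := fun i => mul_pos (inv_pos.2 hP) (hp i)
    have hinv' : ∀ i, 0 < P⁻¹ * (p i + t * ext a i) := fun i =>
      mul_pos (inv_pos.2 hP) (hp' i)
    have l1 := tendsto_score_ladder hΦ hreg hθ (w := fun _ => w) (σ := fun k τ =>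
      σ τ (mixture M θ (J' + 1) w (δ (κ k)))) (fun k => hδ (κ k)) (hδ0.comp hκ) (fun _ => hw)
      (fun _ => hsum) (fun i _ => tendsto_const_nhds) hinv (hs.smul P⁻¹)
      (fun k => heq _ (hg k)) (Nat.lt_succ_self J')
    have l2 := tendsto_score_ladder hΦ hreg hθ (w := w') (σ := fun k τ =>
      σ τ (mixture M θ (J' + 1) (w' k) (δ (κ k)))) (fun k => hδ (κ k)) (hδ0.comp hκ) hw'
      hsum' (fun i _ => ((tendsto_const_nhds.add ((hlimκ i).const_mul t)).const_mul P⁻¹)) hinv'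
      (hs'.smul P⁻¹) (fun k => heq _ (hg' k)) (Nat.lt_succ_self J')
    simp only [hsame] at l1
    exact tendsto_nhds_unique l1 l2

end

/-! ### The cross effect of two masses -/

section

variable {M : CostModel} {Φ : ℝ × ℝ → ℝ} {θ : ℕ → ℝ × ℝ} {J n : ℕ}

/-- Implicit differentiation: if `x t` moves so that `(P + t * A) * c (x t)` stays constant, this is
the derivative of `(P + t * A) * a (x t)`. -/
lemma hasDerivAt_mul_of_const {a c x : ℝ → ℝ} {a' c' P A : ℝ} (hP : 0 < P)
    (ha : HasDerivAt a a' (x 0)) (hc : HasDerivAt c c' (x 0)) (hc' : c' ≠ 0)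
    (hx : Tendsto x (𝓝 0) (𝓝 (x 0)))
    (hconst : ∀ᶠ t in 𝓝 0, (P + t * A) * c (x t) = P * c (x 0)) :
    HasDerivAt (fun t => (P + t * A) * a (x t)) (A * (a (x 0) - c (x 0) * (a' / c'))) 0 := by
  have hlin : HasDerivAt (fun t : ℝ => P + t * A) A 0 := by
    simpa using ((hasDerivAt_id (0 : ℝ)).mul_const A).const_add P
  have hPt : ∀ᶠ t in 𝓝 (0 : ℝ), P + t * A ≠ 0 := by
    have h1 : Tendsto (fun t : ℝ => P + t * A) (𝓝 0) (𝓝 P) := by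
      simpa using hlin.continuousAt.tendsto
    filter_upwards [h1.eventually_const_lt hP] with t ht using ht.ne'
  -- The composition `c ∘ x` is explicit.
  have hcx : HasDerivAt (fun t => c (x t)) (-(c (x 0) * A / P)) 0 := by
    have h1 : HasDerivAt (fun t : ℝ => P * c (x 0) / (P + t * A)) (-(c (x 0) * A / P)) 0 := by
      have h2 := (hasDerivAt_const (0 : ℝ) (P * c (x 0))).div hlin (by simpa using hP.ne')
      refine h2.congr_deriv ?_
      have := hP.ne'
      simp only [zero_mul, add_zero, zero_sub]
      field_simp
    refine h1.congr_of_eventuallyEq ?_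
    filter_upwards [hconst, hPt] with t h h'
    rw [eq_div_iff h', ← h, mul_comm]
  have hds : Tendsto (fun t => dslope c (x 0) (x t)) (𝓝[≠] 0) (𝓝 c') := by
    have h1 := (continuousAt_dslope_same.2 hc.differentiableAt).tendsto
    rw [dslope_same, hc.deriv] at h1
    exact (h1.comp hx).mono_left nhdsWithin_le_nhds
  have hxd : HasDerivAt x (-(c (x 0) * A / P) / c') 0 := by
    rw [hasDerivAt_iff_tendsto_slope]
    refine (((hasDerivAt_iff_tendsto_slope.1 hcx).div hds hc')).congr' ?_
    filter_upwards [hds.eventually_ne hc', self_mem_nhdsWithin] with t ht ht0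
    have ht0' : t ≠ 0 := ht0
    have h1 : (x t - x 0) * dslope c (x 0) (x t) = c (x t) - c (x 0) := by
      simpa [smul_eq_mul] using sub_smul_dslope c (x 0) (x t)
    simp only [Pi.div_apply, slope_def_field]
    rw [← h1]
    field_simp
  have h1 := hlin.mul (ha.comp (0 : ℝ) hxd)
  refine h1.congr_deriv ?_
  have := hP.ne'
  simp only [Function.comp, zero_mul, add_zero]
  field_simp
  ring

/-- The marginal effect, on the payoff of the type `τ`, of a mass shift below the bid `x` that
leaves the payoff of the better type `τ'` unchanged. -/
noncomputable def crossEffect (M : CostModel) (Φ : ℝ × ℝ → ℝ) (τ τ' : ℝ × ℝ) (x : ℝ) : ℝ :=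
  indirectUtility M Φ x τ - indirectUtility M Φ x τ' *
    (indirectUtilityDeriv M Φ x τ / indirectUtilityDeriv M Φ x τ')

/-- The mass of the type `θ i` can be chosen so that its top bid is any given score. -/
lemma exists_ladder_through (hθ : IsChain M θ) (hΦ : IsScoringRule Φ) (hreg : IsRegular M Φ)
    {p s : ℕ → ℝ} (hp : ∀ i, 0 < p i) (hs : IsBidLadder M Φ θ p s) {i : ℕ} {z : ℝ}
    (hz : z ∈ scores Φ) (hlt : s (i + 1) < z) (hu : 0 < indirectUtility M Φ z (θ (i + 1))) :
    ∃ p' s', (∀ l, 0 < p' l) ∧ (∀ l < i + 1, p' l = p l) ∧ IsBidLadder M Φ θ p' s' ∧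
      s' (i + 1 + 1) = z := by
  have hanti := indirectUtility_strictAnti hΦ hreg (M := M) (θ (i + 1))
  have hlt' := hanti (hs.mem i) hz hlt
  have hP := cumul_pos hp i
  simp only at hlt'
  set v := cumul p (i + 1) * indirectUtility M Φ (s (i + 1)) (θ (i + 1)) /
    indirectUtility M Φ z (θ (i + 1)) with hv
  have hvP : cumul p (i + 1) < v := by
    rw [hv, lt_div_iff₀ hu]
    exact mul_lt_mul_of_pos_left hlt' hP
  let p' := Function.update p (i + 1) (v - cumul p (i + 1))
  have hp' : ∀ l, 0 < p' l := by
    intro l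
    by_cases h : l = i + 1
    · subst h; simpa [p'] using hvP
    · simpa [p', Function.update_of_ne h] using hp l
  have hpp : ∀ l < i + 1, p' l = p l := fun l hl => Function.update_of_ne hl.ne _ _
  obtain ⟨s', hs'⟩ := exists_isBidLadder hθ hΦ hreg hp'
  refine ⟨p', s', hp', hpp, hs', ?_⟩
  have hcum : cumul p' (i + 1) = cumul p (i + 1) :=
    Finset.sum_congr rfl fun l hl => hpp l (Finset.mem_range.1 hl)
  have h1 := hs'.indifferent (i + 1)
  rw [cumul_succ, hcum, hs'.congr hs hΦ hreg hp' hpp i (Nat.lt_succ_self i)] at h1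
  have h2 : p' (i + 1) = v - cumul p (i + 1) := Function.update_self _ _ _
  rw [h2, add_sub_cancel] at h1
  refine hanti.injOn (hs'.mem _) hz ?_
  have hv0 : v ≠ 0 := (hP.trans hvP).ne'
  refine mul_left_cancel₀ hv0 ?_
  rw [h1, hv, div_mul_cancel₀ _ hu.ne']

/-- Masses can be chosen so that the first bids stay below any score that the worst type of the
chain cannot afford. -/
lemma exists_ladder_below (hθ : IsChain M θ) (hΦ : IsScoringRule Φ) (hreg : IsRegular M Φ)
    {x : ℝ} (hx : x ∈ scores Φ) (h0 : indirectUtility M Φ x (θ 0) < 0)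
    (h1 : 0 < indirectUtility M Φ x (θ 1)) (i : ℕ) :
    ∃ p s, (∀ l, 0 < p l) ∧ IsBidLadder M Φ θ p s ∧ s (i + 1) < x := by
  have hpos : ∀ i, 0 < indirectUtility M Φ x (θ (i + 1)) := by
    intro i
    induction i with
    | zero => exact h1
    | succ i ih => exact ih.trans (hθ.utility_lt_succ hΦ hreg hx _)
  induction i with
  | zero =>
    obtain ⟨s, hs⟩ := exists_isBidLadder hθ hΦ hreg (p := fun _ => 1) fun _ => one_pos
    refine ⟨_, s, fun _ => one_pos, hs, ?_⟩
    have h2 := hs.utility_nonneg hθ hΦ hreg (fun _ => one_pos) 0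
    by_contra! hcon
    have := (indirectUtility_strictAnti hΦ hreg (θ 0)).antitoneOn hx (hs.mem 0) hcon
    linarith
  | succ i ih =>
    obtain ⟨p, s, hp, hs, hlt⟩ := ih
    obtain ⟨z, hz1, hz2⟩ := exists_between hlt
    have hz := (ordConnected_scores hΦ).out (hs.mem i) hx ⟨hz1.le, hz2.le⟩
    have hzu := (hpos i).trans (indirectUtility_strictAnti hΦ hreg (θ (i + 1)) hz hx hz2)
    obtain ⟨p', s', hp', -, hs', hsz⟩ := exists_ladder_through hθ hΦ hreg hp hs hz hz1 hzu
    exact ⟨p', s', hp', hs', hsz ▸ hz2⟩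

lemma cumul_add_mul (p α : ℕ → ℝ) (t : ℝ) (i : ℕ) :
    cumul (fun l => p l + t * α l) i = cumul p i + t * cumul α i := by
  simp [cumul, Finset.sum_add_distrib, Finset.mul_sum]

lemma eventually_shift_pos {p α : ℕ → ℝ} (hp : ∀ i, 0 < p i) (hα : ∀ i, J ≤ i → α i = 0) :
    ∀ᶠ t in 𝓝 (0 : ℝ), ∀ i, 0 < p i + t * α i := by
  have h : ∀ᶠ t in 𝓝 (0 : ℝ), ∀ i ∈ Finset.range J, 0 < p i + t * α i := by
    rw [Filter.eventually_all_finset]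
    intro i _
    have : Tendsto (fun t : ℝ => p i + t * α i) (𝓝 0) (𝓝 (p i)) :=
      Continuous.tendsto' (by fun_prop) _ _ (by simp)
    exact this.eventually_const_lt (hp i)
  filter_upwards [h] with t ht i
  by_cases hi : i < J
  · exact ht i (Finset.mem_range.2 hi)
  · rw [hα i (not_lt.1 hi), mul_zero, add_zero]
    exact hp i

/-- Along an invariant direction of mass shifts, consider the best type whose bid is affected. The
bid of the next type pins down how its own bid moves, and the implied change in its payoff depends
on worse types only. Hence the cross effect takes the same value at all feasible bids. -/
theorem crossEffect_eq (hθ : IsChain M θ) (hΦ : IsScoringRule Φ) (hreg : IsRegular M Φ)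
    {α : ℕ → ℝ} (hα : ∃ i < J, α i ≠ 0) (hαJ : ∀ i, J ≤ i → α i = 0) (hsum : cumul α J = 0)
    (hinv : ∀ (p s s' : ℕ → ℝ) (t : ℝ), (∀ i, 0 < p i) → (∀ i, 0 < p i + t * α i) →
      IsBidLadder M Φ θ p s → IsBidLadder M Φ θ (fun i => p i + t * α i) s' → s J = s' J)
    {x y : ℝ} (hx : x ∈ scores Φ) (hy : y ∈ scores Φ) (hxy : x < y)
    (hx0 : indirectUtility M Φ x (θ 0) < 0) (hy1 : 0 < indirectUtility M Φ y (θ 1)) :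
    ∃ i, crossEffect M Φ (θ (i + 1)) (θ (i + 2)) x = crossEffect M Φ (θ (i + 1)) (θ (i + 2)) y := by
  have hanti := fun τ => indirectUtility_strictAnti hΦ hreg (M := M) τ
  -- The last partial sum of the direction that does not vanish.
  obtain ⟨i, hiJ, hAi, hlast⟩ : ∃ i, i + 1 < J ∧ cumul α (i + 1) ≠ 0 ∧
      ∀ l, i < l → l < J → cumul α (l + 1) = 0 := by
    classical
    let S := (Finset.range J).filter fun i => cumul α (i + 1) ≠ 0
    have hS : S.Nonempty := by
      by_contra hemp
      rw [Finset.not_nonempty_iff_eq_empty, Finset.filter_eq_empty_iff] at hemp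
      obtain ⟨i, hi, hne⟩ := hα
      have h1 := not_not.1 (hemp (Finset.mem_range.2 hi))
      have h2 : cumul α i = 0 := by
        rcases Nat.eq_zero_or_pos i with rfl | hpos
        · exact cumul_zero α
        · obtain ⟨i', rfl⟩ : ∃ i', i = i' + 1 := ⟨i - 1, by omega⟩
          exact not_not.1 (hemp (Finset.mem_range.2 (by omega)))
      rw [cumul_succ, h2, zero_add] at h1
      exact hne h1
    have hmem := Finset.mem_filter.1 (S.max'_mem hS)
    have hmemJ := Finset.mem_range.1 hmem.1
    refine ⟨S.max' hS, ?_, hmem.2, fun l hl hlJ => ?_⟩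
    · refine lt_of_le_of_ne hmemJ fun h => hmem.2 ?_
      have : S.max' hS + 1 = J := h
      rw [this, hsum]
    · by_contra hne
      have := S.le_max' l (Finset.mem_filter.2 ⟨Finset.mem_range.2 hlJ, hne⟩)
      omega
  -- Bids above are unaffected, so the payoff of the next better type is constant.
  have hconst : ∀ (p s s' : ℕ → ℝ) (t : ℝ), (∀ i, 0 < p i) → (∀ i, 0 < p i + t * α i) →
      IsBidLadder M Φ θ p s → IsBidLadder M Φ θ (fun i => p i + t * α i) s' →
      (cumul p (i + 1) + t * cumul α (i + 1)) * indirectUtility M Φ (s' (i + 1)) (θ (i + 1)) =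
        cumul p (i + 1) * indirectUtility M Φ (s (i + 1)) (θ (i + 1)) := by
    intro p s s' t hp hp' hs hs'
    have hdown : ∀ d l, l + d + 1 = J → i + 1 ≤ l → s' (l + 1) = s (l + 1) := by
      intro d
      induction d with
      | zero =>
        intro l hl _
        have := hinv p s s' t hp hp' hs hs'
        rw [← hl] at this
        exact this.symm
      | succ d ih =>
        intro l hl hil
        have h1 := ih (l + 1) (by omega) (by omega)
        have h2 := hs.indifferent (l + 1)
        have h3 := hs'.indifferent (l + 1)
        rw [cumul_add_mul, cumul_add_mul, hlast (l + 1) (by omega) (by omega),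
          hlast l (by omega) (by omega), mul_zero, add_zero, add_zero, h1, h2] at h3
        exact (hanti (θ (l + 1))).injOn (hs'.mem l) (hs.mem l)
          (mul_left_cancel₀ (cumul_pos hp l).ne' h3.symm)
    have h1 := hdown (J - i - 2) (i + 1) (by omega) le_rfl
    have h2 := hs.indifferent (i + 1)
    have h3 := hs'.indifferent (i + 1)
    rw [cumul_add_mul, cumul_add_mul, hlast (i + 1) (by omega) (by omega), mul_zero, add_zero,
      h1, h2] at h3
    exact h3.symm
  -- The worst type of the chain always bids its zero-profit score, so it is not the affected one.
  obtain ⟨i, rfl⟩ : ∃ i', i = i' + 1 := by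
    refine ⟨i - 1, ?_⟩
    by_contra hne
    have hi0 : i = 0 := by omega
    subst hi0
    have hp : ∀ i : ℕ, 0 < (fun _ => 1 : ℕ → ℝ) i := fun _ => one_pos
    obtain ⟨t, ht, ht0⟩ : ∃ t : ℝ, (∀ i : ℕ, 0 < (1 : ℝ) + t * α i) ∧ t ≠ 0 :=
      (Filter.Eventually.and (nhdsWithin_le_nhds (eventually_shift_pos hp hαJ))
        (eventually_mem_nhdsWithin (a := (0 : ℝ)) (s := {0}ᶜ))).exists
    obtain ⟨s, hs⟩ := exists_isBidLadder hθ hΦ hreg hp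
    obtain ⟨s', hs'⟩ := exists_isBidLadder hθ hΦ hreg ht
    have h1 := hconst _ s s' t hp ht hs hs'
    have h2 := hs.indifferent 0
    have h3 := hs'.indifferent 0
    rw [cumul_zero, zero_mul] at h2 h3
    have h2' := (mul_eq_zero.1 h2).resolve_left (cumul_pos hp 0).ne'
    have h3' := (mul_eq_zero.1 h3).resolve_left (cumul_pos ht 0).ne'
    have h4 : s' 1 = s 1 := (hanti (θ 0)).injOn (hs'.mem 0) (hs.mem 0) (h3'.trans h2'.symm)
    have hpos := hs.utility_pos hθ hΦ hreg hp 0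
    rw [zero_add] at h1 hpos hAi
    rw [h4] at h1
    have h5 := mul_right_cancel₀ hpos.ne' h1
    have h6 : t * cumul α 1 = 0 := by linarith
    exact (mul_ne_zero ht0 hAi) h6
  refine ⟨i, ?_⟩
  have hux : 0 < indirectUtility M Φ x (θ 1) := hy1.trans (hanti _ hx hy hxy)
  have hpos : ∀ i, 0 < indirectUtility M Φ y (θ (i + 1)) := by
    intro i
    induction i with
    | zero => exact hy1
    | succ i ih => exact ih.trans (hθ.utility_lt_succ hΦ hreg hy _)
  have hposx : ∀ i, 0 < indirectUtility M Φ x (θ (i + 1)) := fun i =>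
    (hpos i).trans (hanti _ hx hy hxy)
  obtain ⟨p, s, hp, hs, hsx⟩ := exists_ladder_below hθ hΦ hreg hx hx0 hux i
  -- For each bid `z` of the affected type, the payoff of that type as a function of the shift.
  have main : ∀ z ∈ scores Φ, s (i + 1) < z → 0 < indirectUtility M Φ z (θ (i + 1)) →
      ∀ F : ℝ → ℝ, (∀ t s', (∀ l, 0 < p l + t * α l) →
        IsBidLadder M Φ θ (fun l => p l + t * α l) s' →
        F t = (cumul p (i + 1) + t * cumul α (i + 1)) *
          indirectUtility M Φ (s' (i + 1)) (θ (i + 1))) →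
      HasDerivAt F (cumul α (i + 1 + 1) * crossEffect M Φ (θ (i + 1)) (θ (i + 2)) z) 0 := by
    intro z hz hsz hzu F hF
    obtain ⟨q, r, hq, hqp, hr, hrz⟩ := exists_ladder_through hθ hΦ hreg hp hs hz hsz hzu
    have hev := eventually_shift_pos hq hαJ
    have hevp := eventually_shift_pos hp hαJ
    have hex : ∀ t, ∃ s', (∀ l, 0 < q l + t * α l) →
        IsBidLadder M Φ θ (fun l => q l + t * α l) s' := by
      intro t
      by_cases ht : ∀ l, 0 < q l + t * α l
      · obtain ⟨s', hs'⟩ := exists_isBidLadder hθ hΦ hreg ht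
        exact ⟨s', fun _ => hs'⟩
      · exact ⟨s, fun h => absurd h ht⟩
    choose S hS using hex
    have hx0' : S 0 (i + 1 + 1) = z := by
      have h0 := hS 0 (by simpa using hq)
      rw [← hrz]
      exact h0.congr hr hΦ hreg (by simpa using hq) (j := i + 2) (fun l _ => by simp) (i + 1)
        (by omega)
    have hz2 : 0 < indirectUtility M Φ z (θ (i + 2)) := hzu.trans (hθ.utility_lt_succ hΦ hreg hz _)
    have hC : ∀ᶠ t in 𝓝 (0 : ℝ), (cumul q (i + 1 + 1) + t * cumul α (i + 1 + 1)) *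
        indirectUtility M Φ (S t (i + 1 + 1)) (θ (i + 2)) =
        cumul q (i + 1 + 1) * indirectUtility M Φ (S 0 (i + 1 + 1)) (θ (i + 2)) := by
      filter_upwards [hev] with t ht
      have := hconst q r (S t) t hq ht hr (hS t ht)
      rw [hx0', ← hrz]
      exact this
    have hP := cumul_pos hq (i + 1)
    have hev' : ∀ᶠ t in 𝓝 (0 : ℝ), S t (i + 1 + 1) ∈ scores Φ := by
      filter_upwards [hev] with t ht using (hS t ht).mem (i + 1)
    have hcontS : Tendsto (fun t => S t (i + 1 + 1)) (𝓝 0) (𝓝 z) := by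
      classical
      -- Replacing junk values by `z` makes the score lemma applicable.
      have h1 : Tendsto (fun t => if S t (i + 1 + 1) ∈ scores Φ then S t (i + 1 + 1) else z)
          (𝓝 0) (𝓝 z) := by
        refine tendsto_score_of_utility hΦ hreg (hθ.mem_types (i + 2)) hz hz2.le
          (fun t => by split_ifs with h <;> assumption) ?_
        have h2 : Tendsto (fun t : ℝ => cumul q (i + 1 + 1) *
            indirectUtility M Φ z (θ (i + 2)) / (cumul q (i + 1 + 1) + t * cumul α (i + 1 + 1)))
            (𝓝 0) (𝓝 (indirectUtility M Φ z (θ (i + 2)))) := by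
          have h3 : Tendsto (fun t : ℝ => cumul q (i + 1 + 1) + t * cumul α (i + 1 + 1)) (𝓝 0)
              (𝓝 (cumul q (i + 1 + 1))) := Continuous.tendsto' (by fun_prop) _ _ (by simp)
          have h4 := (tendsto_const_nhds (x := cumul q (i + 1 + 1) *
            indirectUtility M Φ z (θ (i + 2)))).div h3 hP.ne'
          rwa [mul_div_cancel_left₀ _ hP.ne'] at h4
        refine h2.congr' ?_
        filter_upwards [hC, hev', hev] with t h h' ht
        rw [if_pos h', div_eq_iff, mul_comm (indirectUtility _ _ _ _), h, hx0']
        have := cumul_pos ht (i + 1)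
        rw [cumul_add_mul] at this
        exact this.ne'
      refine h1.congr' ?_
      filter_upwards [hev'] with t ht
      rw [if_pos ht]
    have hd := hasDerivAt_mul_of_const (x := fun t => S t (i + 1 + 1)) hP
      (a := fun t => indirectUtility M Φ t (θ (i + 1)))
      (c := fun t => indirectUtility M Φ t (θ (i + 2)))
      (a' := indirectUtilityDeriv M Φ z (θ (i + 1)))
      (c' := indirectUtilityDeriv M Φ z (θ (i + 2)))
      (by simp only [hx0']; exact hasDerivAt_indirectUtility hreg (hθ.mem_types _) hz hzu.le)
      (by simp only [hx0']; exact hasDerivAt_indirectUtility hreg (hθ.mem_types _) hz hz2.le)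
      (indirectUtilityDeriv_neg hΦ hreg (hθ.mem_types _) hz hz2.le).ne
      (by simpa only [hx0'] using hcontS) hC
    simp only [hx0'] at hd
    refine hd.congr_of_eventuallyEq ?_
    filter_upwards [hev, hevp] with t ht htp
    obtain ⟨s', hs'⟩ := exists_isBidLadder hθ hΦ hreg htp
    have hc : cumul q (i + 1) = cumul p (i + 1) :=
      Finset.sum_congr rfl fun l hl => hqp l (Finset.mem_range.1 hl)
    have h1 := (hS t ht).indifferent (i + 1)
    rw [cumul_add_mul, cumul_add_mul, hc, (hS t ht).congr hs' hΦ hreg ht (j := i + 1)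
      (fun l hl => by rw [hqp l hl]) i (by omega)] at h1
    rw [hF t s' htp hs']
    exact h1.symm
  have hex : ∀ t, ∃ v, ∀ s', (∀ l, 0 < p l + t * α l) →
      IsBidLadder M Φ θ (fun l => p l + t * α l) s' →
      v = (cumul p (i + 1) + t * cumul α (i + 1)) *
        indirectUtility M Φ (s' (i + 1)) (θ (i + 1)) := by
    intro t
    by_cases ht : ∀ l, 0 < p l + t * α l
    · obtain ⟨s₁, hs₁⟩ := exists_isBidLadder hθ hΦ hreg ht
      refine ⟨(cumul p (i + 1) + t * cumul α (i + 1)) *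
        indirectUtility M Φ (s₁ (i + 1)) (θ (i + 1)), fun s' _ hs' => ?_⟩
      rw [hs'.congr hs₁ hΦ hreg ht (j := i + 1) (fun _ _ => rfl) i (by omega)]
    · exact ⟨0, fun _ h => absurd h ht⟩
  choose F hF using hex
  have e1 := main x hx hsx (hposx i) F hF
  have e2 := main y hy (hsx.trans hxy) (hpos i) F hF
  exact mul_left_cancel₀ hAi (e1.unique e2)

end

/-! ### Separability of the payoffs -/

section

variable {M : CostModel} {Φ : ℝ × ℝ → ℝ} {n : ℕ}

lemma exists_intermediate_ne {ρ : ℝ → ℝ} {a b : ℝ} (hab : a < b) (hr : ContinuousOn ρ (Icc a b))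
    (hne : ρ b ≠ ρ a) : ∃ c ∈ Ioo a b, ρ c ≠ ρ a ∧ ρ c ≠ ρ b := by
  rcases hne.lt_or_gt with h | h
  · obtain ⟨v, h1, h2⟩ := exists_between h
    obtain ⟨c, hc, rfl⟩ := intermediate_value_Ioo' hab.le hr ⟨h1, h2⟩
    exact ⟨c, hc, h2.ne, h1.ne'⟩
  · obtain ⟨v, h1, h2⟩ := exists_between h
    obtain ⟨c, hc, rfl⟩ := intermediate_value_Ioo hab.le hr ⟨h1, h2⟩
    exact ⟨c, hc, h1.ne', h2.ne⟩

/-- If the relative marginal rates of two marginal costs differ between the scores `x` and `y`, then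
some fixed cost of the better type yields different cross effects at `x` and `y`: the two effects
are affine in it, with different slopes. -/
lemma exists_crossEffect_ne (hΦ : IsScoringRule Φ) (hreg : IsRegular M Φ) {x y : ℝ}
    (hx : x ∈ scores Φ) (hy : y ∈ scores Φ) (hnx : scores Φ ∈ 𝓝 x) (hny : scores Φ ∈ 𝓝 y)
    {μ μ' f : ℝ} (hf : M.fLo < f)
    (hq : indirectUtilityDeriv M Φ x (μ, M.fLo) / indirectUtilityDeriv M Φ x (μ', M.fLo) ≠
      indirectUtilityDeriv M Φ y (μ, M.fLo) / indirectUtilityDeriv M Φ y (μ', M.fLo)) :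
    ∃ f', M.fLo < f' ∧ f' < f ∧
      crossEffect M Φ (μ, f) (μ', f') x ≠ crossEffect M Φ (μ, f) (μ', f') y := by
  by_contra! hall
  obtain ⟨f1, h1, h1'⟩ := exists_between hf
  obtain ⟨f2, h2, h2'⟩ := exists_between h1
  have e1 := hall f1 h1 h1'
  have e2 := hall f2 h2 (h2'.trans h1')
  simp only [crossEffect, indirectUtilityDeriv_fst hΦ hreg hnx _ _ M.fLo,
    indirectUtilityDeriv_fst hΦ hreg hny _ _ M.fLo, indirectUtility_sub hΦ hreg hx μ' f1,
    indirectUtility_sub hΦ hreg hx μ' f2, indirectUtility_sub hΦ hreg hy μ' f1,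
    indirectUtility_sub hΦ hreg hy μ' f2] at e1 e2
  refine hq (mul_left_cancel₀ (sub_ne_zero.2 h2'.ne') ?_)
  linarith

/-- In an auction implementable in finitely many moments, the relative marginal rates of two
marginal costs do not depend on the score: otherwise there would be arbitrarily long chains of
types whose consecutive cross effects all vary with the bid. -/
theorem marginal_ratio_eq (hΦ : IsScoringRule Φ) (hreg : IsRegular M Φ) (himp : Implementable M Φ n)
    {x y m : ℝ} (hx : x ∈ scores Φ) (hy : y ∈ scores Φ) (hxy : x < y)
    (hxw : indirectUtility M Φ x M.worst < 0) (hm : M.mLo < m) (hm' : m ≤ M.mHi)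
    (hu : 0 < indirectUtility M Φ y (m, M.fLo)) :
    indirectUtilityDeriv M Φ y (m, M.fLo) / indirectUtilityDeriv M Φ x (m, M.fLo) =
      indirectUtilityDeriv M Φ y (M.mLo, M.fLo) / indirectUtilityDeriv M Φ x (M.mLo, M.fLo) := by
  obtain ⟨σ, heq, hmom⟩ := himp
  have hmemT : ∀ μ ∈ Icc M.mLo m, (μ, M.fLo) ∈ M.types := fun μ hμ =>
    ⟨⟨hμ.1, hμ.2.trans hm'⟩, le_rfl, M.fLo_lt_fHi.le⟩
  have huy : ∀ μ ∈ Icc M.mLo m, indirectUtility M Φ y (m, M.fLo) ≤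
      indirectUtility M Φ y (μ, M.fLo) := fun μ hμ =>
    indirectUtility_le_of_worse hΦ hreg hy hμ.2 le_rfl
  have hux : ∀ τ, indirectUtility M Φ y τ < indirectUtility M Φ x τ := fun τ =>
    indirectUtility_strictAnti hΦ hreg τ hx hy hxy
  have hy0 : ∀ μ ∈ Icc M.mLo m, 0 < indirectUtility M Φ y (μ, M.fLo) := fun μ hμ =>
    hu.trans_le (huy μ hμ)
  have hx0 : ∀ μ ∈ Icc M.mLo m, 0 < indirectUtility M Φ x (μ, M.fLo) := fun μ hμ =>
    (hy0 μ hμ).trans (hux _)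
  have hDy : ∀ μ ∈ Icc M.mLo m, indirectUtilityDeriv M Φ y (μ, M.fLo) ≠ 0 := fun μ hμ =>
    (indirectUtilityDeriv_neg hΦ hreg (hmemT μ hμ) hy (hy0 μ hμ).le).ne
  have hDx : ∀ μ ∈ Icc M.mLo m, indirectUtilityDeriv M Φ x (μ, M.fLo) ≠ 0 := fun μ hμ =>
    (indirectUtilityDeriv_neg hΦ hreg (hmemT μ hμ) hx (hx0 μ hμ).le).ne
  have hmm : m ∈ Icc M.mLo m := right_mem_Icc.2 hm.le
  have hny := scores_mem_nhds hΦ hreg (hmemT m hmm) hy hu.le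
  have hnx := scores_mem_nhds hΦ hreg (hmemT m hmm) hx (hx0 m hmm).le
  set ρ : ℝ → ℝ := fun μ =>
    indirectUtilityDeriv M Φ y (μ, M.fLo) / indirectUtilityDeriv M Φ x (μ, M.fLo) with hr
  have hcont : ContinuousOn ρ (Icc M.mLo m) := by
    have hsub : ∀ t ∈ scores Φ, 0 < indirectUtility M Φ t (m, M.fLo) →
        M.fLo < indirectUtility M Φ t (m, 0) := fun t ht h => by
      rw [indirectUtility_sub hΦ hreg ht] at h
      linarith
    exact (continuousOn_indirectUtilityDeriv hΦ hreg hy le_rfl hm' (hsub y hy hu)).div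
      (continuousOn_indirectUtilityDeriv hΦ hreg hx le_rfl hm' (hsub x hx (hx0 m hmm))) hDx
  by_contra hne
  have hne' : ρ m ≠ ρ M.mLo := hne
  have hM := hu
  rw [indirectUtility_sub hΦ hreg hy] at hM
  set c := min (indirectUtility M Φ y (m, 0)) M.fHi with hc
  have hcf : M.fLo < c := lt_min (by linarith) M.fLo_lt_fHi
  -- Admissible states of the chain.
  let good : ℝ × ℝ → Prop := fun τ =>
    τ.1 ∈ Ioo M.mLo m ∧ ρ τ.1 ≠ ρ M.mLo ∧ M.fLo < τ.2 ∧ τ.2 < c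
  have step : ∀ τ : ℝ × ℝ, good τ → ∃ τ' : ℝ × ℝ, good τ' ∧ (τ'.1 < τ.1 ∧ τ'.2 < τ.2) ∧
      crossEffect M Φ τ τ' x ≠ crossEffect M Φ τ τ' y := by
    rintro ⟨μ, f⟩ ⟨hμ, hrμ, hf, hfc⟩
    obtain ⟨μ', hμ', h1, h2⟩ := exists_intermediate_ne hμ.1
      (hcont.mono (Icc_subset_Icc_right hμ.2.le)) hrμ
    have hμI : μ ∈ Icc M.mLo m := Ioo_subset_Icc_self hμ
    have hμI' : μ' ∈ Icc M.mLo m := ⟨hμ'.1.le, hμ'.2.le.trans hμ.2.le⟩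
    have hq : indirectUtilityDeriv M Φ x (μ, M.fLo) / indirectUtilityDeriv M Φ x (μ', M.fLo) ≠
        indirectUtilityDeriv M Φ y (μ, M.fLo) / indirectUtilityDeriv M Φ y (μ', M.fLo) := by
      intro h
      refine h2 ?_
      simp only [hr]
      rw [div_eq_div_iff (hDx _ hμI') (hDy _ hμI')] at h
      rw [div_eq_div_iff (hDx _ hμI') (hDx _ hμI)]
      linarith
    obtain ⟨f', hf', hff, hcr⟩ := exists_crossEffect_ne hΦ hreg hx hy hnx hny (f := f) hf hq
    exact ⟨(μ', f'), ⟨⟨hμ'.1, hμ'.2.trans hμ.2⟩, h1, hf', hff.trans hfc⟩, ⟨hμ'.2, hff⟩, hcr⟩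
  obtain ⟨μ₁, hμ₁, hr₁, -⟩ := exists_intermediate_ne hm hcont hne'
  obtain ⟨f₁, hf₁, hf₁c⟩ := exists_between hcf
  choose! next hn1 hn2 hn3 using step
  let τ : ℕ → ℝ × ℝ := fun i => Nat.rec (μ₁, f₁) (fun _ τ => next τ) i
  have hτs : ∀ i, τ (i + 1) = next (τ i) := fun _ => rfl
  have hgood : ∀ i, good (τ i) := by
    intro i
    induction i with
    | zero => exact ⟨hμ₁, hr₁, hf₁, hf₁c⟩
    | succ i ih => rw [hτs]; exact hn1 _ ih
  -- A base type that cannot afford the score `x`.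
  obtain ⟨fb, ⟨hfb1, hfb2⟩, hfbu⟩ : ∃ fb, (f₁ < fb ∧ fb < M.fHi) ∧
      indirectUtility M Φ x (M.mHi, fb) < 0 := by
    have h1 : Tendsto (fun f => indirectUtility M Φ x (M.mHi, f)) (𝓝[<] M.fHi)
        (𝓝 (indirectUtility M Φ x M.worst)) :=
      (((continuous_indirectUtility hΦ hreg hx).comp (Continuous.prodMk_right M.mHi)).tendsto
        M.fHi).mono_left nhdsWithin_le_nhds
    have h2 : f₁ < M.fHi := hf₁c.trans_le (min_le_right _ _)
    exact ((Filter.Eventually.and (Ioo_mem_nhdsLT h2) (h1.eventually_lt_const hxw))).exists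
  let θ : ℕ → ℝ × ℝ := fun i => Nat.casesOn i (M.mHi, fb) fun i => τ i
  have hθs : ∀ i, θ (i + 1) = τ i := fun _ => rfl
  have hchain : IsChain M θ := by
    refine ⟨fun i => ?_, fun i => ?_, fun i => ?_, fun i => ?_, fun i => ?_, fun i => ?_⟩
    · cases i with
      | zero => exact hμ₁.2.trans_le hm'
      | succ i => exact (hn2 _ (hgood i)).1
    · cases i with
      | zero => exact hfb1
      | succ i => exact (hn2 _ (hgood i)).2
    · cases i with
      | zero => exact M.mLo_lt_mHi
      | succ i => rw [hθs]; exact (hgood i).1.1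
    · cases i with
      | zero => exact hf₁.trans hfb1
      | succ i => rw [hθs]; exact (hgood i).2.2.1
    · cases i with
      | zero => exact le_rfl
      | succ i => rw [hθs]; exact (hgood i).1.2.le.trans hm'
    · cases i with
      | zero => exact hfb2
      | succ i => rw [hθs]; exact (hgood i).2.2.2.trans_le (min_le_right _ _)
  obtain ⟨α, hα, hαJ, hsum, hinv⟩ := exists_invariant_direction hΦ hreg hchain
    (J := n + 2) (by omega) heq hmom
  have hy1 : 0 < indirectUtility M Φ y (θ 1) := by
    have h1 : indirectUtility M Φ y (m, 0) ≤ indirectUtility M Φ y (μ₁, 0) :=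
      indirectUtility_le_of_worse hΦ hreg hy hμ₁.2.le le_rfl
    have h2 : f₁ < indirectUtility M Φ y (m, 0) := hf₁c.trans_le (min_le_left _ _)
    change 0 < indirectUtility M Φ y (μ₁, f₁)
    rw [indirectUtility_sub hΦ hreg hy]
    linarith
  obtain ⟨i, hi⟩ := crossEffect_eq hchain hΦ hreg hα hαJ hsum hinv hx hy hxy hfbu hy1
  exact hn3 _ (hgood i) hi

/-- After a change of variable, the score enters the indirect utility additively: for scores
between the zero-profit score `s₀` of the least efficient type and the zero-profit score of the
type, the drop of the indirect utility since `s₀` is a factor that depends on the marginal cost only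
times a function of the score. The score `s₁` serves to normalize the two factors. -/
structure IsSeparable (M : CostModel) (Φ : ℝ × ℝ → ℝ) (s₀ s₁ : ℝ) : Prop where
  mem₀ : s₀ ∈ scores Φ
  mem₁ : s₁ ∈ scores Φ
  zero : indirectUtility M Φ s₀ M.worst = 0
  lt : s₀ < s₁
  separable : ∀ m ∈ Icc M.mLo M.mHi, ∀ s ∈ scores Φ, s₀ ≤ s →
    0 ≤ indirectUtility M Φ s (m, M.fLo) →
    (indirectUtility M Φ s₀ (m, M.fLo) - indirectUtility M Φ s (m, M.fLo)) *
      (indirectUtility M Φ s₀ (M.mLo, M.fLo) - indirectUtility M Φ s₁ (M.mLo, M.fLo)) =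
    (indirectUtility M Φ s₀ (m, M.fLo) - indirectUtility M Φ s₁ (m, M.fLo)) *
      (indirectUtility M Φ s₀ (M.mLo, M.fLo) - indirectUtility M Φ s (M.mLo, M.fLo))

theorem isSeparable_of_implementable (hΦ : IsScoringRule Φ) (hreg : IsRegular M Φ)
    (himp : Implementable M Φ n) : ∃ s₀ s₁, IsSeparable M Φ s₀ s₁ := by
  obtain ⟨s₀, hs₀, hu₀⟩ := exists_zeroScore hΦ hreg M.worst_mem
  have hmem : (M.mHi, M.fLo) ∈ M.types := ⟨⟨M.mLo_lt_mHi.le, le_rfl⟩, le_rfl, M.fLo_lt_fHi.le⟩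
  have hpos₀ : 0 < indirectUtility M Φ s₀ (M.mHi, M.fLo) := by
    have := indirectUtility_anti hΦ hreg hs₀ M.fHi M.fLo (le_refl M.mHi)
    rw [show (M.mHi, M.fHi) = M.worst from rfl, hu₀] at this
    linarith [M.fLo_lt_fHi]
  obtain ⟨s₁, hlt, hs₁, hu₁⟩ : ∃ t, s₀ < t ∧ t ∈ scores Φ ∧
      0 < indirectUtility M Φ t (M.mHi, M.fLo) :=
    ((eventually_mem_nhdsWithin (a := s₀) (s := Ioi s₀)).and (nhdsWithin_le_nhds
      (eventually_utility_pos hΦ hreg hmem hs₀ hpos₀))).exists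
  refine ⟨s₀, s₁, hs₀, hs₁, hu₀, hlt, ?_⟩
  intro m hm
  rcases hm.1.eq_or_lt with rfl | hlo
  · intro s _ _ _
    ring
  have hT : ∀ μ ∈ Icc M.mLo M.mHi, (μ, M.fLo) ∈ M.types := fun μ hμ =>
    ⟨hμ, le_rfl, M.fLo_lt_fHi.le⟩
  have hLo : M.mLo ∈ Icc M.mLo M.mHi := left_mem_Icc.2 M.mLo_lt_mHi.le
  have hanti := fun τ => indirectUtility_strictAnti hΦ hreg (M := M) τ
  have hle : ∀ t ∈ scores Φ, indirectUtility M Φ t (m, M.fLo) ≤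
      indirectUtility M Φ t (M.mLo, M.fLo) := fun t ht =>
    indirectUtility_le_of_worse hΦ hreg ht hm.1 le_rfl
  have hu₁m : 0 < indirectUtility M Φ s₁ (m, M.fLo) :=
    hu₁.trans_le (indirectUtility_le_of_worse hΦ hreg hs₁ hm.2 le_rfl)
  set q := indirectUtilityDeriv M Φ s₁ (m, M.fLo) / indirectUtilityDeriv M Φ s₁ (M.mLo, M.fLo)
    with hq
  have hneg : ∀ μ ∈ Icc M.mLo M.mHi, ∀ t ∈ scores Φ, 0 < indirectUtility M Φ t (μ, M.fLo) →
      indirectUtilityDeriv M Φ t (μ, M.fLo) ≠ 0 := fun μ hμ t ht h =>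
    (indirectUtilityDeriv_neg hΦ hreg (hT μ hμ) ht h.le).ne
  -- The ratio of the marginal rates equals `q` at every relevant score.
  have hratio : ∀ t ∈ scores Φ, s₀ < t → 0 < indirectUtility M Φ t (m, M.fLo) →
      indirectUtilityDeriv M Φ t (m, M.fLo) = q * indirectUtilityDeriv M Φ t (M.mLo, M.fLo) := by
    intro t ht hst hut
    have n1 := hneg m hm t ht hut
    have n2 := hneg M.mLo hLo t ht (hut.trans_le (hle t ht))
    have n3 := hneg m hm s₁ hs₁ hu₁m
    have n4 := hneg M.mLo hLo s₁ hs₁ (hu₁m.trans_le (hle s₁ hs₁))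
    rw [hq, div_mul_eq_mul_div, eq_div_iff n4]
    rcases lt_trichotomy t s₁ with h | rfl | h
    · have := marginal_ratio_eq hΦ hreg himp ht hs₁ h (hu₀ ▸ hanti _ hs₀ ht hst) hlo hm.2 hu₁m
      rw [div_eq_div_iff n1 n2] at this
      linarith
    · rfl
    · have := marginal_ratio_eq hΦ hreg himp hs₁ ht h (hu₀ ▸ hanti _ hs₀ hs₁ hlt) hlo hm.2 hut
      rw [div_eq_div_iff n3 n4] at this
      linarith
  have hdrop : ∀ s ∈ scores Φ, s₀ ≤ s → 0 ≤ indirectUtility M Φ s (m, M.fLo) →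
      indirectUtility M Φ s₀ (m, M.fLo) - indirectUtility M Φ s (m, M.fLo) =
        q * (indirectUtility M Φ s₀ (M.mLo, M.fLo) - indirectUtility M Φ s (M.mLo, M.fLo)) := by
    intro s hs hss hus
    rcases hss.eq_or_lt with rfl | hss
    · ring
    have hsub : Icc s₀ s ⊆ scores Φ := (ordConnected_scores hΦ).out hs₀ hs
    have hnn : ∀ t ∈ Icc s₀ s, 0 ≤ indirectUtility M Φ t (m, M.fLo) := fun t ht =>
      hus.trans ((hanti _).antitoneOn (hsub ht) hs ht.2)
    have hd : ∀ t ∈ Icc s₀ s, HasDerivAt (fun t => indirectUtility M Φ t (m, M.fLo) -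
        q * indirectUtility M Φ t (M.mLo, M.fLo)) (indirectUtilityDeriv M Φ t (m, M.fLo) -
        q * indirectUtilityDeriv M Φ t (M.mLo, M.fLo)) t := fun t ht =>
      (hasDerivAt_indirectUtility hreg (hT m hm) (hsub ht) (hnn t ht)).sub
        ((hasDerivAt_indirectUtility hreg (hT _ hLo) (hsub ht)
          ((hnn t ht).trans (hle t (hsub ht)))).const_mul q)
    obtain ⟨ξ, hξ, h⟩ := exists_hasDerivAt_eq_slope _ _ hss
      (fun t ht => (hd t ht).continuousAt.continuousWithinAt)
      fun t ht => hd t (Ioo_subset_Icc_self ht)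
    have hξ' := Ioo_subset_Icc_self hξ
    rw [hratio ξ (hsub hξ') hξ.1 (hus.trans_lt (hanti _ (hsub hξ') hs hξ.2)), sub_self,
      eq_comm, div_eq_zero_iff] at h
    rcases h with h | h
    · linarith
    · linarith
  intro s hs hss hus
  rw [hdrop s hs hss hus, hdrop s₁ hs₁ hlt.le hu₁m.le]
  ring

end

/-! ### Optimal contracts -/

section

variable {M : CostModel} {Φ : ℝ × ℝ → ℝ}

lemma requiredPrice_eq (hΦ : IsScoringRule Φ) {p q s : ℝ} (hc : (p, q) ∈ contracts)
    (hs : Φ (p, q) = s) : requiredPrice Φ s q = p := by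
  have : {p' | 0 ≤ p' ∧ Φ (p', q) = s} = {p} := by
    ext p'
    constructor
    · rintro ⟨h0, h⟩
      exact (hΦ.decreasing_price q hc.2).injOn h0 hc.1 (h.trans hs.symm)
    · rintro rfl
      exact ⟨hc.1, hs⟩
  rw [requiredPrice, this, csSup_singleton]

/-- By strict concavity of the required price, the optimal contract at a score is unique. -/
lemma optimal_unique (hΦ : IsScoringRule Φ) (hreg : IsRegular M Φ) {s : ℝ} (hs : s ∈ scores Φ)
    {θ : ℝ × ℝ} (hm : 0 ≤ θ.1) {c d : ℝ × ℝ} (hc : c ∈ contracts) (hd : d ∈ contracts)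
    (hcs : Φ c = s) (hds : Φ d = s) (hcu : M.profit θ c = indirectUtility M Φ s θ)
    (hdu : M.profit θ d = indirectUtility M Φ s θ) : c = d := by
  obtain ⟨p, q⟩ := c
  obtain ⟨p', q'⟩ := d
  have hconv := hreg.price_concave s hs
  have h1 : ConcaveOn ℝ (feasibleQualities Φ s) fun x => -(θ.1 * x ^ M.η) := by
    have h2 : ConvexOn ℝ (feasibleQualities Φ s) fun x : ℝ => θ.1 * x ^ M.η :=
      ((convexOn_rpow M.one_le_η).subset (fun x hx => hx.1.1) hconv.1).smul hm
    exact h2.neg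
  have h2 := hconv.add_concaveOn h1
  have hmax : ∀ {p q : ℝ}, (p, q) ∈ contracts → Φ (p, q) = s →
      M.profit θ (p, q) = indirectUtility M Φ s θ →
      IsMaxOn (requiredPrice Φ s + fun x => -(θ.1 * x ^ M.η)) (feasibleQualities Φ s) q := by
    intro p q hc hcs hcu x hx
    obtain ⟨hx1, r, hr, hrs⟩ := hx
    have hrc : (r, x) ∈ contracts := ⟨hr, hx1⟩
    have h3 := profit_le_indirectUtility hΦ hreg hrc θ
    rw [hrs, ← hcu] at h3
    simp only [mem_ofPred_eq, Pi.add_apply, requiredPrice_eq hΦ hc hcs, requiredPrice_eq hΦ hrc hrs]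
    simp only [CostModel.profit, CostModel.cost] at h3
    linarith
  have hq : q = q' := h2.eq_of_isMaxOn (hmax hc hcs hcu) (hmax hd hds hdu)
    ⟨hc.2, p, hc.1, hcs⟩ ⟨hd.2, p', hd.1, hds⟩
  subst hq
  rw [← requiredPrice_eq hΦ hc hcs, requiredPrice_eq hΦ hd hds]

open Classical in
/-- A profit-maximizing contract of score `s` for the marginal cost `m`. -/
noncomputable def optContract (M : CostModel) (Φ : ℝ × ℝ → ℝ) (s m : ℝ) : ℝ × ℝ :=
  if h : ∃ c ∈ contracts, Φ c = s ∧ M.profit (m, 0) c = indirectUtility M Φ s (m, 0) then h.choose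
  else 0

/-- The quantity `q ^ η` at the optimal quality `q` of score `s` for the marginal cost `m`. It is
minus the slope of the indirect utility in `m`. -/
noncomputable def optOutput (M : CostModel) (Φ : ℝ × ℝ → ℝ) (s m : ℝ) : ℝ :=
  (optContract M Φ s m).2 ^ M.η

section Optimum

variable {s m : ℝ}

lemma optContract_spec (hΦ : IsScoringRule Φ) (hreg : IsRegular M Φ) (hs : s ∈ scores Φ) (m : ℝ) :
    optContract M Φ s m ∈ contracts ∧ Φ (optContract M Φ s m) = s ∧
      M.profit (m, 0) (optContract M Φ s m) = indirectUtility M Φ s (m, 0) := by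
  have h : ∃ c ∈ contracts, Φ c = s ∧ M.profit (m, 0) c = indirectUtility M Φ s (m, 0) := by
    obtain ⟨c, hc, hcs, hcu, -⟩ := exists_optimal hΦ hreg hs (m, 0)
    exact ⟨c, hc, hcs, hcu⟩
  rw [optContract, dif_pos h]
  exact ⟨h.choose_spec.1, h.choose_spec.2.1, h.choose_spec.2.2⟩

lemma optContract_fst (hΦ : IsScoringRule Φ) (hreg : IsRegular M Φ) (hs : s ∈ scores Φ) (m f : ℝ) :
    (optContract M Φ s m).1 = indirectUtility M Φ s (m, f) + f + m * optOutput M Φ s m := by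
  have h := (optContract_spec hΦ hreg hs m).2.2
  rw [indirectUtility_sub hΦ hreg hs, ← h]
  simp only [CostModel.profit, CostModel.cost, optOutput]
  ring

lemma le_sub_optOutput (hΦ : IsScoringRule Φ) (hreg : IsRegular M Φ) (hs : s ∈ scores Φ)
    (m m' : ℝ) : indirectUtility M Φ s (m, 0) - optOutput M Φ s m * (m' - m) ≤
      indirectUtility M Φ s (m', 0) := by
  obtain ⟨hc, hcs, hcu⟩ := optContract_spec hΦ hreg hs m
  have h1 := profit_le_indirectUtility hΦ hreg hc (m', 0)
  rw [hcs] at h1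
  rw [← hcu]
  simp only [CostModel.profit, CostModel.cost, optOutput] at *
  linarith

lemma antitone_optOutput (hΦ : IsScoringRule Φ) (hreg : IsRegular M Φ) (hs : s ∈ scores Φ) :
    Antitone (optOutput M Φ s) := by
  intro m m' h
  rcases h.eq_or_lt with rfl | h
  · exact le_rfl
  have h1 := le_sub_optOutput hΦ hreg hs m m'
  have h2 := le_sub_optOutput hΦ hreg hs m' m
  by_contra! hcon
  nlinarith [mul_pos (sub_pos.2 h) (sub_pos.2 hcon)]

lemma optOutput_mem (hΦ : IsScoringRule Φ) (hreg : IsRegular M Φ) (hs : s ∈ scores Φ) (m : ℝ) :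
    optOutput M Φ s m ∈ Icc (0 : ℝ) 1 :=
  rpow_quality_mem M (optContract_spec hΦ hreg hs m).1.2

lemma tendsto_optOutput (hΦ : IsScoringRule Φ) (hreg : IsRegular M Φ) (hs : s ∈ scores Φ)
    (hm : 0 ≤ m) : Tendsto (optOutput M Φ s) (𝓝 m) (𝓝 (optOutput M Φ s m)) := by
  rw [Metric.tendsto_nhds]
  intro ε hε
  obtain ⟨hc₀, hcs₀, hcu₀⟩ := optContract_spec hΦ hreg hs m
  let K := {c | c ∈ contracts ∧ Φ c = s} ∩ {c : ℝ × ℝ | ε ≤ |c.2 ^ M.η - optOutput M Φ s m|}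
  have hη := M.η_pos.le
  have hK : IsCompact K := (isCompact_isoscore hΦ hreg hs).inter_right
    (isClosed_le continuous_const (((Real.continuous_rpow_const hη).comp continuous_snd).sub
      continuous_const).abs)
  have hmem : ∀ m', ¬ |optOutput M Φ s m' - optOutput M Φ s m| < ε →
      optContract M Φ s m' ∈ K := fun m' h =>
    ⟨⟨(optContract_spec hΦ hreg hs m').1, (optContract_spec hΦ hreg hs m').2.1⟩, not_lt.1 h⟩
  rcases K.eq_empty_or_nonempty with hemp | hne
  · refine Eventually.of_forall fun m' => ?_
    rw [Real.dist_eq]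
    by_contra hcon
    have := hmem m' hcon
    rw [hemp] at this
    exact this
  -- The best contract whose output is far from the optimum is strictly worse.
  obtain ⟨c, hcK, hmax⟩ := hK.exists_isMaxOn hne (continuous_profit (M := M) (m, 0)).continuousOn
  have hlt : M.profit (m, 0) c < indirectUtility M Φ s (m, 0) := by
    refine lt_of_le_of_ne (hcK.1.2 ▸ profit_le_indirectUtility hΦ hreg hcK.1.1 (m, 0)) fun h => ?_
    have := optimal_unique hΦ hreg hs (θ := (m, 0)) hm hcK.1.1 hc₀ hcK.1.2 hcs₀ h hcu₀
    have h2 : ε ≤ |c.2 ^ M.η - optOutput M Φ s m| := hcK.2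
    rw [this, optOutput, sub_self, abs_zero] at h2
    linarith
  filter_upwards [Metric.ball_mem_nhds m (half_pos (sub_pos.2 hlt))] with m' hm'
  rw [Metric.mem_ball, Real.dist_eq] at hm'
  rw [Real.dist_eq]
  by_contra hcon
  have h1 := hmax (hmem m' hcon)
  have h2 := (optContract_spec hΦ hreg hs m').2.2
  have h3 := le_sub_optOutput hΦ hreg hs m m'
  have b1 := optOutput_mem hΦ hreg hs m
  have b2 := optOutput_mem hΦ hreg hs m'
  have h4 : M.profit (m, 0) (optContract M Φ s m') =
      M.profit (m', 0) (optContract M Φ s m') + optOutput M Φ s m' * (m' - m) := by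
    simp only [CostModel.profit, CostModel.cost, optOutput]
    ring
  simp only [mem_ofPred_eq] at h1
  have h5 : |optOutput M Φ s m' * (m' - m)| ≤ |m' - m| := by
    rw [abs_mul, abs_of_nonneg b2.1]
    exact mul_le_of_le_one_left (abs_nonneg _) b2.2
  have h6 : |optOutput M Φ s m * (m' - m)| ≤ |m' - m| := by
    rw [abs_mul, abs_of_nonneg b1.1]
    exact mul_le_of_le_one_left (abs_nonneg _) b1.2
  have h7 := neg_abs_le (optOutput M Φ s m' * (m' - m))
  have h8 := le_abs_self (optOutput M Φ s m * (m' - m))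
  linarith

/-- Envelope theorem: the indirect utility falls in the marginal cost at the rate of the optimal
output. -/
lemma hasDerivAt_indirectUtility_fst (hΦ : IsScoringRule Φ) (hreg : IsRegular M Φ)
    (hs : s ∈ scores Φ) (hm : 0 ≤ m) :
    HasDerivAt (fun m => indirectUtility M Φ s (m, 0)) (-optOutput M Φ s m) m := by
  rw [hasDerivAt_iff_isLittleO]
  have h1 : (fun m' => (optOutput M Φ s m' - optOutput M Φ s m) * (m' - m)) =o[𝓝 m]
      fun m' => m' - m := by
    have h2 : (fun m' => optOutput M Φ s m' - optOutput M Φ s m) =o[𝓝 m] fun _ => (1 : ℝ) := by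
      rw [Asymptotics.isLittleO_one_iff]
      simpa using (tendsto_optOutput hΦ hreg hs hm).sub_const (optOutput M Φ s m)
    simpa using h2.mul_isBigO (Asymptotics.isBigO_refl (fun m' => m' - m) (𝓝 m))
  refine Asymptotics.IsBigO.trans_isLittleO (Asymptotics.IsBigO.of_bound 1
    (Eventually.of_forall fun m' => ?_)) h1
  have a1 := le_sub_optOutput hΦ hreg hs m m'
  have a2 := le_sub_optOutput hΦ hreg hs m' m
  rw [one_mul, Real.norm_eq_abs, Real.norm_eq_abs, smul_eq_mul, abs_of_nonneg (by linarith)]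
  refine le_trans ?_ (neg_le_abs _)
  linarith

/-- Optimal qualities are positive, since the required price rises faster in quality at zero than
any cost. -/
lemma optOutput_pos (hΦ : IsScoringRule Φ) (hreg : IsRegular M Φ) (hs : s ∈ scores Φ)
    (hm : m ∈ Icc M.mLo M.mHi) : 0 < optOutput M Φ s m := by
  obtain ⟨hc, hcs, hcu⟩ := optContract_spec hΦ hreg hs m
  unfold optOutput
  generalize hcdef : optContract M Φ s m = c at *
  obtain ⟨p, q⟩ := c
  refine Real.rpow_pos_of_pos (lt_of_le_of_ne hc.2.1 fun h0 => ?_) _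
  have h0' : q = 0 := h0.symm
  subst h0'
  have hF : (0 : ℝ) ∈ feasibleQualities Φ s := ⟨hc.2, p, hc.1, hcs⟩
  have hD := hreg.price_deriv_zero s hs hF
  have hm0 : 0 < m := M.mLo_pos.trans_le hm.1
  have hne : requiredPriceDeriv Φ s 0 ≠ 0 := by linarith [hm.2]
  have hacc : AccPt (0 : ℝ) (𝓟 (feasibleQualities Φ s)) := by
    by_contra h
    exact hne (derivWithin_zero_of_not_accPt h)
  have hdiff : DifferentiableWithinAt ℝ (requiredPrice Φ s) (feasibleQualities Φ s) 0 := by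
    by_contra h
    exact hne (derivWithin_zero_of_not_differentiableWithinAt h)
  have hslope := hasDerivWithinAt_iff_tendsto_slope.1 hdiff.hasDerivWithinAt
  have hnb : (𝓝[feasibleQualities Φ s \ {0}] (0 : ℝ)).NeBot := accPt_principal_iff_nhdsWithin.1 hacc
  have hev := hslope.eventually_const_lt (lt_of_le_of_lt hm.2 hD)
  obtain ⟨x, hx, hxF, hx0⟩ := (Filter.Eventually.and hev self_mem_nhdsWithin).exists
  obtain ⟨hx1, r, hr, hrs⟩ := hxF
  have hxpos : 0 < x := lt_of_le_of_ne hx1.1 (Ne.symm hx0)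
  have hrc : (r, x) ∈ contracts := ⟨hr, hx1⟩
  rw [slope_def_field, sub_zero, lt_div_iff₀ hxpos, requiredPrice_eq hΦ hrc hrs,
    requiredPrice_eq hΦ hc hcs] at hx
  have h1 := profit_le_indirectUtility hΦ hreg hrc (m, 0)
  rw [hrs, ← hcu] at h1
  have h2 : x ^ M.η ≤ x := by
    simpa using Real.rpow_le_rpow_of_exponent_ge hxpos hx1.2 M.one_le_η
  have h3 := mul_le_mul_of_nonneg_left h2 hm0.le
  simp only [CostModel.profit, CostModel.cost, Real.zero_rpow M.η_pos.ne'] at h1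
  linarith

end Optimum

/-! ### Pseudotypes -/

/-- The drop of the indirect utility between the scores `s₀` and `s₁`; the unit in which the
payoffs of the types of marginal cost `m` are measured. -/
noncomputable def unitDrop (M : CostModel) (Φ : ℝ × ℝ → ℝ) (s₀ s₁ m : ℝ) : ℝ :=
  indirectUtility M Φ s₀ (m, M.fLo) - indirectUtility M Φ s₁ (m, M.fLo)

/-- The score as a cost in the common unit. -/
noncomputable def scoreCost (M : CostModel) (Φ : ℝ × ℝ → ℝ) (s₀ s₁ s : ℝ) : ℝ :=
  unitDrop M Φ s₀ s M.mLo / unitDrop M Φ s₀ s₁ M.mLo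

/-- The pseudotype: the indirect utility at the score `s₀` in the common unit. -/
noncomputable def pseudotype (M : CostModel) (Φ : ℝ × ℝ → ℝ) (s₀ s₁ : ℝ) (τ : ℝ × ℝ) : ℝ :=
  indirectUtility M Φ s₀ τ / unitDrop M Φ s₀ s₁ τ.1

/-- The output of the optimal contract whose score has cost `b`. -/
noncomputable def outputAt (M : CostModel) (Φ : ℝ × ℝ → ℝ) (s₀ s₁ m b : ℝ) : ℝ :=
  optOutput M Φ s₀ m + (optOutput M Φ s₁ m - optOutput M Φ s₀ m) * b

/-- The optimal contract of the type `τ` among those whose score has cost `b`. -/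
noncomputable def contractAt (M : CostModel) (Φ : ℝ × ℝ → ℝ) (s₀ s₁ : ℝ) (τ : ℝ × ℝ) (b : ℝ) :
    ℝ × ℝ :=
  (unitDrop M Φ s₀ s₁ τ.1 * (pseudotype M Φ s₀ s₁ τ - b) + τ.2 + τ.1 * outputAt M Φ s₀ s₁ τ.1 b,
    outputAt M Φ s₀ s₁ τ.1 b ^ (M.η⁻¹))

namespace IsSeparable

variable {s₀ s₁ : ℝ}

lemma unitDrop_pos (S : IsSeparable M Φ s₀ s₁) (hΦ : IsScoringRule Φ) (hreg : IsRegular M Φ)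
    (m : ℝ) : 0 < unitDrop M Φ s₀ s₁ m :=
  sub_pos.2 (indirectUtility_strictAnti hΦ hreg _ S.mem₀ S.mem₁ S.lt)

lemma utility_eq (S : IsSeparable M Φ s₀ s₁) (hΦ : IsScoringRule Φ) (hreg : IsRegular M Φ)
    {τ : ℝ × ℝ} (hτ : τ ∈ M.types) {s : ℝ} (hs : s ∈ scores Φ) (hss : s₀ ≤ s)
    (hu : 0 ≤ indirectUtility M Φ s τ) :
    indirectUtility M Φ s τ =
      unitDrop M Φ s₀ s₁ τ.1 * (pseudotype M Φ s₀ s₁ τ - scoreCost M Φ s₀ s₁ s) := by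
  obtain ⟨m, f⟩ := τ
  have hle := indirectUtility_le_of_worse hΦ hreg hs (θ := (m, f)) (θ' := (m, M.fLo)) le_rfl hτ.2.1
  have h := S.separable m hτ.1 s hs hss (hu.trans hle)
  have hA := (S.unitDrop_pos hΦ hreg m).ne'
  have hA' := (S.unitDrop_pos hΦ hreg M.mLo).ne'
  have h2 : unitDrop M Φ s₀ s m * unitDrop M Φ s₀ s₁ M.mLo =
      unitDrop M Φ s₀ s₁ m * unitDrop M Φ s₀ s M.mLo := h
  have h3 : unitDrop M Φ s₀ s m = indirectUtility M Φ s₀ (m, f) - indirectUtility M Φ s (m, f) := by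
    rw [unitDrop, indirectUtility_sub hΦ hreg S.mem₀, indirectUtility_sub hΦ hreg hs,
      indirectUtility_sub hΦ hreg S.mem₀ m f, indirectUtility_sub hΦ hreg hs m f]
    ring
  simp only [pseudotype, scoreCost]
  rw [mul_sub, mul_div_cancel₀ _ hA, ← mul_div_assoc, ← h2, mul_div_cancel_right₀ _ hA', h3]
  ring

lemma scoreCost_strictMono (S : IsSeparable M Φ s₀ s₁) (hΦ : IsScoringRule Φ)
    (hreg : IsRegular M Φ) : StrictMonoOn (scoreCost M Φ s₀ s₁) (scores Φ) := by
  intro s hs t ht hst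
  have := indirectUtility_strictAnti hΦ hreg (M := M) (M.mLo, M.fLo) hs ht hst
  unfold scoreCost
  refine div_lt_div_of_pos_right ?_ (S.unitDrop_pos hΦ hreg _)
  simp only [unitDrop]
  linarith

lemma scoreCost_zero : scoreCost M Φ s₀ s₁ s₀ = 0 := by simp [scoreCost, unitDrop]

lemma optOutput_eq (S : IsSeparable M Φ s₀ s₁) (hΦ : IsScoringRule Φ) (hreg : IsRegular M Φ)
    {m : ℝ} (hm : m ∈ Icc M.mLo M.mHi) {s : ℝ} (hs : s ∈ scores Φ) (hss : s₀ ≤ s)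
    (hu : 0 < indirectUtility M Φ s (m, M.fLo)) :
    optOutput M Φ s m = outputAt M Φ s₀ s₁ m (scoreCost M Φ s₀ s₁ s) := by
  have hm0 : 0 ≤ m := M.mLo_pos.le.trans hm.1
  have hdiff : ∀ t ∈ scores Φ, HasDerivAt (fun m => unitDrop M Φ s₀ t m)
      (-optOutput M Φ s₀ m - -optOutput M Φ t m) m := by
    intro t ht
    refine ((hasDerivAt_indirectUtility_fst hΦ hreg S.mem₀ hm0).sub
      (hasDerivAt_indirectUtility_fst hΦ hreg ht hm0)).congr_of_eventuallyEq
        (Eventually.of_forall fun x => ?_)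
    simp only [unitDrop, Pi.sub_apply]
    rw [indirectUtility_sub hΦ hreg S.mem₀, indirectUtility_sub hΦ hreg ht]
    ring
  have h1 := ((hdiff s hs).mul_const (unitDrop M Φ s₀ s₁ M.mLo)).hasDerivWithinAt
    (s := Icc M.mLo M.mHi)
  have h2 := ((hdiff s₁ S.mem₁).mul_const (unitDrop M Φ s₀ s M.mLo)).hasDerivWithinAt
    (s := Icc M.mLo M.mHi)
  have hev : ∀ᶠ x in 𝓝[Icc M.mLo M.mHi] m, unitDrop M Φ s₀ s x * unitDrop M Φ s₀ s₁ M.mLo =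
      unitDrop M Φ s₀ s₁ x * unitDrop M Φ s₀ s M.mLo := by
    have h3 : Tendsto (fun x => indirectUtility M Φ s (x, M.fLo)) (𝓝 m)
        (𝓝 (indirectUtility M Φ s (m, M.fLo))) :=
      ((continuous_indirectUtility hΦ hreg hs).comp (Continuous.prodMk_left M.fLo)).tendsto m
    filter_upwards [self_mem_nhdsWithin, nhdsWithin_le_nhds (h3.eventually_const_lt hu)] with x hx
      hxu
    exact S.separable x hx s hs hss hxu.le
  have h3 := h2.congr_of_eventuallyEq hev (hev.self_of_nhdsWithin hm)
  have h4 := (uniqueDiffOn_Icc M.mLo_lt_mHi m hm).eq_deriv _ h1 h3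
  have hA' := (S.unitDrop_pos hΦ hreg M.mLo).ne'
  unfold outputAt scoreCost
  rw [← mul_div_assoc, ← sub_eq_iff_eq_add', eq_div_iff hA']
  linarith

lemma utility_zero_nonneg (S : IsSeparable M Φ s₀ s₁) (hΦ : IsScoringRule Φ)
    (hreg : IsRegular M Φ) {τ : ℝ × ℝ} (hτ : τ ∈ M.types) : 0 ≤ indirectUtility M Φ s₀ τ :=
  S.zero.ge.trans (indirectUtility_le_of_worse hΦ hreg S.mem₀ hτ.1.2 hτ.2.2)

lemma pseudotype_nonneg (S : IsSeparable M Φ s₀ s₁) (hΦ : IsScoringRule Φ)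
    (hreg : IsRegular M Φ) {τ : ℝ × ℝ} (hτ : τ ∈ M.types) : 0 ≤ pseudotype M Φ s₀ s₁ τ :=
  div_nonneg (S.utility_zero_nonneg hΦ hreg hτ) (S.unitDrop_pos hΦ hreg _).le

/-- For every cost `b` below the pseudotype there is a score of this cost, and `contractAt` is the
optimal contract of this score. -/
lemma exists_score (S : IsSeparable M Φ s₀ s₁) (hΦ : IsScoringRule Φ) (hreg : IsRegular M Φ)
    {τ : ℝ × ℝ} (hτ : τ ∈ M.types) {b : ℝ} (hb : 0 ≤ b)
    (hbk : b < pseudotype M Φ s₀ s₁ τ ∨ b = 0) :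
    contractAt M Φ s₀ s₁ τ b ∈ contracts ∧ s₀ ≤ Φ (contractAt M Φ s₀ s₁ τ b) ∧
      scoreCost M Φ s₀ s₁ (Φ (contractAt M Φ s₀ s₁ τ b)) = b ∧
      M.profit τ (contractAt M Φ s₀ s₁ τ b) =
        unitDrop M Φ s₀ s₁ τ.1 * (pseudotype M Φ s₀ s₁ τ - b) ∧
      0 < outputAt M Φ s₀ s₁ τ.1 b := by
  have hA := S.unitDrop_pos hΦ hreg τ.1
  have hk := S.pseudotype_nonneg hΦ hreg hτ
  have hu₀ : indirectUtility M Φ s₀ τ = unitDrop M Φ s₀ s₁ τ.1 * pseudotype M Φ s₀ s₁ τ := by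
    rw [pseudotype, mul_div_cancel₀ _ hA.ne']
  obtain ⟨s, hs, hss, hsb, hu, hQ⟩ : ∃ s ∈ scores Φ, s₀ ≤ s ∧ scoreCost M Φ s₀ s₁ s = b ∧
      indirectUtility M Φ s τ = unitDrop M Φ s₀ s₁ τ.1 * (pseudotype M Φ s₀ s₁ τ - b) ∧
      optOutput M Φ s τ.1 = outputAt M Φ s₀ s₁ τ.1 b := by
    by_cases hb0 : b = 0
    · subst hb0
      exact ⟨s₀, S.mem₀, le_rfl, scoreCost_zero, by rw [hu₀, sub_zero], by simp [outputAt]⟩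
    · have hbk := hbk.resolve_right hb0
      have hv : 0 < unitDrop M Φ s₀ s₁ τ.1 * (pseudotype M Φ s₀ s₁ τ - b) :=
        mul_pos hA (sub_pos.2 hbk)
      obtain ⟨s, hs, hss, hsu⟩ := exists_score_of_utility hΦ hreg hτ S.mem₀ hv.le (by
        rw [hu₀]
        exact mul_le_mul_of_nonneg_left (by linarith) hA.le)
      have h1 := S.utility_eq hΦ hreg hτ hs hss (hsu ▸ hv.le)
      rw [hsu] at h1
      have h2 := mul_left_cancel₀ hA.ne' h1
      have h3 : scoreCost M Φ s₀ s₁ s = b := by linarith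
      refine ⟨s, hs, hss, h3, hsu, ?_⟩
      rw [← h3]
      refine S.optOutput_eq hΦ hreg hτ.1 hs hss (lt_of_lt_of_le (hsu ▸ hv) ?_)
      exact indirectUtility_le_of_worse hΦ hreg hs le_rfl hτ.2.1
  obtain ⟨hc, hcs, -⟩ := optContract_spec hΦ hreg hs τ.1
  have heq : contractAt M Φ s₀ s₁ τ b = optContract M Φ s τ.1 := by
    refine Prod.ext ?_ ?_
    · rw [optContract_fst hΦ hreg hs τ.1 τ.2, Prod.mk.eta, hu, hQ]
      rfl
    · simp only [contractAt]
      rw [← hQ, optOutput, Real.rpow_rpow_inv hc.2.1 M.η_pos.ne']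
  rw [heq]
  refine ⟨hc, hcs.ge.trans' hss, by rw [hcs, hsb], ?_, hQ ▸ optOutput_pos hΦ hreg hs hτ.1⟩
  have := optContract_fst hΦ hreg hs τ.1 τ.2
  rw [Prod.mk.eta, hu] at this
  simp only [CostModel.profit, CostModel.cost, optOutput] at *
  linarith

end IsSeparable

end

/-! ### The mean pseudotype of the weaker types -/

section

variable {M : CostModel} {Φ : ℝ × ℝ → ℝ} {s₀ s₁ : ℝ} {g : ℝ × ℝ → ℝ}

/-- The types whose pseudotype is below `κ`. -/
def lowerTypes (M : CostModel) (Φ : ℝ × ℝ → ℝ) (s₀ s₁ κ : ℝ) : Set (ℝ × ℝ) :=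
  {τ | τ ∈ M.types ∧ pseudotype M Φ s₀ s₁ τ < κ}

/-- The mean pseudotype of the types below `κ`, a ratio of two moments. It is `0` if there are no
such types. -/
noncomputable def lowerMean (M : CostModel) (Φ : ℝ × ℝ → ℝ) (s₀ s₁ : ℝ) (g : ℝ × ℝ → ℝ) (κ : ℝ) :
    ℝ :=
  moment M ((lowerTypes M Φ s₀ s₁ κ).indicator (pseudotype M Φ s₀ s₁)) g /
    moment M ((lowerTypes M Φ s₀ s₁ κ).indicator fun _ => 1) g

namespace IsSeparable

lemma continuous_unitDrop (S : IsSeparable M Φ s₀ s₁) (hΦ : IsScoringRule Φ)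
    (hreg : IsRegular M Φ) : Continuous (unitDrop M Φ s₀ s₁) :=
  ((continuous_indirectUtility hΦ hreg S.mem₀).comp (Continuous.prodMk_left M.fLo)).sub
    ((continuous_indirectUtility hΦ hreg S.mem₁).comp (Continuous.prodMk_left M.fLo))

lemma continuous_pseudotype (S : IsSeparable M Φ s₀ s₁) (hΦ : IsScoringRule Φ)
    (hreg : IsRegular M Φ) : Continuous (pseudotype M Φ s₀ s₁) :=
  (continuous_indirectUtility hΦ hreg S.mem₀).div
    ((S.continuous_unitDrop hΦ hreg).comp continuous_fst) fun τ => (S.unitDrop_pos hΦ hreg τ.1).ne'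

lemma measurableSet_lowerTypes (S : IsSeparable M Φ s₀ s₁) (hΦ : IsScoringRule Φ)
    (hreg : IsRegular M Φ) (κ : ℝ) : MeasurableSet (lowerTypes M Φ s₀ s₁ κ) :=
  measurableSet_types.inter
    (measurableSet_lt (S.continuous_pseudotype hΦ hreg).measurable measurable_const)

lemma exists_bound (S : IsSeparable M Φ s₀ s₁) (hΦ : IsScoringRule Φ)
    (hreg : IsRegular M Φ) : ∃ B, ∀ τ ∈ M.types, |pseudotype M Φ s₀ s₁ τ| ≤ B := by
  obtain ⟨B, hB⟩ := isCompact_types.exists_bound_of_continuousOn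
    (S.continuous_pseudotype hΦ hreg (M := M)).continuousOn
  exact ⟨B, hB⟩

lemma integrable_pseudotype (S : IsSeparable M Φ s₀ s₁) (hΦ : IsScoringRule Φ)
    (hreg : IsRegular M Φ) (hg : g ∈ densities M) :
    Integrable (pseudotype M Φ s₀ s₁) (typeLaw M g) := by
  have := isProbabilityMeasure_typeLaw hg
  obtain ⟨B, hB⟩ := S.exists_bound hΦ hreg
  refine Integrable.of_bound (S.continuous_pseudotype hΦ hreg).aestronglyMeasurable B ?_
  filter_upwards [ae_typeLaw_mem (M := M) (g := g)] with τ hτ using hB τ hτ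

/-- The pseudotype has no atoms, as it is strictly decreasing in the fixed cost. -/
lemma typeLaw_level (S : IsSeparable M Φ s₀ s₁) (hΦ : IsScoringRule Φ)
    (hreg : IsRegular M Φ) (κ : ℝ) : typeLaw M g {τ | pseudotype M Φ s₀ s₁ τ = κ} = 0 := by
  refine typeLaw_eq_zero_of_sections
    ((S.continuous_pseudotype hΦ hreg).measurable (measurableSet_singleton κ)) ?_
  intro m f f' h h'
  have h1 : pseudotype M Φ s₀ s₁ (m, f) = pseudotype M Φ s₀ s₁ (m, f') := Eq.trans h (Eq.symm h')
  rw [pseudotype, pseudotype, div_left_inj' (S.unitDrop_pos hΦ hreg _).ne',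
    indirectUtility_sub hΦ hreg S.mem₀, indirectUtility_sub hΦ hreg S.mem₀ m f'] at h1
  linarith

lemma pseudotype_worst (S : IsSeparable M Φ s₀ s₁) : pseudotype M Φ s₀ s₁ M.worst = 0 := by
  rw [pseudotype, S.zero, zero_div]

lemma typeLaw_between_pos (S : IsSeparable M Φ s₀ s₁) (hΦ : IsScoringRule Φ)
    (hreg : IsRegular M Φ) (hg : g ∈ densities M) {τ : ℝ × ℝ} (hτ : τ ∈ M.types) {a b : ℝ}
    (ha : 0 ≤ a) (hab : a < b) (hb : b ≤ pseudotype M Φ s₀ s₁ τ) :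
    0 < typeLaw M g ({τ | a < pseudotype M Φ s₀ s₁ τ ∧ pseudotype M Φ s₀ s₁ τ < b} ∩ M.types) := by
  have hcont := S.continuous_pseudotype hΦ hreg
  refine typeLaw_pos hg ((isOpen_lt continuous_const hcont).inter
    (isOpen_lt hcont continuous_const)) ?_
  obtain ⟨c, hac, hcb⟩ := exists_between hab
  have hconn : IsPreconnected M.types :=
    ((convex_Icc M.mLo M.mHi).prod (convex_Icc M.fLo M.fHi)).isPreconnected
  obtain ⟨x, hx, hxc⟩ := hconn.intermediate_value M.worst_mem hτ hcont.continuousOn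
    (show c ∈ Icc (pseudotype M Φ s₀ s₁ M.worst) (pseudotype M Φ s₀ s₁ τ) from
      ⟨by rw [S.pseudotype_worst]; linarith, by linarith⟩)
  exact ⟨x, ⟨by rw [hxc]; exact hac, by rw [hxc]; exact hcb⟩, hx⟩

lemma moment_count (S : IsSeparable M Φ s₀ s₁) (hΦ : IsScoringRule Φ) (hreg : IsRegular M Φ)
    (hg : g ∈ densities M) (κ : ℝ) :
    moment M ((lowerTypes M Φ s₀ s₁ κ).indicator fun _ => 1) g =
      (typeLaw M g).real (lowerTypes M Φ s₀ s₁ κ) := by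
  rw [moment, ← integral_typeLaw hg, integral_indicator (S.measurableSet_lowerTypes hΦ hreg κ)]
  simp

lemma moment_sum (S : IsSeparable M Φ s₀ s₁) (hΦ : IsScoringRule Φ) (hreg : IsRegular M Φ)
    (hg : g ∈ densities M) (κ : ℝ) :
    moment M ((lowerTypes M Φ s₀ s₁ κ).indicator (pseudotype M Φ s₀ s₁)) g =
      ∫ τ in lowerTypes M Φ s₀ s₁ κ, pseudotype M Φ s₀ s₁ τ ∂(typeLaw M g) := by
  rw [moment, ← integral_typeLaw hg, integral_indicator (S.measurableSet_lowerTypes hΦ hreg κ)]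

/-- Among all sets of types, the types below `κ` maximize the integral of `κ - k`. -/
lemma setIntegral_le_lowerTypes (S : IsSeparable M Φ s₀ s₁) (hΦ : IsScoringRule Φ)
    (hreg : IsRegular M Φ) (hg : g ∈ densities M) (κ : ℝ) {T : Set (ℝ × ℝ)}
    (hT : NullMeasurableSet T (typeLaw M g)) :
    κ * (typeLaw M g).real T - ∫ τ in T, pseudotype M Φ s₀ s₁ τ ∂(typeLaw M g) ≤
      κ * (typeLaw M g).real (lowerTypes M Φ s₀ s₁ κ) -
        ∫ τ in lowerTypes M Φ s₀ s₁ κ, pseudotype M Φ s₀ s₁ τ ∂(typeLaw M g) := by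
  have := isProbabilityMeasure_typeLaw hg
  have hint := S.integrable_pseudotype hΦ hreg hg
  have hL := S.measurableSet_lowerTypes hΦ hreg (M := M) κ
  have hsub : Integrable (fun τ => κ - pseudotype M Φ s₀ s₁ τ) (typeLaw M g) :=
    (integrable_const κ).sub hint
  have key : ∀ U : Set (ℝ × ℝ), κ * (typeLaw M g).real U -
      ∫ τ in U, pseudotype M Φ s₀ s₁ τ ∂(typeLaw M g) =
      ∫ τ in U, (κ - pseudotype M Φ s₀ s₁ τ) ∂(typeLaw M g) := by
    intro U
    rw [integral_sub (integrable_const κ) hint.integrableOn, setIntegral_const, smul_eq_mul,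
      mul_comm]
  rw [key, key, ← integral_indicator₀ hT, ← integral_indicator hL]
  refine integral_mono_ae (hsub.indicator₀ hT) (hsub.indicator hL) ?_
  filter_upwards [ae_typeLaw_mem (M := M) (g := g)] with τ hτ
  by_cases hlt : pseudotype M Φ s₀ s₁ τ < κ
  · rw [indicator_of_mem (show τ ∈ lowerTypes M Φ s₀ s₁ κ from ⟨hτ, hlt⟩)]
    by_cases h : τ ∈ T
    · rw [indicator_of_mem h]
    · rw [indicator_of_notMem h]
      linarith
  · rw [indicator_of_notMem (show τ ∉ lowerTypes M Φ s₀ s₁ κ from fun h => hlt h.2)]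
    by_cases h : τ ∈ T
    · rw [indicator_of_mem h]
      linarith
    · rw [indicator_of_notMem h]

lemma lowerMean_eq (S : IsSeparable M Φ s₀ s₁) (hΦ : IsScoringRule Φ) (hreg : IsRegular M Φ)
    (hg : g ∈ densities M) (κ : ℝ) : lowerMean M Φ s₀ s₁ g κ =
      (∫ τ in lowerTypes M Φ s₀ s₁ κ, pseudotype M Φ s₀ s₁ τ ∂(typeLaw M g)) /
        (typeLaw M g).real (lowerTypes M Φ s₀ s₁ κ) := by
  rw [lowerMean, S.moment_count hΦ hreg hg, S.moment_sum hΦ hreg hg]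

lemma lowerTypes_zero (S : IsSeparable M Φ s₀ s₁) (hΦ : IsScoringRule Φ) (hreg : IsRegular M Φ) :
    lowerTypes M Φ s₀ s₁ 0 = ∅ :=
  eq_empty_of_forall_notMem fun _ h => not_lt.2 (S.pseudotype_nonneg hΦ hreg h.1) h.2

lemma lowerMean_zero (S : IsSeparable M Φ s₀ s₁) (hΦ : IsScoringRule Φ) (hreg : IsRegular M Φ)
    (g : ℝ × ℝ → ℝ) : lowerMean M Φ s₀ s₁ g 0 = 0 := by
  simp [lowerMean, S.lowerTypes_zero hΦ hreg, moment]

lemma count_pos (S : IsSeparable M Φ s₀ s₁) (hΦ : IsScoringRule Φ) (hreg : IsRegular M Φ)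
    (hg : g ∈ densities M) {τ : ℝ × ℝ} (hτ : τ ∈ M.types) (hk : 0 < pseudotype M Φ s₀ s₁ τ) :
    0 < (typeLaw M g).real (lowerTypes M Φ s₀ s₁ (pseudotype M Φ s₀ s₁ τ)) := by
  have := isProbabilityMeasure_typeLaw hg
  rw [measureReal_def, ENNReal.toReal_pos_iff]
  refine ⟨(S.typeLaw_between_pos hΦ hreg hg hτ le_rfl hk le_rfl).trans_le
    (measure_mono fun x hx => ⟨hx.2, hx.1.2⟩), measure_lt_top _ _⟩

lemma sum_pos (S : IsSeparable M Φ s₀ s₁) (hΦ : IsScoringRule Φ) (hreg : IsRegular M Φ)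
    (hg : g ∈ densities M) {τ : ℝ × ℝ} (hτ : τ ∈ M.types) (hk : 0 < pseudotype M Φ s₀ s₁ τ) :
    0 < ∫ x in lowerTypes M Φ s₀ s₁ (pseudotype M Φ s₀ s₁ τ), pseudotype M Φ s₀ s₁ x
      ∂(typeLaw M g) := by
  have hL := S.measurableSet_lowerTypes hΦ hreg (M := M) (pseudotype M Φ s₀ s₁ τ)
  rw [setIntegral_pos_iff_support_of_nonneg_ae ?_ (S.integrable_pseudotype hΦ hreg hg).integrableOn]
  · refine (S.typeLaw_between_pos hΦ hreg hg hτ le_rfl hk le_rfl).trans_le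
      (measure_mono fun x hx => ⟨hx.1.1.ne', hx.2, hx.1.2⟩)
  · filter_upwards [ae_restrict_mem hL] with x hx using S.pseudotype_nonneg hΦ hreg hx.1

lemma sum_lt (S : IsSeparable M Φ s₀ s₁) (hΦ : IsScoringRule Φ) (hreg : IsRegular M Φ)
    (hg : g ∈ densities M) {τ : ℝ × ℝ} (hτ : τ ∈ M.types) (hk : 0 < pseudotype M Φ s₀ s₁ τ) :
    ∫ x in lowerTypes M Φ s₀ s₁ (pseudotype M Φ s₀ s₁ τ), pseudotype M Φ s₀ s₁ x
      ∂(typeLaw M g) < pseudotype M Φ s₀ s₁ τ *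
        (typeLaw M g).real (lowerTypes M Φ s₀ s₁ (pseudotype M Φ s₀ s₁ τ)) := by
  have := isProbabilityMeasure_typeLaw hg
  have hL := S.measurableSet_lowerTypes hΦ hreg (M := M) (pseudotype M Φ s₀ s₁ τ)
  have hint := S.integrable_pseudotype hΦ hreg hg
  have hsub : Integrable (fun x => pseudotype M Φ s₀ s₁ τ - pseudotype M Φ s₀ s₁ x)
      (typeLaw M g) := (integrable_const _).sub hint
  have h : 0 < ∫ x in lowerTypes M Φ s₀ s₁ (pseudotype M Φ s₀ s₁ τ),
      (pseudotype M Φ s₀ s₁ τ - pseudotype M Φ s₀ s₁ x) ∂(typeLaw M g) := by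
    rw [setIntegral_pos_iff_support_of_nonneg_ae ?_ hsub.integrableOn]
    · refine (S.typeLaw_between_pos hΦ hreg hg hτ le_rfl hk le_rfl).trans_le
        (measure_mono fun x hx => ⟨(sub_pos.2 hx.1.2).ne', hx.2, hx.1.2⟩)
    · filter_upwards [ae_restrict_mem hL] with x hx using sub_nonneg.2 hx.2.le
  rw [integral_sub (integrable_const _) hint.integrableOn, setIntegral_const, smul_eq_mul,
    mul_comm] at h
  linarith

lemma lowerMean_mem (S : IsSeparable M Φ s₀ s₁) (hΦ : IsScoringRule Φ) (hreg : IsRegular M Φ)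
    (hg : g ∈ densities M) {τ : ℝ × ℝ} (hτ : τ ∈ M.types) (hk : 0 < pseudotype M Φ s₀ s₁ τ) :
    0 < lowerMean M Φ s₀ s₁ g (pseudotype M Φ s₀ s₁ τ) ∧
      lowerMean M Φ s₀ s₁ g (pseudotype M Φ s₀ s₁ τ) < pseudotype M Φ s₀ s₁ τ := by
  have h1 := S.count_pos hΦ hreg hg hτ hk
  rw [S.lowerMean_eq hΦ hreg hg]
  exact ⟨div_pos (S.sum_pos hΦ hreg hg hτ hk) h1,
    (div_lt_iff₀ h1).2 (S.sum_lt hΦ hreg hg hτ hk)⟩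

lemma lowerMean_mem' (S : IsSeparable M Φ s₀ s₁) (hΦ : IsScoringRule Φ) (hreg : IsRegular M Φ)
    (hg : g ∈ densities M) {τ : ℝ × ℝ} (hτ : τ ∈ M.types) :
    0 ≤ lowerMean M Φ s₀ s₁ g (pseudotype M Φ s₀ s₁ τ) ∧
      (lowerMean M Φ s₀ s₁ g (pseudotype M Φ s₀ s₁ τ) < pseudotype M Φ s₀ s₁ τ ∨
        lowerMean M Φ s₀ s₁ g (pseudotype M Φ s₀ s₁ τ) = 0) := by
  rcases (S.pseudotype_nonneg hΦ hreg hτ).eq_or_lt with h | h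
  · rw [← h, S.lowerMean_zero hΦ hreg]
    exact ⟨le_rfl, Or.inr rfl⟩
  · have := S.lowerMean_mem hΦ hreg hg hτ h
    exact ⟨this.1.le, Or.inl this.2⟩

lemma lowerMean_lt (S : IsSeparable M Φ s₀ s₁) (hΦ : IsScoringRule Φ) (hreg : IsRegular M Φ)
    (hg : g ∈ densities M) {τ τ' : ℝ × ℝ} (hτ : τ ∈ M.types) (hτ' : τ' ∈ M.types)
    (hlt : pseudotype M Φ s₀ s₁ τ < pseudotype M Φ s₀ s₁ τ') :
    lowerMean M Φ s₀ s₁ g (pseudotype M Φ s₀ s₁ τ) <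
      lowerMean M Φ s₀ s₁ g (pseudotype M Φ s₀ s₁ τ') := by
  have := isProbabilityMeasure_typeLaw hg
  have hk := S.pseudotype_nonneg hΦ hreg hτ
  have hk' := hk.trans_lt hlt
  have hmem' := S.lowerMean_mem hΦ hreg hg hτ' hk'
  rcases hk.eq_or_lt with h | h
  · rw [← h, S.lowerMean_zero hΦ hreg]
    exact hmem'.1
  have c1 := S.count_pos hΦ hreg hg hτ h
  have c2 := S.count_pos hΦ hreg hg hτ' hk'
  have h1 := S.sum_lt hΦ hreg hg hτ h
  have h2 := S.setIntegral_le_lowerTypes hΦ hreg hg (pseudotype M Φ s₀ s₁ τ)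
    (S.measurableSet_lowerTypes hΦ hreg (pseudotype M Φ s₀ s₁ τ')).nullMeasurableSet
  have h3 : (typeLaw M g).real (lowerTypes M Φ s₀ s₁ (pseudotype M Φ s₀ s₁ τ)) <
      (typeLaw M g).real (lowerTypes M Φ s₀ s₁ (pseudotype M Φ s₀ s₁ τ')) := by
    have hpos := S.typeLaw_between_pos hΦ hreg hg hτ' hk hlt le_rfl
    have hL := S.measurableSet_lowerTypes hΦ hreg (M := M) (pseudotype M Φ s₀ s₁ τ)
    have hdisj : Disjoint ({x | pseudotype M Φ s₀ s₁ τ < pseudotype M Φ s₀ s₁ x ∧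
        pseudotype M Φ s₀ s₁ x < pseudotype M Φ s₀ s₁ τ'} ∩ M.types)
        (lowerTypes M Φ s₀ s₁ (pseudotype M Φ s₀ s₁ τ)) :=
      Set.disjoint_left.2 fun x hx hx' => lt_asymm hx.1.1 hx'.2
    have h4 : (typeLaw M g).real (({x | pseudotype M Φ s₀ s₁ τ < pseudotype M Φ s₀ s₁ x ∧
        pseudotype M Φ s₀ s₁ x < pseudotype M Φ s₀ s₁ τ'} ∩ M.types) ∪
        lowerTypes M Φ s₀ s₁ (pseudotype M Φ s₀ s₁ τ)) ≤
        (typeLaw M g).real (lowerTypes M Φ s₀ s₁ (pseudotype M Φ s₀ s₁ τ')) :=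
      measureReal_mono (union_subset (fun x hx => ⟨hx.2, hx.1.2⟩)
        fun x hx => ⟨hx.1, hx.2.trans hlt⟩)
    rw [measureReal_union hdisj hL] at h4
    have h5 : 0 < (typeLaw M g).real ({x | pseudotype M Φ s₀ s₁ τ < pseudotype M Φ s₀ s₁ x ∧
        pseudotype M Φ s₀ s₁ x < pseudotype M Φ s₀ s₁ τ'} ∩ M.types) :=
      ENNReal.toReal_pos hpos.ne' (measure_ne_top _ _)
    linarith
  rw [S.lowerMean_eq hΦ hreg hg, S.lowerMean_eq hΦ hreg hg, div_lt_div_iff₀ c1 c2]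
  nlinarith [mul_pos (sub_pos.2 h1) (sub_pos.2 h3)]

lemma lowerMean_lt_iff (S : IsSeparable M Φ s₀ s₁) (hΦ : IsScoringRule Φ) (hreg : IsRegular M Φ)
    (hg : g ∈ densities M) {τ τ' : ℝ × ℝ} (hτ : τ ∈ M.types) (hτ' : τ' ∈ M.types) :
    lowerMean M Φ s₀ s₁ g (pseudotype M Φ s₀ s₁ τ) <
      lowerMean M Φ s₀ s₁ g (pseudotype M Φ s₀ s₁ τ') ↔
        pseudotype M Φ s₀ s₁ τ < pseudotype M Φ s₀ s₁ τ' := by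
  refine ⟨fun h => ?_, S.lowerMean_lt hΦ hreg hg hτ hτ'⟩
  by_contra! hcon
  rcases hcon.eq_or_lt with h' | h'
  · rw [h'] at h
    exact h.false
  · exact lt_asymm h (S.lowerMean_lt hΦ hreg hg hτ' hτ h')

lemma continuous_sum_sub (S : IsSeparable M Φ s₀ s₁) (hΦ : IsScoringRule Φ)
    (hreg : IsRegular M Φ) (hg : g ∈ densities M) (B : ℝ) :
    Continuous fun κ => ∫ τ in lowerTypes M Φ s₀ s₁ κ, (pseudotype M Φ s₀ s₁ τ - B)
      ∂(typeLaw M g) := by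
  have := isProbabilityMeasure_typeLaw hg
  have hint : Integrable (fun τ => pseudotype M Φ s₀ s₁ τ - B) (typeLaw M g) :=
    (S.integrable_pseudotype hΦ hreg hg).sub (integrable_const B)
  have hL := fun κ => S.measurableSet_lowerTypes hΦ hreg (M := M) κ
  simp_rw [← fun κ => integral_indicator (μ := typeLaw M g)
    (f := fun τ => pseudotype M Φ s₀ s₁ τ - B) (hL κ)]
  rw [continuous_iff_continuousAt]
  intro κ
  refine continuousAt_of_dominated (bound := fun τ => ‖pseudotype M Φ s₀ s₁ τ - B‖)
    (Eventually.of_forall fun κ => (hint.indicator (hL κ)).aestronglyMeasurable)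
    (Eventually.of_forall fun κ => Eventually.of_forall fun τ => norm_indicator_le_norm_self _ τ)
    hint.norm ?_
  have hlevel : ∀ᵐ τ ∂(typeLaw M g), pseudotype M Φ s₀ s₁ τ ≠ κ := by
    rw [ae_iff]
    simpa using S.typeLaw_level (g := g) hΦ hreg κ
  filter_upwards [hlevel, ae_typeLaw_mem (M := M) (g := g)] with τ hne hτ
  rcases hne.lt_or_gt with h | h
  · refine (continuousAt_const (y := pseudotype M Φ s₀ s₁ τ - B)).congr ?_
    filter_upwards [Ioi_mem_nhds h] with x hx
    rw [indicator_of_mem (show τ ∈ lowerTypes M Φ s₀ s₁ x from ⟨hτ, hx⟩)]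
  · refine (continuousAt_const (y := (0 : ℝ))).congr ?_
    filter_upwards [Iio_mem_nhds h] with x hx
    rw [indicator_of_notMem (show τ ∉ lowerTypes M Φ s₀ s₁ x from fun h' => lt_asymm h'.2 hx)]

/-- The mean pseudotype of the types whose lower mean is below `B` is at most `B`. -/
lemma setIntegral_lowerMean_lt (S : IsSeparable M Φ s₀ s₁) (hΦ : IsScoringRule Φ)
    (hreg : IsRegular M Φ) (hg : g ∈ densities M) {B : ℝ} {T : Set (ℝ × ℝ)}
    (hT : T = {τ | τ ∈ M.types ∧ lowerMean M Φ s₀ s₁ g (pseudotype M Φ s₀ s₁ τ) < B}) :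
    ∫ τ in T, pseudotype M Φ s₀ s₁ τ ∂(typeLaw M g) ≤ B * (typeLaw M g).real T := by
  have := isProbabilityMeasure_typeLaw hg
  subst hT
  set T := {τ | τ ∈ M.types ∧ lowerMean M Φ s₀ s₁ g (pseudotype M Φ s₀ s₁ τ) < B} with hTdef
  rcases T.eq_empty_or_nonempty with h | hne
  · simp [h]
  have hint := S.integrable_pseudotype hΦ hreg hg
  have key : ∀ U : Set (ℝ × ℝ), ∫ τ in U, (pseudotype M Φ s₀ s₁ τ - B) ∂(typeLaw M g) =
      ∫ τ in U, pseudotype M Φ s₀ s₁ τ ∂(typeLaw M g) - B * (typeLaw M g).real U := by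
    intro U
    rw [integral_sub hint.integrableOn (integrable_const B), setIntegral_const, smul_eq_mul,
      mul_comm]
  obtain ⟨b, hb⟩ := S.exists_bound hΦ hreg
  have hbdd : BddAbove (pseudotype M Φ s₀ s₁ '' T) :=
    ⟨b, by rintro _ ⟨τ, hτ, rfl⟩; exact (le_abs_self _).trans (hb τ hτ.1)⟩
  set K := sSup (pseudotype M Φ s₀ s₁ '' T) with hK
  have hnonpos : ∀ κ ∈ pseudotype M Φ s₀ s₁ '' T,
      ∫ τ in lowerTypes M Φ s₀ s₁ κ, (pseudotype M Φ s₀ s₁ τ - B) ∂(typeLaw M g) ≤ 0 := by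
    rintro _ ⟨τ, ⟨hτ, hτB⟩, rfl⟩
    rw [key]
    rcases (S.pseudotype_nonneg hΦ hreg hτ).eq_or_lt with h | h
    · rw [← h, S.lowerTypes_zero hΦ hreg]
      simp
    · have h1 := S.count_pos hΦ hreg hg hτ h
      rw [S.lowerMean_eq hΦ hreg hg, div_lt_iff₀ h1] at hτB
      linarith
  have hKle : ∫ τ in lowerTypes M Φ s₀ s₁ K, (pseudotype M Φ s₀ s₁ τ - B) ∂(typeLaw M g) ≤ 0 :=
    closure_minimal (t := {κ | ∫ τ in lowerTypes M Φ s₀ s₁ κ, (pseudotype M Φ s₀ s₁ τ - B)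
      ∂(typeLaw M g) ≤ 0}) hnonpos
      (isClosed_le (S.continuous_sum_sub hΦ hreg hg B) continuous_const)
      (csSup_mem_closure (hne.image _) hbdd)
  -- Up to a level set, `T` consists of the types below its supremum.
  have hae : T =ᵐ[typeLaw M g] lowerTypes M Φ s₀ s₁ K := by
    have hlevel : ∀ᵐ τ ∂(typeLaw M g), pseudotype M Φ s₀ s₁ τ ≠ K := by
      rw [ae_iff]
      simpa using S.typeLaw_level (g := g) hΦ hreg K
    rw [Filter.eventuallyEq_set]
    filter_upwards [hlevel] with τ hτ
    constructor
    · intro h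
      exact ⟨h.1, lt_of_le_of_ne (le_csSup hbdd ⟨τ, h, rfl⟩) hτ⟩
    · rintro ⟨h1, h2⟩
      obtain ⟨_, ⟨τ', hτ', rfl⟩, hlt⟩ := exists_lt_of_lt_csSup (hne.image _) h2
      exact ⟨h1, (S.lowerMean_lt hΦ hreg hg h1 hτ'.1 hlt).trans hτ'.2⟩
  have h1 := key T
  rw [setIntegral_congr_set hae] at h1
  linarith

end IsSeparable

end

/-! ### The two-moment equilibrium -/

section

variable {M : CostModel} {Φ : ℝ × ℝ → ℝ} {s₀ s₁ : ℝ} {g : ℝ × ℝ → ℝ}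

/-- The strategy under which every type bids its optimal contract among those whose score costs
the mean pseudotype of the weaker types, as in a first-price auction with values given by the
pseudotypes. -/
noncomputable def meanBid (M : CostModel) (Φ : ℝ × ℝ → ℝ) (s₀ s₁ : ℝ) (τ : ℝ × ℝ)
    (g : ℝ × ℝ → ℝ) : ℝ × ℝ :=
  contractAt M Φ s₀ s₁ τ (lowerMean M Φ s₀ s₁ g (pseudotype M Φ s₀ s₁ τ))

namespace IsSeparable

lemma measurable_lowerMean (S : IsSeparable M Φ s₀ s₁) (hΦ : IsScoringRule Φ)
    (hreg : IsRegular M Φ) (hg : g ∈ densities M) : Measurable (lowerMean M Φ s₀ s₁ g) := by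
  have := isProbabilityMeasure_typeLaw hg
  have hint := S.integrable_pseudotype hΦ hreg hg
  have hsub : ∀ {κ κ' : ℝ}, κ ≤ κ' → lowerTypes M Φ s₀ s₁ κ ⊆ lowerTypes M Φ s₀ s₁ κ' :=
    fun h τ hτ => ⟨hτ.1, hτ.2.trans_le h⟩
  rw [funext (S.lowerMean_eq hΦ hreg hg)]
  refine Measurable.div (Monotone.measurable fun κ κ' h => ?_)
    (Monotone.measurable fun κ κ' h => measureReal_mono (hsub h))
  refine setIntegral_mono_set hint.integrableOn ?_ (hsub h).eventuallyLE
  filter_upwards [ae_restrict_mem (S.measurableSet_lowerTypes hΦ hreg κ')] with τ hτ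
    using S.pseudotype_nonneg hΦ hreg hτ.1

lemma measurable_meanBid (S : IsSeparable M Φ s₀ s₁) (hΦ : IsScoringRule Φ)
    (hreg : IsRegular M Φ) (hg : g ∈ densities M) :
    Measurable fun τ => meanBid M Φ s₀ s₁ τ g := by
  have hk := (S.continuous_pseudotype hΦ hreg).measurable
  have hA : Measurable fun τ : ℝ × ℝ => unitDrop M Φ s₀ s₁ τ.1 :=
    (S.continuous_unitDrop hΦ hreg).measurable.comp measurable_fst
  have hb := (S.measurable_lowerMean hΦ hreg hg).comp hk
  have h₀ : Measurable fun τ : ℝ × ℝ => optOutput M Φ s₀ τ.1 :=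
    (antitone_optOutput hΦ hreg S.mem₀).measurable.comp measurable_fst
  have h₁ : Measurable fun τ : ℝ × ℝ => optOutput M Φ s₁ τ.1 :=
    (antitone_optOutput hΦ hreg S.mem₁).measurable.comp measurable_fst
  have ho : Measurable fun τ : ℝ × ℝ => outputAt M Φ s₀ s₁ τ.1
      (lowerMean M Φ s₀ s₁ g (pseudotype M Φ s₀ s₁ τ)) := h₀.add ((h₁.sub h₀).mul hb)
  exact (((hA.mul (hk.sub hb)).add measurable_snd).add (measurable_fst.mul ho)).prodMk
    (ho.pow_const _)

lemma meanBid_spec (S : IsSeparable M Φ s₀ s₁) (hΦ : IsScoringRule Φ)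
    (hreg : IsRegular M Φ) (hg : g ∈ densities M) {τ : ℝ × ℝ} (hτ : τ ∈ M.types) :
    meanBid M Φ s₀ s₁ τ g ∈ contracts ∧ s₀ ≤ Φ (meanBid M Φ s₀ s₁ τ g) ∧
      scoreCost M Φ s₀ s₁ (Φ (meanBid M Φ s₀ s₁ τ g)) =
        lowerMean M Φ s₀ s₁ g (pseudotype M Φ s₀ s₁ τ) ∧
      M.profit τ (meanBid M Φ s₀ s₁ τ g) = unitDrop M Φ s₀ s₁ τ.1 *
        (pseudotype M Φ s₀ s₁ τ - lowerMean M Φ s₀ s₁ g (pseudotype M Φ s₀ s₁ τ)) := by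
  have h := S.lowerMean_mem' hΦ hreg hg hτ
  have h' := S.exists_score hΦ hreg hτ h.1 h.2
  exact ⟨h'.1, h'.2.1, h'.2.2.1, h'.2.2.2.1⟩

lemma score_meanBid_lt_iff (S : IsSeparable M Φ s₀ s₁) (hΦ : IsScoringRule Φ)
    (hreg : IsRegular M Φ) (hg : g ∈ densities M) {τ : ℝ × ℝ} (hτ : τ ∈ M.types) {t : ℝ}
    (ht : t ∈ scores Φ) : Φ (meanBid M Φ s₀ s₁ τ g) < t ↔
      lowerMean M Φ s₀ s₁ g (pseudotype M Φ s₀ s₁ τ) < scoreCost M Φ s₀ s₁ t := by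
  have h := S.meanBid_spec hΦ hreg hg hτ
  rw [← h.2.2.1]
  exact ((S.scoreCost_strictMono hΦ hreg).lt_iff_lt ⟨_, h.1, rfl⟩ ht).symm

lemma score_meanBid_eq_iff (S : IsSeparable M Φ s₀ s₁) (hΦ : IsScoringRule Φ)
    (hreg : IsRegular M Φ) (hg : g ∈ densities M) {τ : ℝ × ℝ} (hτ : τ ∈ M.types) {t : ℝ}
    (ht : t ∈ scores Φ) : Φ (meanBid M Φ s₀ s₁ τ g) = t ↔
      lowerMean M Φ s₀ s₁ g (pseudotype M Φ s₀ s₁ τ) = scoreCost M Φ s₀ s₁ t := by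
  have h := S.meanBid_spec hΦ hreg hg hτ
  rw [← h.2.2.1]
  exact ((S.scoreCost_strictMono hΦ hreg).injOn.eq_iff ⟨_, h.1, rfl⟩ ht).symm

/-- Ties have probability zero under `meanBid`. -/
lemma winProb_meanBid (S : IsSeparable M Φ s₀ s₁) (hΦ : IsScoringRule Φ)
    (hreg : IsRegular M Φ) (hg : g ∈ densities M) {t : ℝ} (ht : t ∈ scores Φ) :
    winProb M Φ g (fun τ => meanBid M Φ s₀ s₁ τ g) t = (typeLaw M g).real
      {τ | τ ∈ M.types ∧
        lowerMean M Φ s₀ s₁ g (pseudotype M Φ s₀ s₁ τ) < scoreCost M Φ s₀ s₁ t} := by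
  have hX : AEMeasurable (fun τ => Φ (meanBid M Φ s₀ s₁ τ g)) (typeLaw M g) :=
    aemeasurable_score hΦ
      ((S.measurable_meanBid hΦ hreg hg).comp measurable_subtype_coe)
      fun τ hτ => (S.meanBid_spec hΦ hreg hg hτ).1
  rw [winProb_eq hg hX]
  have h0 : typeLaw M g {τ | Φ (meanBid M Φ s₀ s₁ τ g) = t} = 0 := by
    by_cases hex : ∃ τ ∈ M.types, Φ (meanBid M Φ s₀ s₁ τ g) = t
    · obtain ⟨τ, hτ, h⟩ := hex
      refine measure_mono_null_ae ?_ (S.typeLaw_level (g := g) hΦ hreg (pseudotype M Φ s₀ s₁ τ))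
      filter_upwards [ae_typeLaw_mem (M := M) (g := g)] with τ' hτ' h'
      rw [S.score_meanBid_eq_iff hΦ hreg hg hτ ht] at h
      have h2 := (S.score_meanBid_eq_iff hΦ hreg hg hτ' ht).1 h'
      refine le_antisymm (not_lt.1 fun hlt => ?_) (not_lt.1 fun hlt => ?_)
      · exact (S.lowerMean_lt hΦ hreg hg hτ hτ' hlt).ne (h.trans h2.symm)
      · exact (S.lowerMean_lt hΦ hreg hg hτ' hτ hlt).ne (h2.trans h.symm)
    · refine measure_mono_null_ae ?_ measure_empty
      filter_upwards [ae_typeLaw_mem (M := M) (g := g)] with τ hτ h using hex ⟨τ, hτ, h⟩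
  rw [measureReal_def (typeLaw M g) {τ | Φ (meanBid M Φ s₀ s₁ τ g) = t}, h0]
  simp only [ENNReal.toReal_zero, mul_zero, add_zero]
  refine measureReal_congr ?_
  rw [Filter.eventuallyEq_set]
  filter_upwards [ae_typeLaw_mem (M := M) (g := g)] with τ hτ
  exact (S.score_meanBid_lt_iff hΦ hreg hg hτ ht).trans ⟨fun h => ⟨hτ, h⟩, fun h => h.2⟩

/-- The sum of the pseudotypes below a type is the expected payment in the common unit. -/
lemma lowerMean_mul_count (S : IsSeparable M Φ s₀ s₁) (hΦ : IsScoringRule Φ)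
    (hreg : IsRegular M Φ) (hg : g ∈ densities M) {τ : ℝ × ℝ} (hτ : τ ∈ M.types) :
    lowerMean M Φ s₀ s₁ g (pseudotype M Φ s₀ s₁ τ) *
      (typeLaw M g).real (lowerTypes M Φ s₀ s₁ (pseudotype M Φ s₀ s₁ τ)) =
      ∫ x in lowerTypes M Φ s₀ s₁ (pseudotype M Φ s₀ s₁ τ), pseudotype M Φ s₀ s₁ x
        ∂(typeLaw M g) := by
  rcases (S.pseudotype_nonneg hΦ hreg hτ).eq_or_lt with h | h
  · rw [← h, S.lowerTypes_zero hΦ hreg]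
    simp
  · rw [S.lowerMean_eq hΦ hreg hg, div_mul_cancel₀ _ (S.count_pos hΦ hreg hg hτ h).ne']

lemma isEquilibrium_meanBid (S : IsSeparable M Φ s₀ s₁) (hΦ : IsScoringRule Φ)
    (hreg : IsRegular M Φ) (hg : g ∈ densities M) :
    IsEquilibrium M Φ g fun τ => meanBid M Φ s₀ s₁ τ g := by
  have := isProbabilityMeasure_typeLaw hg
  refine ⟨(S.measurable_meanBid hΦ hreg hg).comp measurable_subtype_coe,
    fun τ hτ => (S.meanBid_spec hΦ hreg hg hτ).1, fun θ hθ c hc => ?_⟩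
  have ht : Φ c ∈ scores Φ := ⟨c, hc, rfl⟩
  have hspec := S.meanBid_spec hΦ hreg hg hθ
  have hA := S.unitDrop_pos hΦ hreg θ.1
  have hmem := S.lowerMean_mem' hΦ hreg hg hθ
  have hk := S.pseudotype_nonneg hΦ hreg hθ
  have hcount := S.lowerMean_mul_count hΦ hreg hg hθ
  have hset : {τ | τ ∈ M.types ∧ lowerMean M Φ s₀ s₁ g (pseudotype M Φ s₀ s₁ τ) <
      lowerMean M Φ s₀ s₁ g (pseudotype M Φ s₀ s₁ θ)} =
      lowerTypes M Φ s₀ s₁ (pseudotype M Φ s₀ s₁ θ) := by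
    ext τ
    exact and_congr_right fun hτ => S.lowerMean_lt_iff hΦ hreg hg hτ hθ
  rw [S.winProb_meanBid hΦ hreg hg ht, S.winProb_meanBid hΦ hreg hg ⟨_, hspec.1, rfl⟩,
    hspec.2.2.1, hspec.2.2.2, hset]
  set T := {τ | τ ∈ M.types ∧
    lowerMean M Φ s₀ s₁ g (pseudotype M Φ s₀ s₁ τ) < scoreCost M Φ s₀ s₁ (Φ c)} with hT
  have hle : lowerMean M Φ s₀ s₁ g (pseudotype M Φ s₀ s₁ θ) ≤ pseudotype M Φ s₀ s₁ θ := by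
    rcases hmem.2 with h | h
    · exact h.le
    · rwa [h]
  have hpay : 0 ≤ (typeLaw M g).real (lowerTypes M Φ s₀ s₁ (pseudotype M Φ s₀ s₁ θ)) *
      (unitDrop M Φ s₀ s₁ θ.1 * (pseudotype M Φ s₀ s₁ θ -
        lowerMean M Φ s₀ s₁ g (pseudotype M Φ s₀ s₁ θ))) :=
    mul_nonneg measureReal_nonneg (mul_nonneg hA.le (sub_nonneg.2 hle))
  have hprofit := profit_le_indirectUtility hΦ hreg hc θ
  rcases le_or_gt (indirectUtility M Φ (Φ c) θ) 0 with hu | hu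
  · exact (mul_nonpos_of_nonneg_of_nonpos measureReal_nonneg (hprofit.trans hu)).trans hpay
  rcases lt_or_ge (Φ c) s₀ with hlow | hss
  · -- Scores below `s₀` never win.
    have hneg := S.scoreCost_strictMono hΦ hreg ht S.mem₀ hlow
    rw [scoreCost_zero] at hneg
    have hemp : T = ∅ := eq_empty_of_forall_notMem fun τ hτ =>
      (hτ.2.trans hneg).not_ge (S.lowerMean_mem' hΦ hreg hg hτ.1).1
    rw [hemp, measureReal_empty, zero_mul]
    exact hpay
  have hB : 0 ≤ scoreCost M Φ s₀ s₁ (Φ c) := by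
    rw [← scoreCost_zero (M := M) (Φ := Φ) (s₀ := s₀) (s₁ := s₁)]
    exact (S.scoreCost_strictMono hΦ hreg).monotoneOn S.mem₀ ht hss
  rw [S.utility_eq hΦ hreg hθ ht hss hu.le] at hprofit
  have hTm : MeasurableSet T := measurableSet_types.inter (measurableSet_lt
    ((S.measurable_lowerMean hΦ hreg hg).comp (S.continuous_pseudotype hΦ hreg).measurable)
    measurable_const)
  have h1 := S.setIntegral_lowerMean_lt hΦ hreg hg hT
  have h2 := S.setIntegral_le_lowerTypes hΦ hreg hg (pseudotype M Φ s₀ s₁ θ)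
    hTm.nullMeasurableSet
  rw [← hcount] at h2
  have h3 : (pseudotype M Φ s₀ s₁ θ - scoreCost M Φ s₀ s₁ (Φ c)) * (typeLaw M g).real T ≤
      (pseudotype M Φ s₀ s₁ θ - lowerMean M Φ s₀ s₁ g (pseudotype M Φ s₀ s₁ θ)) *
        (typeLaw M g).real (lowerTypes M Φ s₀ s₁ (pseudotype M Φ s₀ s₁ θ)) := by
    linarith
  calc _ ≤ (typeLaw M g).real T * (unitDrop M Φ s₀ s₁ θ.1 *
        (pseudotype M Φ s₀ s₁ θ - scoreCost M Φ s₀ s₁ (Φ c))) :=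
        mul_le_mul_of_nonneg_left hprofit measureReal_nonneg
    _ = unitDrop M Φ s₀ s₁ θ.1 * ((pseudotype M Φ s₀ s₁ θ - scoreCost M Φ s₀ s₁ (Φ c)) *
        (typeLaw M g).real T) := by ring
    _ ≤ _ := mul_le_mul_of_nonneg_left h3 hA.le
    _ = _ := by ring

lemma differentiableAt_contractAt {τ : ℝ × ℝ} {b : ℝ} (h : 0 < outputAt M Φ s₀ s₁ τ.1 b) :
    DifferentiableAt ℝ (contractAt M Φ s₀ s₁ τ) b := by
  have ho : DifferentiableAt ℝ (outputAt M Φ s₀ s₁ τ.1) b :=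
    (differentiableAt_const _).add ((differentiableAt_const _).mul differentiableAt_id)
  refine DifferentiableAt.prodMk ?_ (ho.rpow_const (Or.inl h.ne'))
  exact ((((differentiableAt_const _).sub differentiableAt_id).const_mul _).add_const _).add
    (ho.const_mul _)

open Classical in
lemma isMomentStrategy_meanBid (S : IsSeparable M Φ s₀ s₁) (hΦ : IsScoringRule Φ)
    (hreg : IsRegular M Φ) : IsMomentStrategy M 2 (meanBid M Φ s₀ s₁) := by
  intro θ hθ
  obtain ⟨B, hB⟩ := S.exists_bound hΦ hreg
  have hL := S.measurableSet_lowerTypes hΦ hreg (M := M) (pseudotype M Φ s₀ s₁ θ)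
  have hk := S.pseudotype_nonneg hΦ hreg hθ
  -- The pair of moments whose ratio is the lower mean at the pseudotype of `θ`.
  refine ⟨![(lowerTypes M Φ s₀ s₁ (pseudotype M Φ s₀ s₁ θ)).indicator (pseudotype M Φ s₀ s₁),
    (lowerTypes M Φ s₀ s₁ (pseudotype M Φ s₀ s₁ θ)).indicator fun _ => 1],
    fun x => contractAt M Φ s₀ s₁ θ
      (if 0 < x 0 / x 1 ∧ x 0 / x 1 < pseudotype M Φ s₀ s₁ θ then x 0 / x 1 else 0), ?_, ?_, ?_⟩
  · rw [Fin.forall_fin_two]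
    refine ⟨⟨(S.continuous_pseudotype hΦ hreg).measurable.indicator hL, B, fun τ => ?_⟩,
      ⟨measurable_const.indicator hL, 1, fun τ => ?_⟩⟩
    · simp only [Matrix.cons_val_zero]
      by_cases h : τ ∈ lowerTypes M Φ s₀ s₁ (pseudotype M Φ s₀ s₁ θ)
      · rw [indicator_of_mem h]
        exact hB τ h.1
      · rw [indicator_of_notMem h, abs_zero]
        exact (abs_nonneg _).trans (hB θ hθ)
    · simp only [Matrix.cons_val_one, Matrix.cons_val_zero]
      by_cases h : τ ∈ lowerTypes M Φ s₀ s₁ (pseudotype M Φ s₀ s₁ θ)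
      · rw [indicator_of_mem h, abs_one]
      · rw [indicator_of_notMem h, abs_zero]
        exact zero_le_one
  · intro x
    dsimp only
    split_ifs with h
    · exact (S.exists_score hΦ hreg hθ h.1.le (Or.inl h.2)).1
    · exact (S.exists_score hΦ hreg hθ le_rfl (Or.inr rfl)).1
  · intro g hg
    set x : Fin 2 → ℝ := fun i => moment M
      (![(lowerTypes M Φ s₀ s₁ (pseudotype M Φ s₀ s₁ θ)).indicator (pseudotype M Φ s₀ s₁),
        (lowerTypes M Φ s₀ s₁ (pseudotype M Φ s₀ s₁ θ)).indicator fun _ => 1] i) g with hx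
    have hratio : x 0 / x 1 = lowerMean M Φ s₀ s₁ g (pseudotype M Φ s₀ s₁ θ) := rfl
    rcases hk.eq_or_lt with h0 | h0
    · have hif : ∀ y : Fin 2 → ℝ,
          (if 0 < y 0 / y 1 ∧ y 0 / y 1 < pseudotype M Φ s₀ s₁ θ then y 0 / y 1 else 0) = 0 :=
        fun y => if_neg fun h => (h.1.trans h.2).ne h0
      simp only [hif]
      refine ⟨differentiableAt_const _, ?_⟩
      rw [meanBid, ← h0, S.lowerMean_zero hΦ hreg]
    · have hm := S.lowerMean_mem hΦ hreg hg hθ h0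
      have hx1 : x 1 ≠ 0 := by
        have := S.count_pos hΦ hreg hg hθ h0
        rw [← S.moment_count hΦ hreg hg] at this
        exact this.ne'
      rw [← hratio] at hm
      refine ⟨?_, by dsimp only; rw [if_pos hm]; rfl⟩
      have hdiv : DifferentiableAt ℝ (fun y : Fin 2 → ℝ => y 0 / y 1) x := by
        fun_prop (disch := exact hx1)
      have hpos := (S.exists_score hΦ hreg hθ hm.1.le (Or.inl hm.2)).2.2.2.2
      refine DifferentiableAt.congr_of_eventuallyEq
        ((differentiableAt_contractAt hpos).comp x hdiv) ?_
      have hc := hdiv.continuousAt.tendsto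
      filter_upwards [hc.eventually_const_lt hm.1, hc.eventually_lt_const hm.2] with y h1 h2
      rw [if_pos ⟨h1, h2⟩]
      rfl

end IsSeparable

/-- Separability of the payoffs suffices for two moments: bidding the mean pseudotype of the
weaker types is an equilibrium. -/
lemma IsSeparable.implementable (S : IsSeparable M Φ s₀ s₁) (hΦ : IsScoringRule Φ)
    (hreg : IsRegular M Φ) : Implementable M Φ 2 :=
  ⟨meanBid M Φ s₀ s₁, fun _ hg => S.isEquilibrium_meanBid hΦ hreg hg,
    S.isMomentStrategy_meanBid hΦ hreg⟩

end

end ScoreAuction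

theorem theorem1 (M : ScoreAuction.CostModel) (Φ : ℝ × ℝ → ℝ)
    (hΦ : ScoreAuction.IsScoringRule Φ) (hreg : ScoreAuction.IsRegular M Φ) :
    Xor (ScoreAuction.Implementable M Φ 2)
      (∀ n : ℕ, ¬ ScoreAuction.Implementable M Φ n) := by
  by_cases h : ∃ n, ScoreAuction.Implementable M Φ n
  · obtain ⟨n, hn⟩ := h
    obtain ⟨s₀, s₁, S⟩ := ScoreAuction.isSeparable_of_implementable hΦ hreg hn
    exact Or.inl ⟨S.implementable hΦ hreg, fun h => h n hn⟩
  · exact Or.inr ⟨fun n hn => h ⟨n, hn⟩, fun h2 => h ⟨2, h2⟩⟩
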